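/- **Setting.** Let $\Pi$ (decisions), $\Phi$ (measurements) and $\mathcal O$ (observations) be measurable spaces, $\Pi,\Phi$ non-empty, $\mathbf\Pi=\Pi\times\Phi$, and suppose that the $\sigma$-algebra of $\mathcal O$ is countably generated (or that $\mathbf\Pi$ is countable). A *model* is a Markov kernel $M$ from $\mathbf\Pi$ to $\mathcal O$. Let $\mathscr P$ be a finite non-empty collection of sets of models, and $L:\mathscr P\times\Pi\to[0,\infty)$ a loss, measurable in its second argument. Write $\mathrm{co}$ for the convex hull, $\Delta(\cdot)$ for the set of probability measures, and $D_{\rm H}^2(P,Q)=\frac12\int(\sqrt{dP}-\sqrt{dQ})^2$. The hybrid DEC is $$\textsf{p-dec}_\varepsilon(\mathscr P)=\sup_{\bar M\in\mathrm{co}(\bigcup_{\mathcal P\in\mathscr P}\mathcal P)}\ \inf_{p\in\Delta(\Pi),\,q\in\Delta(\mathbf\Pi)}\ \sup\Big\{\mathbb E_{\pi\sim p}L(\mathcal P,\pi)\ :\ \mathcal P\in\mathscr P,\ \inf_{M\in\mathrm{co}(\mathcal P)}\mathbb E_{x\sim q}D_{\rm H}^2(M(x),\bar M(x))\le\varepsilon^2\Big\},$$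 with $\sup\emptyset=0$. Assume that $\bigcup_{\mathcal P\in\mathscr P}\mathrm{co}(\mathcal P)$ has, for every $\varepsilon>0$, a finite $\varepsilon$-covering by its own elements in the distance $\sup_{x\in\mathbf\Pi}D_{\rm H}(M(x),M'(x))$. **Protocol.** For $t=1,\dots,T$, an adaptive environment picks a (possibly random) model $M^t$ given the full history of models, pairs and observations; independently, given the past pairs and observations, the learner picks $x^t\in\mathbf\Pi$; then $o^t\sim M^t(x^t)$ is revealed. The environment is *constrained by* $\mathscr P$ if there is a fixed $\mathcal P^\star\in\mathscr P$ such that always $M^t\in\mathcal P^\star$ almost surely. At the end the learner outputs a law $\widehat p\in\Delta(\Pi)$ depending on the pairs and observations, with risk $\mathbf{Risk}(T)=\mathbb E_{\pi\sim\widehat p}L(\mathcal P^\star,\pi)$. **Algorithm ExO$^+$** (information sets $\mathscr P$, parameter $\gamma>0$, accuracy $\eta\ge0$). Start with $w^1=\mathrm{Unif}(\mathscr P)$. In round $t$ choose $p^t\in\Delta(\Pi)$, $q^t\in\Delta(\mathbf\Pi)$ and a bounded measurable $\xi^t:\mathscr P\times\mathbf\Pi\times\mathcal O\to\mathbb R$,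 measurably in the history, that minimize, up to an additive error $\eta$, $$\Gamma_{w^t,\gamma}(p,q,\xi)=\sup_{\psi\in\mathscr P,\,M\in\psi}\Big\{\mathbb E_{\pi\sim p}L(\psi,\pi)-\gamma\,\mathbb E_{x\sim q}\mathbb E_{o\sim M(x)}\mathbb E_{\psi'\sim w^t}\big[1-e^{\xi(\psi';x,o)-\xi(\psi;x,o)}\big]\Big\};$$ play $x^t\sim q^t$, observe $o^t$, and set $w^{t+1}(\psi)\propto w^t(\psi)\exp(\xi^t(\psi;x^t,o^t))$. Output $\widehat p=\frac1T\sum_{t=1}^Tp^t$. (Accuracy $\eta=0$ is exact minimization.) **Theorem.** There is a universal constant $C$ such that the following holds in every such setting, for all $T\ge1$ and $\delta\in(0,1)$. Put $\bar\varepsilon(\tau)=\sqrt{\log(|\mathscr P|/\delta)/\tau}$. 1. Suppose that $L$ is metric-based, i.e. $L(\mathcal P,\pi)=\rho(\pi_{\mathcal P},\pi)$ for a pseudo-metric $\rho$ on $\Pi$ and a map $\mathcal P\mapsto\pi_{\mathcal P}\in\Pi$, and that the hybrid DEC is of moderate decay with constant $c\ge1$, i.e. $\textsf{p-dec}_{\varepsilon'}(\mathscr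 P)/\varepsilon'\le c\,\textsf{p-dec}_{\varepsilon}(\mathscr P)/\varepsilon$ for $0<\varepsilon\le\varepsilon'\le1$. Then there is $\gamma>0$ such that for every $\eta>0$ there is an execution of ExO$^+$ with parameter $\gamma$ and accuracy $\eta$ which, in every environment constrained by $\mathscr P$, satisfies with probability at least $1-\delta$ $$\mathbf{Risk}(T)\le C\,c\;\textsf{p-dec}_{\bar\varepsilon(T)}(\mathscr P);$$ moreover, for every $\eta\ge0$, every execution of ExO$^+$ with parameter $\gamma$ and accuracy $\eta$ satisfies this bound, with $\eta$ added to the right-hand side. 2. For a general loss bounded in $[0,1]$ and every $\Delta>0$ (no metric structure and no moderate decay being assumed) there is $\gamma>0$ for which the same two assertions hold with the bound $$\mathbf{Risk}(T)\le C\big(\textsf{p-dec}_{\bar\varepsilon(\Delta T)}(\mathscr P)+\Delta\big).$$ -/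

import Mathlib

open MeasureTheory ProbabilityTheory
open scoped ENNReal NNReal

universe u v w z

namespace HybridDMSO

noncomputable section

/-- Squared Hellinger distance `½ ∫ (√dμ - √dν)²`, with densities taken with respect to `μ + ν`
(so it equals `1 - ∫ √(dμ dν)` and lies in `[0, 1]` for probability measures). -/
def hellingerSq {O : Type w} [MeasurableSpace O] (μ ν : Measure O) : ℝ≥0∞ :=
  2⁻¹ * ∫⁻ o, ENNReal.ofReal
    ((√(μ.rnDeriv (μ + ν) o).toReal - √(ν.rnDeriv (μ + ν) o).toReal) ^ 2) ∂(μ + ν)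

/-- A model: a Markov kernel sending a (decision, measurement) pair to a law of the observation. -/
abbrev Model (D : Type u) (Φ : Type v) (O : Type w)
    [MeasurableSpace D] [MeasurableSpace Φ] [MeasurableSpace O] :=
  {M : Kernel (D × Φ) O // IsMarkovKernel M}

section Defs

variable {D : Type u} {Φ : Type v} {O : Type w}
  [MeasurableSpace D] [MeasurableSpace Φ] [MeasurableSpace O]

/-- Convex hull of a set of models: finite pointwise mixtures of its elements. -/
def co (S : Set (Model D Φ O)) : Set (Model D Φ O) :=
  {M | ∃ (n : ℕ) (a : Fin n → ℝ≥0) (N : Fin n → Model D Φ O),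
    ∑ i, a i = 1 ∧ (∀ i, N i ∈ S) ∧ ∀ x, M.1 x = ∑ i, a i • (N i).1 x}

/-- The class `⋃_{P ∈ 𝓒} co P`. -/
def convexifiedClass (𝓒 : Finset (Set (Model D Φ O))) : Set (Model D Φ O) :=
  ⋃ P ∈ 𝓒, co P

/-- The class of reference models `co (⋃_{P ∈ 𝓒} P)`. -/
def referenceModels (𝓒 : Finset (Set (Model D Φ O))) : Set (Model D Φ O) :=
  co (⋃ P ∈ 𝓒, P)

/-- All covering numbers of `S`, for the Hellinger distance uniform over pairs
(decision, measurement), are finite. -/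
def FiniteCovering (S : Set (Model D Φ O)) : Prop :=
  ∀ ε : ℝ, 0 < ε → ∃ S₀ ⊆ S, S₀.Finite ∧
    ∀ M ∈ S, ∃ M' ∈ S₀, ∀ x, hellingerSq (M.1 x) (M'.1 x) ≤ ENNReal.ofReal (ε ^ 2)

/-- The loss is induced by a pseudo-metric on the decision space. -/
def MetricBased {𝓒 : Finset (Set (Model D Φ O))} (L : 𝓒 → D → ℝ≥0) : Prop :=
  ∃ (ρ : PseudoMetricSpace D) (best : 𝓒 → D), ∀ P d, (L P d : ℝ) = ρ.dist (best P) d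

/-- `inf_{M ∈ co P} E_{x ∼ q} D_H²(M(x), Mbar(x))`. -/
def infoGap (P : Set (Model D Φ O)) (q : ProbabilityMeasure (D × Φ)) (Mbar : Model D Φ O) :
    ℝ≥0∞ :=
  ⨅ M ∈ co P, ∫⁻ x, hellingerSq (M.1 x) (Mbar.1 x) ∂(q : Measure (D × Φ))

/-- The hybrid PAC DEC with respect to a reference model. The supremum of the empty set is the least
value `0` of a non-negative loss; replacing it by `-∞` would not change `pDec` below as soon as some
`P ∈ 𝓒` is non-empty, because a reference model taken in `P` gives a non-negative value. -/
def pDecAt (𝓒 : Finset (Set (Model D Φ O))) (L : 𝓒 → D → ℝ≥0) (ε : ℝ) (Mbar : Model D Φ O) :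
    ℝ≥0∞ :=
  ⨅ (p : ProbabilityMeasure D) (q : ProbabilityMeasure (D × Φ)),
    ⨆ (P : 𝓒) (_ : infoGap P.1 q Mbar ≤ ENNReal.ofReal (ε ^ 2)),
      ∫⁻ d, (L P d : ℝ≥0∞) ∂(p : Measure D)

/-- The hybrid PAC DEC of the constraint class `𝓒`. -/
def pDec (𝓒 : Finset (Set (Model D Φ O))) (L : 𝓒 → D → ℝ≥0) (ε : ℝ) : ℝ≥0∞ :=
  ⨆ Mbar ∈ referenceModels 𝓒, pDecAt 𝓒 L ε Mbar

/-- Moderate decay, with constant `c`, of a function on `[0, 1]`. -/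
def ModerateDecay (c : ℝ≥0) (f : ℝ → ℝ≥0∞) : Prop :=
  ∀ ε ε' : ℝ, 0 < ε → ε ≤ ε' → ε' ≤ 1 →
    f ε' / ENNReal.ofReal ε' ≤ c * (f ε / ENNReal.ofReal ε)

/-- `√(log (N / δ) / τ)`. -/
def epsBar (N : ℕ) (δ τ : ℝ) : ℝ := √(Real.log (N / δ) / τ)

/-! ### Interaction protocol -/

/-- What the learner sees in one round: its (decision, measurement) pair and the observation. -/
abbrev Obs (D : Type u) (Φ : Type v) (O : Type w) := (D × Φ) × O

variable (D Φ O) in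
/-- A `T`-round algorithm. `explore t` is the law of the (decision, measurement) pair of round
`t + 1` given the first `t` rounds (used for `t < T`), `output` the law of the output decision. -/
structure Algorithm (T : ℕ) where
  explore : (t : ℕ) → Kernel (Fin t → Obs D Φ O) (D × Φ)
  explore_markov : ∀ t, IsMarkovKernel (explore t)
  output : Kernel (Fin T → Obs D Φ O) D
  output_markov : IsMarkovKernel output

/-- One round with full information: the environment's choice, the pair played, the observation. -/
abbrev Round (D : Type u) (Φ : Type v) (O : Type w) (Z : Type z) := (Z × (D × Φ)) × O

variable (D Φ O) in
/-- An adaptive environment. Its models are labelled by a measurable space `Z` through a jointly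
measurable `model`; `choose t` is the law of the label of the model of round `t + 1` given the full
history (labels of the models, pairs played, observations) of the first `t` rounds. -/
structure Environment (Z : Type z) [MeasurableSpace Z] where
  model : Kernel (Z × (D × Φ)) O
  model_markov : IsMarkovKernel model
  choose : (t : ℕ) → Kernel (Fin t → Round D Φ O Z) Z
  choose_markov : ∀ t, IsMarkovKernel (choose t)

/-- The part of a full history that is visible to the learner. -/
def visible {Z : Type z} {t : ℕ} (h : Fin t → Round D Φ O Z) : Fin t → Obs D Φ O :=
  fun i => ((h i).1.2, (h i).2)

theorem measurable_visible {Z : Type z} [MeasurableSpace Z] (t : ℕ) :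
    Measurable (visible : (Fin t → Round D Φ O Z) → Fin t → Obs D Φ O) := by
  unfold visible
  fun_prop

namespace Environment

variable {Z : Type z} [MeasurableSpace Z]

/-- The model with label `l`. -/
def modelAt (env : Environment D Φ O Z) (l : Z) : Model D Φ O :=
  ⟨env.model.comap (fun x => (l, x)) measurable_prodMk_left, by
    have := env.model_markov
    infer_instance⟩

/-- In each of the `T` rounds, whatever the history, the model is almost surely in `P`. -/
def ConstrainedTo (env : Environment D Φ O Z) (T : ℕ) (P : Set (Model D Φ O)) : Prop :=
  ∀ t < T, ∀ h, ∀ᵐ l ∂(env.choose t h), env.modelAt l ∈ P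

end Environment

/-- One round: given the full history, environment and learner move independently, then the
observation is drawn from the chosen model at the pair played. -/
def roundKernel {Z : Type z} [MeasurableSpace Z] {T : ℕ} (alg : Algorithm D Φ O T)
    (env : Environment D Φ O Z) (t : ℕ) : Kernel (Fin t → Round D Φ O Z) (Round D Φ O Z) :=
  (env.choose t ×ₖ (alg.explore t).comap visible (measurable_visible t)) ⊗ₖ
    env.model.prodMkLeft (Fin t → Round D Φ O Z)

/-- The law of the full history of the first `t` rounds. -/
def historyLaw {Z : Type z} [MeasurableSpace Z] {T : ℕ} (alg : Algorithm D Φ O T)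
    (env : Environment D Φ O Z) : (t : ℕ) → Measure (Fin t → Round D Φ O Z)
  | 0 => Measure.dirac Fin.elim0
  | t + 1 => (historyLaw alg env t ⊗ₘ roundKernel alg env t).map
      fun x => Fin.snoc (α := fun _ => Round D Φ O Z) x.1 x.2

/-- The PAC risk after a history: the expected loss of the output decision. -/
def risk {T : ℕ} {𝓒 : Finset (Set (Model D Φ O))} (alg : Algorithm D Φ O T) (L : 𝓒 → D → ℝ≥0)
    (P : 𝓒) (h : Fin T → Obs D Φ O) : ℝ≥0∞ :=
  ∫⁻ d, (L P d : ℝ≥0∞) ∂(alg.output h)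

/-- In every environment constrained by some `P ∈ 𝓒`, with probability at least `1 - δ` the risk
with respect to `P` is at most `B`. -/
def RiskBound {T : ℕ} {𝓒 : Finset (Set (Model D Φ O))} (alg : Algorithm D Φ O T)
    (L : 𝓒 → D → ℝ≥0) (δ : ℝ) (B : ℝ≥0∞) : Prop :=
  ∀ (Z : Type z) [MeasurableSpace Z] (env : Environment D Φ O Z) (P : 𝓒),
    env.ConstrainedTo T P.1 →
      ENNReal.ofReal (1 - δ) ≤ historyLaw alg env T {h | risk alg L P (visible h) ≤ B}

/-! ### The algorithm ExO⁺, with `𝓒` itself as the information sets -/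

variable {𝓒 : Finset (Set (Model D Φ O))}

/-- The objective `Γ_{w,γ}(p, q, ξ; M, ψ)`. -/
def objectiveAt (L : 𝓒 → D → ℝ≥0) (γ : ℝ) (wt : 𝓒 → ℝ) (p : Measure D) (q : Measure (D × Φ))
    (ξ : 𝓒 → Obs D Φ O → ℝ) (M : Model D Φ O) (ψ : 𝓒) : EReal :=
  ((∫⁻ d, (L ψ d : ℝ≥0∞) ∂p : ℝ≥0∞) : EReal) -
    ((γ * ∫ x, ∫ o, ∑ ψ', wt ψ' * (1 - Real.exp (ξ ψ' (x, o) - ξ ψ (x, o))) ∂(M.1 x) ∂q : ℝ) :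
      EReal)

/-- The worst-case objective `Γ_{w,γ}(p, q, ξ)`, the supremum over `ψ ∈ 𝓒` and `M ∈ ψ`. -/
def objective (L : 𝓒 → D → ℝ≥0) (γ : ℝ) (wt : 𝓒 → ℝ) (p : Measure D) (q : Measure (D × Φ))
    (ξ : 𝓒 → Obs D Φ O → ℝ) : EReal :=
  ⨆ ψ : 𝓒, ⨆ M ∈ ψ.1, objectiveAt L γ wt p q ξ M ψ

/-- Weight functions: measurable and uniformly bounded. -/
def weightFunctions (𝓒 : Finset (Set (Model D Φ O))) : Set (𝓒 → Obs D Φ O → ℝ) :=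
  {ξ | (∀ ψ, Measurable (ξ ψ)) ∧ ∃ A : ℝ, ∀ ψ x, |ξ ψ x| ≤ A}

/-- The infimum of the worst-case objective. -/
def exo (L : 𝓒 → D → ℝ≥0) (γ : ℝ) (wt : 𝓒 → ℝ) : EReal :=
  ⨅ (p : ProbabilityMeasure D) (q : ProbabilityMeasure (D × Φ)) (ξ ∈ weightFunctions 𝓒),
    objective L γ wt (p : Measure D) (q : Measure (D × Φ)) ξ

/-- Exponential weights after a history, from the uniform prior; `ξ t h` is the weight function used
in round `t + 1` after the history `h`. -/
def expWeights (ξ : (t : ℕ) → (Fin t → Obs D Φ O) → 𝓒 → Obs D Φ O → ℝ) :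
    (t : ℕ) → (Fin t → Obs D Φ O) → 𝓒 → ℝ
  | 0, _ => fun _ => (𝓒.card : ℝ)⁻¹
  | t + 1, h => fun ψ =>
      expWeights ξ t (Fin.init h) ψ * Real.exp (ξ t (Fin.init h) ψ (h (Fin.last t))) /
        ∑ ψ', expWeights ξ t (Fin.init h) ψ' * Real.exp (ξ t (Fin.init h) ψ' (h (Fin.last t)))

/-- `alg` is an execution of ExO⁺ (option PAC, information sets `𝓒`, uniform prior, parameter `γ`)
in which every exploration-by-optimization problem is solved up to an additive error `η`; `η = 0`
is exact minimization. The output law is the average of the exploitation laws `p t`. -/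
def IsExOPlus {T : ℕ} (alg : Algorithm D Φ O T) (L : 𝓒 → D → ℝ≥0) (γ : ℝ) (η : ℝ≥0) : Prop :=
  ∃ (p : (t : ℕ) → Kernel (Fin t → Obs D Φ O) D)
    (ξ : (t : ℕ) → (Fin t → Obs D Φ O) → 𝓒 → Obs D Φ O → ℝ),
    (∀ t, IsMarkovKernel (p t)) ∧
    (∀ t ψ, Measurable fun y : (Fin t → Obs D Φ O) × Obs D Φ O => ξ t y.1 ψ y.2) ∧
    (∀ t h, ξ t h ∈ weightFunctions 𝓒) ∧
    (∀ t < T, ∀ h, objective L γ (expWeights ξ t h) (p t h) (alg.explore t h) (ξ t h) ≤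
      exo L γ (expWeights ξ t h) + ((η : ℝ) : EReal)) ∧
    ∀ h, alg.output h =
      (T : ℝ≥0∞)⁻¹ • ∑ t : Fin T, p t (fun i => h (Fin.castLE t.isLt.le i))

end Defs

end

end HybridDMSO

/-! Exponential weights reduce the risk bound to bounding the value of a one-round game. The update
multiplies 1/w(P) by `1 - gap`, whose conditional mean is `1 - info`. If the objective never exceeds
B, a model in P forces (ℓ - B)/γ ≤ `info`, so exp((∑ ℓ - tB)/γ) / (|𝓒| w(P)) is a supermartingale
started at 1. As w(P) ≤ 1, Markov's inequality bounds the average loss by B + γ log(|𝓒|/δ)/T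
(`lintegral_potential_le_one`, `risk_bound_of_objective_le`).

It remains to bound `exo` uniformly over the weights. The learner's side is convex-like
(`exists_info_mixture_ge`) and finite coverings make the adversary finite, so a Hahn–Banach minimax
argument lets the adversary commit first to a finitely supported law of (ψ, M). The learner answers
with half the log-ratio of the smoothed posterior of ψ to w. Up to a factor 4 and smoothing, the
information is then at least the mean squared Hellinger distance between the mixture of the models
given ψ, an element of `co ψ`, and the overall mixture, an admissible reference model
(`exists_weightFunction_info_ge`). Hence an offset form of the DEC with coefficient γ bounds `exo`
with coefficient 4γ (`exo_le`).

The offset form follows from the constrained one. For bounded losses, an information set farther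
than ε pays a penalty of at least 1. For metric losses, one explores all dyadic radii with geometric
weights and plays the best decision of the information set nearest to the reference model. At radius
2^k ε the loss is of order c 2^k v, with v the DEC at ε, while the mixed squared distance is of
order 2^k ε², so a coefficient of order c v/ε² suffices (`offsetBound_of_metricBased`). With ε² =
log(|𝓒|/δ)/τ the term γ log(|𝓒|/δ)/T has the right order. The case v = 0, where this γ would vanish,
is treated apart.

Measurable near-optimal executions exist because, for a fixed triple (p, q, ξ), the objective is
upper semicontinuous in the weights; a countable family of triples then suffices. -/

namespace HybridDMSO

noncomputable section

/-! ### Squared Hellinger distance -/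

section Hellinger

variable {O : Type w} [MeasurableSpace O]

/-- Squared Hellinger distance from a measure with a density with respect to the other one. -/
theorem hellingerSq_withDensity (ν : Measure O) [IsFiniteMeasure ν] {f : O → ℝ≥0}
    (hf : Measurable f) [IsFiniteMeasure (ν.withDensity fun o => (f o : ℝ≥0∞))] :
    hellingerSq (ν.withDensity fun o => (f o : ℝ≥0∞)) ν =
      2⁻¹ * ∫⁻ o, ENNReal.ofReal ((√(f o) - 1) ^ 2) ∂ν := by
  have hsum : (ν.withDensity fun o => (f o : ℝ≥0∞)) + ν =
      ν.withDensity (fun o => ((f o + 1 : ℝ≥0) : ℝ≥0∞)) := by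
    have : (fun o => ((f o + 1 : ℝ≥0) : ℝ≥0∞)) = (fun o => (f o : ℝ≥0∞)) + 1 := by
      ext o; simp
    rw [this, withDensity_add_left (by fun_prop), withDensity_one]
  set σ := (ν.withDensity fun o => (f o : ℝ≥0∞)) + ν with hσ
  have hpos : ∀ o, (f o + 1 : ℝ≥0) ≠ 0 := fun o => by positivity
  -- With σ = (f + 1) ν, the two densities are f/(f + 1) and 1/(f + 1); the common factor cancels
  -- against the density of σ.
  have key : ∀ g : O → ℝ≥0, Measurable g →
      σ.withDensity (fun o => ((g o / (f o + 1) : ℝ≥0) : ℝ≥0∞)) =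
        ν.withDensity fun o => (g o : ℝ≥0∞) := by
    intro g hg
    rw [hsum, ← withDensity_mul _ (by fun_prop) (by fun_prop)]
    congr 1
    ext o
    simp only [Pi.mul_apply]
    rw [← ENNReal.coe_mul, mul_div_cancel₀ _ (hpos o)]
  have h1 := Measure.rnDeriv_withDensity σ
    (f := fun o => ((f o / (f o + 1) : ℝ≥0) : ℝ≥0∞)) (by fun_prop)
  have h2 := Measure.rnDeriv_withDensity σ
    (f := fun o => (((1 : O → ℝ≥0) o / (f o + 1) : ℝ≥0) : ℝ≥0∞)) (by fun_prop)
  rw [key f hf] at h1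
  rw [key 1 measurable_one] at h2
  have h3 : (ν.withDensity fun o => (((1 : O → ℝ≥0) o : ℝ≥0) : ℝ≥0∞)) = ν := by
    simp
  rw [h3] at h2
  unfold hellingerSq
  rw [← hσ]
  congr 1
  calc _ = ∫⁻ o, ENNReal.ofReal ((√(f o / (f o + 1) : ℝ) - √(1 / (f o + 1) : ℝ)) ^ 2) ∂σ := by
        refine lintegral_congr_ae ?_
        filter_upwards [h1, h2] with o ho1 ho2
        rw [ho1, ho2]
        simp only [ENNReal.coe_toReal, NNReal.coe_div, NNReal.coe_add, NNReal.coe_one,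
          Pi.one_apply]
    _ = _ := by
        rw [hsum, lintegral_withDensity_eq_lintegral_mul _ (by fun_prop) (by fun_prop)]
        refine lintegral_congr fun o => ?_
        simp only [Pi.mul_apply]
        have hp : (0 : ℝ) < f o + 1 := by positivity
        rw [← ENNReal.ofReal_coe_nnreal, ← ENNReal.ofReal_mul (by positivity)]
        congr 1
        rw [Real.sqrt_div (by positivity), Real.sqrt_div (by positivity), ← sub_div, div_pow,
          Real.sq_sqrt hp.le]
        push_cast
        rw [mul_div_cancel₀ _ hp.ne', Real.sqrt_one]

/-- Pointwise (√a - √b)² ≤ a + b, and each density has integral at most 1. -/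
theorem hellingerSq_le_one (μ ν : Measure O) [IsProbabilityMeasure μ] [IsProbabilityMeasure ν] :
    hellingerSq μ ν ≤ 1 := by
  have hle : ∀ a b : ℝ≥0∞, ENNReal.ofReal ((√a.toReal - √b.toReal) ^ 2) ≤ a + b := by
    intro a b
    calc ENNReal.ofReal ((√a.toReal - √b.toReal) ^ 2)
        ≤ ENNReal.ofReal (a.toReal + b.toReal) := by
          apply ENNReal.ofReal_le_ofReal
          have h1 := Real.sq_sqrt (ENNReal.toReal_nonneg (a := a))
          have h2 := Real.sq_sqrt (ENNReal.toReal_nonneg (a := b))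
          nlinarith [mul_nonneg (Real.sqrt_nonneg a.toReal) (Real.sqrt_nonneg b.toReal)]
      _ ≤ ENNReal.ofReal a.toReal + ENNReal.ofReal b.toReal := ENNReal.ofReal_add_le
      _ ≤ a + b := add_le_add ENNReal.ofReal_toReal_le ENNReal.ofReal_toReal_le
  calc hellingerSq μ ν
      ≤ 2⁻¹ * ∫⁻ o, (μ.rnDeriv (μ + ν) o + ν.rnDeriv (μ + ν) o) ∂(μ + ν) := by
        unfold hellingerSq
        gcongr
        exact hle _ _
    _ ≤ 2⁻¹ * (1 + 1) := by
        rw [lintegral_add_left (Measure.measurable_rnDeriv _ _)]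
        gcongr
        · exact (Measure.lintegral_rnDeriv_le).trans prob_le_one
        · exact (Measure.lintegral_rnDeriv_le).trans prob_le_one
    _ = 1 := by
        rw [one_add_one_eq_two, ENNReal.inv_mul_cancel (by simp) (by simp)]

/-- Expectations of a bounded function under laws that are close in Hellinger distance. -/
theorem abs_integral_sub_le_of_hellingerSq (μ ν : Measure O) [IsProbabilityMeasure μ]
    [IsProbabilityMeasure ν] {g : O → ℝ} (hg : Measurable g) {G : ℝ} (hG : ∀ o, |g o| ≤ G)
    {ε : ℝ} (hε : 0 < ε) (h : hellingerSq μ ν ≤ ENNReal.ofReal (ε ^ 2)) :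
    |∫ o, g o ∂μ - ∫ o, g o ∂ν| ≤ 3 * ε * G := by
  set σ := μ + ν with hσ
  have hμ : μ ≪ σ := Measure.absolutelyContinuous_of_le (Measure.le_add_right le_rfl)
  have hν : ν ≪ σ := Measure.absolutelyContinuous_of_le (Measure.le_add_left le_rfl)
  set a : O → ℝ := fun o => (μ.rnDeriv σ o).toReal with ha
  set b : O → ℝ := fun o => (ν.rnDeriv σ o).toReal with hb
  have ham : Measurable a := (Measure.measurable_rnDeriv _ _).ennreal_toReal
  have hbm : Measurable b := (Measure.measurable_rnDeriv _ _).ennreal_toReal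
  have hai : Integrable a σ := Measure.integrable_toReal_rnDeriv
  have hbi : Integrable b σ := Measure.integrable_toReal_rnDeriv
  have ha1 : ∫ o, a o ∂σ = 1 := by
    rw [Measure.integral_toReal_rnDeriv hμ]; simp
  have hb1 : ∫ o, b o ∂σ = 1 := by
    rw [Measure.integral_toReal_rnDeriv hν]; simp
  have hG0 : 0 ≤ G := by
    obtain ⟨o⟩ : Nonempty O := nonempty_of_isProbabilityMeasure μ
    exact (abs_nonneg _).trans (hG o)
  have hagi : Integrable (fun o => a o * g o) σ :=
    hai.mul_bdd (c := G) hg.aestronglyMeasurable (by simpa using .of_forall hG)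
  have hbgi : Integrable (fun o => b o * g o) σ :=
    hbi.mul_bdd (c := G) hg.aestronglyMeasurable (by simpa using .of_forall hG)
  have hμg : ∫ o, g o ∂μ = ∫ o, a o * g o ∂σ := by
    rw [← integral_rnDeriv_smul hμ]; rfl
  have hνg : ∫ o, g o ∂ν = ∫ o, b o * g o ∂σ := by
    rw [← integral_rnDeriv_smul hν]; rfl
  set s : O → ℝ := fun o => (√(a o) - √(b o)) ^ 2 with hs
  have ha0 : ∀ o, 0 ≤ a o := fun o => ENNReal.toReal_nonneg
  have hb0 : ∀ o, 0 ≤ b o := fun o => ENNReal.toReal_nonneg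
  have hsm : Measurable s := by fun_prop
  have hsle : ∀ o, s o ≤ a o + b o := by
    intro o
    have h1 := Real.sq_sqrt (ha0 o)
    have h2 := Real.sq_sqrt (hb0 o)
    simp only [hs]
    nlinarith [mul_nonneg (Real.sqrt_nonneg (a o)) (Real.sqrt_nonneg (b o))]
  have hsi : Integrable s σ := by
    refine (hai.add hbi).mono' hsm.aestronglyMeasurable (.of_forall fun o => ?_)
    rw [Real.norm_of_nonneg (sq_nonneg _)]
    exact hsle o
  have hsint : ∫ o, s o ∂σ ≤ 2 * ε ^ 2 := by
    have h' : ∫⁻ o, ENNReal.ofReal (s o) ∂σ ≤ ENNReal.ofReal (2 * ε ^ 2) := by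
      have : ∫⁻ o, ENNReal.ofReal (s o) ∂σ = 2 * hellingerSq μ ν := by
        unfold hellingerSq
        rw [← mul_assoc, ENNReal.mul_inv_cancel (by simp) (by simp), one_mul]
      rw [this, ENNReal.ofReal_mul (by norm_num)]
      simpa using mul_le_mul_right h 2
    rw [← ofReal_integral_eq_lintegral_ofReal hsi (.of_forall fun o => sq_nonneg _)] at h'
    exact (ENNReal.ofReal_le_ofReal_iff (by positivity)).1 h'
  rw [hμg, hνg, ← integral_sub hagi hbgi]
  calc |∫ o, a o * g o - b o * g o ∂σ|
      ≤ ∫ o, |a o * g o - b o * g o| ∂σ := abs_integral_le_integral_abs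
    _ ≤ ∫ o, G * ((2 * ε)⁻¹ * s o + ε * (a o + b o)) ∂σ := by
        refine integral_mono (hagi.sub hbgi).abs
          (((hsi.const_mul _).add ((hai.add hbi).const_mul _)).const_mul _) fun o => ?_
        have h1 := Real.sq_sqrt (ha0 o)
        have h2 := Real.sq_sqrt (hb0 o)
        -- Factor a - b = (√a - √b)(√a + √b) and apply AM-GM with weight ε, using (√a + √b)² ≤ 2(a +
        -- b). Integrated, the two terms contribute ε and 2ε, whence the constant 3.
        have hab : |a o - b o| ≤ (2 * ε)⁻¹ * s o + ε * (a o + b o) := by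
          set x := √(a o)
          set y := √(b o)
          have hx : 0 ≤ x := Real.sqrt_nonneg _
          have hy : 0 ≤ y := Real.sqrt_nonneg _
          have hfac : |a o - b o| = |x - y| * (x + y) := by
            rw [← h1, ← h2, sq_sub_sq, abs_mul, abs_of_nonneg (add_nonneg hx hy), mul_comm]
          have hsq : s o = |x - y| ^ 2 := by rw [sq_abs]
          rw [hfac, hsq, ← h1, ← h2]
          have : 0 ≤ (2 * ε)⁻¹ * (|x - y| - ε * (x + y)) ^ 2 := by positivity
          have e : (2 * ε)⁻¹ * (|x - y| - ε * (x + y)) ^ 2 =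
              (2 * ε)⁻¹ * |x - y| ^ 2 - |x - y| * (x + y) + ε / 2 * (x + y) ^ 2 := by
            field_simp
            ring
          nlinarith [sq_nonneg (x - y)]
        simp only [← sub_mul, abs_mul]
        rw [mul_comm]
        exact mul_le_mul (hG o) hab (abs_nonneg _) hG0
    _ = G * ((2 * ε)⁻¹ * ∫ o, s o ∂σ + ε * (1 + 1)) := by
        have h1 : ∫ o, (a o + b o) ∂σ = 1 + 1 := by rw [integral_add hai hbi, ha1, hb1]
        have h2 : Integrable (fun o => ε * (a o + b o)) σ := (hai.add hbi).const_mul _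
        rw [integral_const_mul, integral_add (hsi.const_mul _) h2,
          integral_const_mul, integral_const_mul, h1]
    _ ≤ G * ((2 * ε)⁻¹ * (2 * ε ^ 2) + ε * (1 + 1)) := by gcongr
    _ = 3 * ε * G := by field_simp; ring

end Hellinger

/-! ### Finite-dimensional minimax inequality -/

section Minimax

/-- A minimax inequality for a convex-like family of vectors in a finite dimensional space. -/
theorem exists_forall_lt_of_convexlike {ι X : Type*} [Fintype ι] [Nonempty X] (V : X → ι → ℝ)
    (hV : ∀ x y : X, ∀ a b : ℝ, 0 ≤ a → 0 ≤ b → a + b = 1 →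
      ∃ z, ∀ i, V z i ≤ a * V x i + b * V y i) {B s : ℝ} (hs : 0 < s)
    (hB : ∀ μ : ι → ℝ, (∀ i, 0 ≤ μ i) → ∑ i, μ i = 1 → ∃ x, ∑ i, μ i * V x i ≤ B) :
    ∃ x, ∀ i, V x i < B + s := by
  classical
  by_contra hcon
  push Not at hcon
  -- Failure of the conclusion means that this open orthant misses the upward closure `K` of the
  -- range of `V`. A separating functional, once normalized, is a mixed strategy contradicting `hB`.
  set U : Set (ι → ℝ) := Set.univ.pi fun _ => Set.Iio (B + s) with hU
  set K : Set (ι → ℝ) := {v | ∃ x, ∀ i, V x i ≤ v i} with hK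
  have hUc : Convex ℝ U := convex_pi fun _ _ => convex_Iio _
  have hUo : IsOpen U := isOpen_set_pi Set.finite_univ fun _ _ => isOpen_Iio
  have hKc : Convex ℝ K := by
    rintro v ⟨x, hx⟩ v' ⟨y, hy⟩ a b ha hb hab
    obtain ⟨z, hz⟩ := hV x y a b ha hb hab
    refine ⟨z, fun i => (hz i).trans ?_⟩
    simp only [Pi.add_apply, Pi.smul_apply, smul_eq_mul]
    exact add_le_add (mul_le_mul_of_nonneg_left (hx i) ha) (mul_le_mul_of_nonneg_left (hy i) hb)
  have hdisj : Disjoint U K := by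
    rw [Set.disjoint_left]
    rintro v hvU ⟨x, hx⟩
    obtain ⟨i, hi⟩ := hcon x
    exact absurd ((hi.trans (hx i)).trans_lt (hvU i trivial)) (lt_irrefl _)
  obtain ⟨f, u, hfU, hfK⟩ := geometric_hahn_banach_open hUc hUo hKc hdisj
  set c : ι → ℝ := fun i => f (Pi.single i 1) with hc
  have hf : ∀ v, f v = ∑ i, c i * v i := by
    intro v
    conv_lhs => rw [← Finset.univ_sum_single v, map_sum]
    refine Finset.sum_congr rfl fun i _ => ?_
    have : (Pi.single i (v i) : ι → ℝ) = v i • Pi.single i 1 := by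
      rw [← Pi.single_smul]; simp
    rw [this, map_smul, smul_eq_mul, mul_comm]
  obtain ⟨x₀⟩ := ‹Nonempty X›
  -- `K` is stable under increasing a coordinate, so a negative coefficient would make the
  -- functional unbounded below on `K`.
  have hc0 : ∀ i, 0 ≤ c i := by
    intro i
    by_contra hneg
    push Not at hneg
    have hle : ∀ t : ℝ, 0 ≤ t → u ≤ f (V x₀) + t * c i := by
      intro t ht
      have := hfK (V x₀ + t • Pi.single i 1) ⟨x₀, fun j => by
        simp only [Pi.add_apply, Pi.smul_apply, smul_eq_mul]
        have : (0 : ℝ) ≤ (Pi.single i 1 : ι → ℝ) j := by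
          by_cases h : j = i
          · subst h; simp
          · simp [h]
        nlinarith [mul_nonneg ht this]⟩
      rwa [map_add, map_smul, smul_eq_mul] at this
    have h1 := hle ((|f (V x₀) - u| + 1) / (-c i)) (div_nonneg (by positivity) (by linarith))
    have h2 : (|f (V x₀) - u| + 1) / (-c i) * c i = -(|f (V x₀) - u| + 1) := by
      rw [div_mul_eq_mul_div, div_eq_iff (by linarith)]
      ring
    rw [h2] at h1
    linarith [le_abs_self (f (V x₀) - u)]
  have hconst : (fun _ : ι => B) ∈ U := fun i _ => by simpa using hs
  have hlt := hfU _ hconst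
  rw [hf] at hlt
  rcases (Finset.sum_nonneg fun i (_ : i ∈ Finset.univ) => hc0 i).eq_or_lt with h0 | hpos
  · have hz : ∀ i, c i = 0 := fun i =>
      (Finset.sum_eq_zero_iff_of_nonneg fun i _ => hc0 i).1 h0.symm i (Finset.mem_univ i)
    have := hfK (V x₀) ⟨x₀, fun _ => le_rfl⟩
    rw [hf] at this
    simp only [hz, zero_mul, Finset.sum_const_zero] at this hlt
    linarith
  · obtain ⟨x, hx⟩ := hB (fun i => c i / ∑ j, c j) (fun i => div_nonneg (hc0 i) hpos.le) (by
      rw [← Finset.sum_div, div_self hpos.ne'])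
    have h1 := hfK (V x) ⟨x, fun _ => le_rfl⟩
    rw [hf] at h1
    have h2 : ∑ i, c i / (∑ j, c j) * V x i = (∑ i, c i * V x i) / ∑ j, c j := by
      rw [Finset.sum_div]
      exact Finset.sum_congr rfl fun i _ => by ring
    rw [h2, div_le_iff₀ hpos] at hx
    rw [← Finset.sum_mul] at hlt
    linarith [mul_comm B (∑ j, c j)]

end Minimax

/-! ### Information carried by the posterior -/

section Posterior

variable {κ : Type*} [Fintype κ]

/-- The payoff of the smoothed log-ratio weight functions is at least the squared Hellinger
distance between the posterior `r` and the weights `wt`, up to a smoothing error. -/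
theorem sum_mul_gap_ge {wt r : κ → ℝ} (hw : ∀ i, 0 < wt i) (hw1 : ∑ i, wt i = 1)
    (hr : ∀ i, 0 ≤ r i) (hr1 : ∑ i, r i = 1) {θ : ℝ} (hθ : 0 < θ) :
    2⁻¹ * ∑ i, (√(r i) - √(wt i)) ^ 2 - Fintype.card κ * √θ ≤
      ∑ i, r i * ∑ j, wt j * (1 - Real.exp
        (2⁻¹ * Real.log ((r j + θ) / wt j) - 2⁻¹ * Real.log ((r i + θ) / wt i))) := by
  -- The payoff factors as 1 - (∑ r/a)(∑ w a). Without smoothing both factors equal S = ∑ √(r w),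
  -- and 1 - S² ≥ 1 - S is half the squared distance of the square roots. The shift θ keeps the
  -- logarithms bounded where r vanishes.
  set a : κ → ℝ := fun i => √((r i + θ) / wt i) with ha
  have hfrac : ∀ i, 0 < (r i + θ) / wt i := fun i =>
    div_pos (add_pos_of_nonneg_of_pos (hr i) hθ) (hw i)
  have hapos : ∀ i, 0 < a i := fun i => Real.sqrt_pos.2 (hfrac i)
  have hexp : ∀ i, Real.exp (2⁻¹ * Real.log ((r i + θ) / wt i)) = a i := by
    intro i
    rw [ha]
    simp only
    rw [Real.sqrt_eq_rpow, Real.rpow_def_of_pos (hfrac i)]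
    congr 1
    ring
  set S : ℝ := ∑ i, √(r i) * √(wt i) with hS
  have hS0 : 0 ≤ S := Finset.sum_nonneg fun i _ => by positivity
  have hSeq : 2⁻¹ * ∑ i, (√(r i) - √(wt i)) ^ 2 = 1 - S := by
    have : ∀ i, (√(r i) - √(wt i)) ^ 2 = r i + wt i - 2 * (√(r i) * √(wt i)) := by
      intro i
      have h1 := Real.sq_sqrt (hr i)
      have h2 := Real.sq_sqrt (hw i).le
      nlinarith
    simp only [this, Finset.sum_sub_distrib, Finset.sum_add_distrib, hr1, hw1, ← Finset.mul_sum]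
    ring
  have hS1 : S ≤ 1 := by
    have : 0 ≤ 2⁻¹ * ∑ i, (√(r i) - √(wt i)) ^ 2 := by positivity
    linarith
  have hX : ∑ i, r i / a i ≤ S := by
    refine Finset.sum_le_sum fun i _ => ?_
    rw [div_le_iff₀ (hapos i), ha]
    simp only
    rw [Real.sqrt_div' _ (hw i).le]
    have h1 := Real.sq_sqrt (hr i)
    have h3 : √(r i) ≤ √(r i + θ) := Real.sqrt_le_sqrt (by linarith)
    have h4 : √(wt i) ≠ 0 := (Real.sqrt_pos.2 (hw i)).ne'
    have : √(r i) * √(wt i) * (√(r i + θ) / √(wt i)) = √(r i) * √(r i + θ) := by field_simp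
    rw [this]
    nlinarith [Real.sqrt_nonneg (r i)]
  have hY : ∑ i, wt i * a i ≤ S + Fintype.card κ * √θ := by
    have : (Fintype.card κ : ℝ) * √θ = ∑ _i : κ, √θ := by simp
    rw [this, hS, ← Finset.sum_add_distrib]
    refine Finset.sum_le_sum fun i _ => ?_
    rw [ha]
    simp only
    rw [Real.sqrt_div' _ (hw i).le]
    have h2 := Real.sq_sqrt (hw i).le
    have h4 : √(wt i) ≠ 0 := (Real.sqrt_pos.2 (hw i)).ne'
    have h5 : √(r i + θ) ≤ √(r i) + √θ := by
      refine Real.sqrt_le_iff.2 ⟨by positivity, ?_⟩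
      have h1 := Real.sq_sqrt (hr i)
      have h3 := Real.sq_sqrt hθ.le
      nlinarith [mul_nonneg (Real.sqrt_nonneg (r i)) (Real.sqrt_nonneg θ)]
    have h6 : √(wt i) ≤ 1 := by
      rw [Real.sqrt_le_one]
      rw [← hw1]
      exact Finset.single_le_sum (fun j _ => (hw j).le) (Finset.mem_univ i)
    have h7 : wt i * (√(r i + θ) / √(wt i)) = √(wt i) * √(r i + θ) := by
      nth_rewrite 1 [← h2]
      field_simp
    rw [h7]
    nlinarith [Real.sqrt_nonneg (wt i), Real.sqrt_nonneg (r i), Real.sqrt_nonneg θ,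
      mul_le_mul_of_nonneg_left h5 (Real.sqrt_nonneg (wt i)),
      mul_le_mul_of_nonneg_right h6 (Real.sqrt_nonneg θ)]
  have hmain : ∑ i, r i * ∑ j, wt j * (1 - Real.exp
        (2⁻¹ * Real.log ((r j + θ) / wt j) - 2⁻¹ * Real.log ((r i + θ) / wt i))) =
      1 - (∑ i, r i / a i) * ∑ j, wt j * a j := by
    have h1 : ∀ i, r i * ∑ j, wt j * (1 - Real.exp
        (2⁻¹ * Real.log ((r j + θ) / wt j) - 2⁻¹ * Real.log ((r i + θ) / wt i))) =
        r i - r i / a i * ∑ j, wt j * a j := by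
      intro i
      have h2 : ∀ j, wt j * (1 - Real.exp
        (2⁻¹ * Real.log ((r j + θ) / wt j) - 2⁻¹ * Real.log ((r i + θ) / wt i))) =
          wt j - wt j * a j / a i := by
        intro j
        rw [Real.exp_sub, hexp, hexp]
        ring
      simp only [h2, Finset.sum_sub_distrib, hw1, ← Finset.sum_div]
      ring
    simp only [h1, Finset.sum_sub_distrib, hr1, ← Finset.sum_mul]
  rw [hmain, hSeq]
  have hY0 : 0 ≤ ∑ j, wt j * a j := Finset.sum_nonneg fun i _ => by
    have := hw i
    have := hapos i
    positivity
  have hc : (0 : ℝ) ≤ Fintype.card κ * √θ := by positivity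
  have h8 : (∑ i, r i / a i) * ∑ j, wt j * a j ≤ S * (S + Fintype.card κ * √θ) :=
    mul_le_mul hX hY hY0 hS0
  nlinarith [mul_le_mul_of_nonneg_right hS1 hc]

/-- The deviation of `√r` from the square root of the mean of `r` is controlled by its deviation
from any constant. -/
theorem integral_sqrt_sub_sqrt_integral_le {O : Type*} [MeasurableSpace O] (m : Measure O)
    [IsProbabilityMeasure m] {r : O → ℝ} (hr : Measurable r) (hr0 : ∀ o, 0 ≤ r o)
    (hr1 : ∀ o, r o ≤ 1) {b : ℝ} (hb : 0 ≤ b) :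
    ∫ o, (√(r o) - √(∫ o, r o ∂m)) ^ 2 ∂m ≤ 4 * ∫ o, (√(r o) - √b) ^ 2 ∂m := by
  have hri : Integrable r m := Integrable.of_bound hr.aestronglyMeasurable 1
    (.of_forall fun o => by rw [Real.norm_of_nonneg (hr0 o)]; exact hr1 o)
  have hs1 : ∀ o, √(r o) ≤ 1 := fun o => Real.sqrt_le_one.2 (hr1 o)
  have hsi : Integrable (fun o => √(r o)) m := Integrable.of_bound
    hr.sqrt.aestronglyMeasurable 1
    (.of_forall fun o => by rw [Real.norm_of_nonneg (Real.sqrt_nonneg _)]; exact hs1 o)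
  -- With ρ = E r and σ = E √r, the left side is 2√ρ(√ρ - σ) ≤ 2(ρ - σ²). This is twice the variance
  -- of √r, which is at most its mean square deviation from any constant.
  have key : ∀ c : ℝ, 0 ≤ c → ∫ o, (√(r o) - √c) ^ 2 ∂m =
      ∫ o, r o ∂m - 2 * √c * ∫ o, √(r o) ∂m + c := by
    intro c hc
    have : ∀ o, (√(r o) - √c) ^ 2 = r o - 2 * √c * √(r o) + c := fun o => by
      have h1 := Real.sq_sqrt (hr0 o)
      have h2 := Real.sq_sqrt hc
      nlinarith
    simp only [this]
    have h3 : Integrable (fun o => r o - 2 * √c * √(r o)) m := hri.sub (hsi.const_mul _)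
    rw [integral_add h3 (integrable_const _), integral_sub hri (hsi.const_mul _),
      integral_const_mul]
    simp
  have hm0 : 0 ≤ ∫ o, r o ∂m := integral_nonneg hr0
  rw [key _ hm0, key _ hb]
  set ρ := ∫ o, r o ∂m
  set σ := ∫ o, √(r o) ∂m
  have hvar : σ ^ 2 ≤ ρ := by
    have h := key (σ ^ 2) (sq_nonneg _)
    have hσ : 0 ≤ σ := integral_nonneg fun o => Real.sqrt_nonneg _
    rw [Real.sqrt_sq hσ] at h
    have : 0 ≤ ∫ o, (√(r o) - σ) ^ 2 ∂m := integral_nonneg fun o => sq_nonneg _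
    nlinarith
  have hσ : 0 ≤ σ := integral_nonneg fun o => Real.sqrt_nonneg _
  have hσρ : σ ≤ √ρ := Real.le_sqrt_of_sq_le hvar
  have h1 := Real.sq_sqrt hm0
  have h2 := Real.sq_sqrt hb
  set x := √ρ
  set y := √b
  have hx : 0 ≤ x := Real.sqrt_nonneg _
  have hy : 0 ≤ y := Real.sqrt_nonneg _
  nlinarith [sq_nonneg (σ - y), sq_nonneg (x - y), mul_nonneg hy (sub_nonneg.2 hσρ),
    mul_nonneg hx (sub_nonneg.2 hσρ), mul_nonneg hσ (sub_nonneg.2 hσρ), sq_nonneg (x - 2 * y),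
    sq_nonneg (σ - 2 * y), sq_nonneg (x + σ - 2*y)]

end Posterior

/-- A finite measure dominated by another one has a density with values in `[0, 1]`. -/
theorem exists_density_of_le {X : Type*} [MeasurableSpace X] {μ ν : Measure X} [IsFiniteMeasure ν]
    (h : μ ≤ ν) :
    ∃ f : X → ℝ≥0, Measurable f ∧ (∀ x, f x ≤ 1) ∧ μ = ν.withDensity fun x => (f x : ℝ≥0∞) := by
  have : IsFiniteMeasure μ := isFiniteMeasure_of_le ν h
  -- Truncation makes the bound 1 hold everywhere instead of almost everywhere.
  refine ⟨fun x => min (μ.rnDeriv ν x).toNNReal 1,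
    (Measure.measurable_rnDeriv _ _).ennreal_toNNReal.min measurable_const,
    fun x => min_le_right _ _, ?_⟩
  rw [← Measure.withDensity_rnDeriv_eq μ ν (Measure.absolutelyContinuous_of_le h)]
  refine withDensity_congr_ae ?_
  rw [Measure.withDensity_rnDeriv_eq μ ν (Measure.absolutelyContinuous_of_le h)]
  filter_upwards [Measure.rnDeriv_le_one_of_le h] with x hx
  have hx' : (μ.rnDeriv ν x).toNNReal ≤ 1 := by
    rw [← ENNReal.coe_le_coe, ENNReal.coe_toNNReal (ne_top_of_le_ne_top ENNReal.one_ne_top hx)]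
    exact hx
  rw [min_eq_left hx', ENNReal.coe_toNNReal (ne_top_of_le_ne_top ENNReal.one_ne_top hx)]

/-! ### The information term of the objective -/

section Info

variable {D : Type u} {Φ : Type v} {O : Type w}
  [MeasurableSpace D] [MeasurableSpace Φ] [MeasurableSpace O]
  {𝓒 : Finset (Set (Model D Φ O))}

instance isMarkovKernel_model (M : Model D Φ O) : IsMarkovKernel M.1 := M.2

/-- The integrand `E_{ψ' ∼ wt}[1 - exp (ξ(ψ') - ξ(ψ))]` of the information term. -/
def gap (wt : 𝓒 → ℝ) (ξ : 𝓒 → Obs D Φ O → ℝ) (ψ : 𝓒) (y : Obs D Φ O) : ℝ :=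
  ∑ ψ', wt ψ' * (1 - Real.exp (ξ ψ' y - ξ ψ y))

/-- The information term of the objective given the pair played. -/
def infoAt (wt : 𝓒 → ℝ) (ξ : 𝓒 → Obs D Φ O → ℝ) (M : Model D Φ O) (ψ : 𝓒) (x : D × Φ) : ℝ :=
  ∫ o, gap wt ξ ψ (x, o) ∂(M.1 x)

/-- The information term of the objective. -/
def info (wt : 𝓒 → ℝ) (q : Measure (D × Φ)) (ξ : 𝓒 → Obs D Φ O → ℝ) (M : Model D Φ O)
    (ψ : 𝓒) : ℝ :=
  ∫ x, infoAt wt ξ M ψ x ∂q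

theorem objectiveAt_eq (L : 𝓒 → D → ℝ≥0) (γ : ℝ) (wt : 𝓒 → ℝ) (p : Measure D)
    (q : Measure (D × Φ)) (ξ : 𝓒 → Obs D Φ O → ℝ) (M : Model D Φ O) (ψ : 𝓒) :
    objectiveAt L γ wt p q ξ M ψ =
      ((∫⁻ d, (L ψ d : ℝ≥0∞) ∂p : ℝ≥0∞) : EReal) - ((γ * info wt q ξ M ψ : ℝ) : EReal) := rfl

theorem measurable_gap {wt : 𝓒 → ℝ} {ξ : 𝓒 → Obs D Φ O → ℝ} (hξ : ∀ ψ, Measurable (ξ ψ))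
    (ψ : 𝓒) : Measurable (gap wt ξ ψ) := by
  unfold gap
  fun_prop

/-- Signed weights are allowed so that differences of weight vectors are covered; `info_sub_le`
relies on this. -/
theorem abs_gap_le_of_sum_abs {wt : 𝓒 → ℝ} {ξ : 𝓒 → Obs D Φ O → ℝ} {A : ℝ}
    (hA : ∀ ψ y, |ξ ψ y| ≤ A) (ψ : 𝓒) (y : Obs D Φ O) :
    |gap wt ξ ψ y| ≤ (∑ ψ', |wt ψ'|) * Real.exp (2 * A) := by
  unfold gap
  rw [Finset.sum_mul]
  refine (Finset.abs_sum_le_sum_abs _ _).trans (Finset.sum_le_sum fun i _ => ?_)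
  rw [abs_mul]
  refine mul_le_mul_of_nonneg_left ?_ (abs_nonneg _)
  have h1 := abs_le.1 (hA i y)
  have h2 := abs_le.1 (hA ψ y)
  have h3 : Real.exp (ξ i y - ξ ψ y) ≤ Real.exp (2 * A) := Real.exp_le_exp.2 (by linarith)
  have h4 : 1 ≤ Real.exp (2 * A) := Real.one_le_exp (by linarith)
  have := Real.exp_pos (ξ i y - ξ ψ y)
  rw [abs_le]
  constructor <;> linarith

theorem abs_gap_le {wt : 𝓒 → ℝ} (hw : ∀ i, 0 ≤ wt i) (hw1 : ∑ i, wt i = 1)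
    {ξ : 𝓒 → Obs D Φ O → ℝ} {A : ℝ}
    (hA : ∀ ψ y, |ξ ψ y| ≤ A) (ψ : 𝓒) (y : Obs D Φ O) :
    |gap wt ξ ψ y| ≤ Real.exp (2 * A) := by
  have := abs_gap_le_of_sum_abs (wt := wt) hA ψ y
  simpa only [abs_of_nonneg (hw _), hw1, one_mul] using this

section Bounded

variable {wt : 𝓒 → ℝ} {ξ : 𝓒 → Obs D Φ O → ℝ}

theorem exists_abs_gap_le (hξ : ξ ∈ weightFunctions 𝓒) :
    ∃ G, ∀ ψ y, |gap wt ξ ψ y| ≤ G := by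
  obtain ⟨A, hA⟩ := hξ.2
  exact ⟨_, abs_gap_le_of_sum_abs hA⟩

theorem integrable_gap (hξ : ξ ∈ weightFunctions 𝓒) (M : Model D Φ O) (ψ : 𝓒) (x : D × Φ) :
    Integrable (fun o => gap wt ξ ψ (x, o)) (M.1 x) := by
  obtain ⟨G, hG⟩ := exists_abs_gap_le (wt := wt) hξ
  exact Integrable.of_bound ((measurable_gap hξ.1 ψ).comp measurable_prodMk_left).aestronglyMeasurable
    G (.of_forall fun o => hG _ _)

theorem abs_infoAt_le {G : ℝ} (hG : ∀ ψ y, |gap wt ξ ψ y| ≤ G) (M : Model D Φ O) (ψ : 𝓒)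
    (x : D × Φ) : |infoAt wt ξ M ψ x| ≤ G := by
  have := norm_integral_le_of_norm_le_const (μ := M.1 x) (f := fun o => gap wt ξ ψ (x, o))
    (C := G) (.of_forall fun o => hG _ _)
  simpa [infoAt] using this

theorem measurable_infoAt (hξ : ∀ ψ, Measurable (ξ ψ)) (M : Model D Φ O) (ψ : 𝓒) :
    Measurable (infoAt wt ξ M ψ) := by
  unfold infoAt
  exact (StronglyMeasurable.integral_kernel_prod_right'
    (measurable_gap hξ ψ).stronglyMeasurable).measurable

theorem integrable_infoAt (hξ : ξ ∈ weightFunctions 𝓒) (M : Model D Φ O) (ψ : 𝓒)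
    (q : Measure (D × Φ)) [IsFiniteMeasure q] : Integrable (infoAt wt ξ M ψ) q := by
  obtain ⟨G, hG⟩ := exists_abs_gap_le (wt := wt) hξ
  exact Integrable.of_bound (measurable_infoAt hξ.1 M ψ).aestronglyMeasurable
    G (.of_forall fun x => abs_infoAt_le hG M ψ x)

theorem abs_info_le {G : ℝ} (hG : ∀ ψ y, |gap wt ξ ψ y| ≤ G) (q : Measure (D × Φ))
    [IsProbabilityMeasure q] (M : Model D Φ O) (ψ : 𝓒) : |info wt q ξ M ψ| ≤ G := by
  have := norm_integral_le_of_norm_le_const (μ := q) (f := infoAt wt ξ M ψ)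
    (C := G) (.of_forall fun x => abs_infoAt_le hG M ψ x)
  simpa [info] using this

/-- Each term 1 - exp(·) is below 1. This one-sided bound does not depend on ξ and keeps the value
of the game above -γ. -/
theorem info_le_one (hw : ∀ i, 0 ≤ wt i) (hw1 : ∑ i, wt i = 1) (hξ : ξ ∈ weightFunctions 𝓒)
    (q : Measure (D × Φ)) [IsProbabilityMeasure q] (M : Model D Φ O) (ψ : 𝓒) :
    info wt q ξ M ψ ≤ 1 := by
  have h1 : ∀ y, gap wt ξ ψ y ≤ 1 := by
    intro y
    unfold gap
    rw [← hw1]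
    refine Finset.sum_le_sum fun i _ => ?_
    nlinarith [hw i, Real.exp_pos (ξ i y - ξ ψ y), mul_nonneg (hw i) (Real.exp_pos (ξ i y - ξ ψ y)).le]
  have h2 : ∀ x, infoAt wt ξ M ψ x ≤ 1 := by
    intro x
    calc infoAt wt ξ M ψ x ≤ ∫ _, (1 : ℝ) ∂(M.1 x) :=
          integral_mono (integrable_gap hξ M ψ x) (integrable_const _) fun o => h1 _
      _ = 1 := by simp
  calc info wt q ξ M ψ ≤ ∫ _, (1 : ℝ) ∂q :=
        integral_mono (integrable_infoAt hξ M ψ q) (integrable_const _) h2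
    _ = 1 := by simp

end Bounded

/-- Concavity of 1 - exp. The proportion f may depend on the point, as it does in
`exists_info_mixture_ge`. -/
theorem gap_convex {wt : 𝓒 → ℝ} (hw : ∀ i, 0 ≤ wt i) (ξ₁ ξ₂ : 𝓒 → Obs D Φ O → ℝ) (ψ : 𝓒)
    (y : Obs D Φ O) {f : ℝ} (hf0 : 0 ≤ f) (hf1 : f ≤ 1) :
    f * gap wt ξ₁ ψ y + (1 - f) * gap wt ξ₂ ψ y ≤
      ∑ ψ', wt ψ' * (1 - Real.exp ((f * ξ₁ ψ' y + (1 - f) * ξ₂ ψ' y) -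
        (f * ξ₁ ψ y + (1 - f) * ξ₂ ψ y))) := by
  unfold gap
  rw [Finset.mul_sum, Finset.mul_sum, ← Finset.sum_add_distrib]
  refine Finset.sum_le_sum fun i _ => ?_
  have h := convexOn_exp.2 (Set.mem_univ (ξ₁ i y - ξ₁ ψ y)) (Set.mem_univ (ξ₂ i y - ξ₂ ψ y))
    hf0 (sub_nonneg.2 hf1) (by ring)
  simp only [smul_eq_mul] at h
  have e : f * (ξ₁ i y - ξ₁ ψ y) + (1 - f) * (ξ₂ i y - ξ₂ ψ y) =
    (f * ξ₁ i y + (1 - f) * ξ₂ i y) - (f * ξ₁ ψ y + (1 - f) * ξ₂ ψ y) := by ring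
  rw [e] at h
  nlinarith [mul_le_mul_of_nonneg_left h (hw i)]

theorem integral_smul_add_smul {X : Type*} [MeasurableSpace X] (μ ν : Measure X)
    [IsFiniteMeasure μ] [IsFiniteMeasure ν] {a b : ℝ} (ha : 0 ≤ a) (hb : 0 ≤ b) {f : X → ℝ}
    (hμ : Integrable f μ) (hν : Integrable f ν) :
    ∫ x, f x ∂(a.toNNReal • μ + b.toNNReal • ν) = a * ∫ x, f x ∂μ + b * ∫ x, f x ∂ν := by
  rw [integral_add_measure (hμ.smul_measure_nnreal) (hν.smul_measure_nnreal),
    integral_smul_nnreal_measure, integral_smul_nnreal_measure]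
  simp [NNReal.smul_def, ha, hb]

/-- The convex combination `a μ + b ν` of probability measures. -/
def mixture {X : Type*} [MeasurableSpace X] (μ ν : ProbabilityMeasure X) (a b : ℝ) (ha : 0 ≤ a)
    (hb : 0 ≤ b) (hab : a + b = 1) : ProbabilityMeasure X :=
  ⟨a.toNNReal • (μ : Measure X) + b.toNNReal • (ν : Measure X), ⟨by
    simp only [Measure.add_apply, Measure.smul_apply, measure_univ, ENNReal.smul_def, smul_eq_mul,
      mul_one]
    rw [← ENNReal.coe_add, ← Real.toNNReal_add ha hb, hab]
    simp⟩⟩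

/-- Mixing the exploration laws, and averaging the weight functions with respect to the posterior
probability of the component, does not decrease the mixture of the information terms. -/
theorem exists_info_mixture_ge {wt : 𝓒 → ℝ} (hw : ∀ i, 0 ≤ wt i)
    (q₁ q₂ : ProbabilityMeasure (D × Φ)) {ξ₁ ξ₂ : 𝓒 → Obs D Φ O → ℝ}
    (h₁ : ∀ ψ, Measurable (ξ₁ ψ)) (h₂ : ∀ ψ, Measurable (ξ₂ ψ)) {A : ℝ}
    (hA₁ : ∀ ψ y, |ξ₁ ψ y| ≤ A) (hA₂ : ∀ ψ y, |ξ₂ ψ y| ≤ A) {a b : ℝ} (ha : 0 ≤ a) (hb : 0 ≤ b)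
    (hab : a + b = 1) :
    ∃ (q : ProbabilityMeasure (D × Φ)) (ξ : 𝓒 → Obs D Φ O → ℝ),
      (∀ ψ, Measurable (ξ ψ)) ∧ (∀ ψ y, |ξ ψ y| ≤ A) ∧
      ∀ M ψ, a * info wt q₁ ξ₁ M ψ + b * info wt q₂ ξ₂ M ψ ≤ info wt q ξ M ψ := by
  set q := mixture q₁ q₂ a b ha hb hab with hq
  have hle : a.toNNReal • (q₁ : Measure (D × Φ)) ≤ (q : Measure (D × Φ)) :=
    Measure.le_add_right le_rfl
  -- f(x) is the posterior probability that x was drawn from q₁: f q = a q₁ and (1 - f) q = b q₂.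
  obtain ⟨f, hfm, hf1, hf⟩ := exists_density_of_le hle
  have hm₁ : ξ₁ ∈ weightFunctions 𝓒 := ⟨h₁, A, hA₁⟩
  have hm₂ : ξ₂ ∈ weightFunctions 𝓒 := ⟨h₂, A, hA₂⟩
  have hf1' : ∀ x, (f x : ℝ) ≤ 1 := fun x => by exact_mod_cast hf1 x
  set ξ : 𝓒 → Obs D Φ O → ℝ := fun ψ y => f y.1 * ξ₁ ψ y + (1 - f y.1) * ξ₂ ψ y with hξdef
  have hξm : ∀ ψ, Measurable (ξ ψ) := fun ψ => by
    have := h₁ ψ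
    have := h₂ ψ
    fun_prop
  have hξA : ∀ ψ y, |ξ ψ y| ≤ A := by
    intro ψ y
    have e1 := abs_le.1 (hA₁ ψ y)
    have e2 := abs_le.1 (hA₂ ψ y)
    have e3 := hf1' y.1
    have e4 : (0 : ℝ) ≤ f y.1 := (f y.1).2
    rw [abs_le]
    simp only [hξdef]
    constructor <;> nlinarith
  have hm : ξ ∈ weightFunctions 𝓒 := ⟨hξm, A, hξA⟩
  refine ⟨q, ξ, hξm, hξA, fun M ψ => ?_⟩
  have hpt : ∀ x, f x * infoAt wt ξ₁ M ψ x + (1 - f x) * infoAt wt ξ₂ M ψ x ≤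
      infoAt wt ξ M ψ x := by
    intro x
    unfold infoAt
    rw [← integral_const_mul, ← integral_const_mul, ← integral_add
      ((integrable_gap hm₁ M ψ x).const_mul _) ((integrable_gap hm₂ M ψ x).const_mul _)]
    refine integral_mono (((integrable_gap hm₁ M ψ x).const_mul _).add
      ((integrable_gap hm₂ M ψ x).const_mul _)) (integrable_gap hm M ψ x) fun o => ?_
    exact gap_convex hw ξ₁ ξ₂ ψ (x, o) (f x).2 (hf1' x)
  have hint : ∀ ζ ∈ weightFunctions 𝓒, Integrable (fun x => f x * infoAt wt ζ M ψ x) q := by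
    intro ζ hζ
    refine (integrable_infoAt hζ M ψ (q : Measure (D × Φ))).bdd_mul (c := 1)
      hfm.coe_nnreal_real.aestronglyMeasurable (.of_forall fun x => ?_)
    rw [Real.norm_of_nonneg (NNReal.coe_nonneg _)]
    exact hf1' x
  have hdens : ∀ ζ ∈ weightFunctions 𝓒,
      ∫ x, f x * infoAt wt ζ M ψ x ∂q = a * info wt q₁ ζ M ψ := by
    intro ζ hζ
    have := integral_withDensity_eq_integral_smul hfm (μ := (q : Measure (D × Φ)))
      (infoAt wt ζ M ψ)
    rw [← hf, integral_smul_nnreal_measure] at this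
    simp only [NNReal.smul_def, smul_eq_mul, Real.coe_toNNReal _ ha] at this
    exact this.symm
  have htot : info wt q ξ₂ M ψ = a * info wt q₁ ξ₂ M ψ + b * info wt q₂ ξ₂ M ψ :=
    integral_smul_add_smul _ _ ha hb (integrable_infoAt hm₂ M ψ _) (integrable_infoAt hm₂ M ψ _)
  have hint' : Integrable (fun x => (1 - f x) * infoAt wt ξ₂ M ψ x) q := by
    have := (integrable_infoAt hm₂ M ψ (wt := wt) (q : Measure (D × Φ))).sub (hint ξ₂ hm₂)
    refine this.congr (.of_forall fun x => ?_)
    simp only [Pi.sub_apply]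
    ring
  -- Total minus first part, so no second density is needed.
  have hsecond : ∫ x, (1 - f x) * infoAt wt ξ₂ M ψ x ∂q = b * info wt q₂ ξ₂ M ψ := by
    have : ∀ x, (1 - f x) * infoAt wt ξ₂ M ψ x =
        infoAt wt ξ₂ M ψ x - f x * infoAt wt ξ₂ M ψ x := fun x => by ring
    simp only [this]
    rw [integral_sub (integrable_infoAt hm₂ M ψ _) (hint ξ₂ hm₂), hdens ξ₂ hm₂]
    change info wt q ξ₂ M ψ - _ = _
    rw [htot]
    ring
  rw [← hdens ξ₁ hm₁, ← hsecond, ← integral_add (hint ξ₁ hm₁) hint']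
  exact integral_mono ((hint ξ₁ hm₁).add hint') (integrable_infoAt hm M ψ _) hpt

theorem subset_co (S : Set (Model D Φ O)) : S ⊆ co S := fun M hM =>
  ⟨1, fun _ => 1, fun _ => M, by simp, fun _ => hM, fun x => by simp⟩

/-- Every `ψ ∈ 𝓒` has finite internal coverings, in the sense that expectations of bounded functions
are approximated uniformly. -/
theorem exists_finite_internal_cover (hcov : FiniteCovering (convexifiedClass 𝓒)) {ε : ℝ}
    (hε : 0 < ε) (ψ : 𝓒) :
    ∃ S : Set (Model D Φ O), S.Finite ∧ S ⊆ ψ.1 ∧ ∀ M ∈ ψ.1, ∃ M' ∈ S, ∀ (x : D × Φ) (g : O → ℝ),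
      Measurable g → ∀ G, (∀ o, |g o| ≤ G) →
        |∫ o, g o ∂(M.1 x) - ∫ o, g o ∂(M'.1 x)| ≤ ε * G := by
  classical
  -- Two comparisons through a centre cost 3 · ε/6 each.
  obtain ⟨S₀, -, hfin, hS₀⟩ := hcov (ε / 6) (by positivity)
  set near : Model D Φ O → Model D Φ O → Prop := fun M N =>
    ∀ x, hellingerSq (M.1 x) (N.1 x) ≤ ENNReal.ofReal ((ε / 6) ^ 2) with hnear
  -- The centres need not lie in ψ. Each useful one is replaced by a nearby element of ψ, and the
  -- triangle inequality is applied to expectations.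
  set pick : Model D Φ O → Model D Φ O := fun N =>
    if h : ∃ M ∈ ψ.1, near M N then h.choose else N with hpick
  have hpick' : ∀ N, (∃ M ∈ ψ.1, near M N) → pick N ∈ ψ.1 ∧ near (pick N) N := by
    intro N h
    simp only [hpick, dif_pos h]
    exact h.choose_spec
  refine ⟨pick '' {N ∈ S₀ | ∃ M ∈ ψ.1, near M N}, (hfin.subset fun N h => h.1).image _, ?_, ?_⟩
  · rintro _ ⟨N, ⟨-, h⟩, rfl⟩
    exact (hpick' N h).1
  · intro M hM
    obtain ⟨N, hN, hMN⟩ := hS₀ M (by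
      simp only [convexifiedClass, Set.mem_iUnion]
      exact ⟨ψ.1, ψ.2, subset_co _ hM⟩)
    have hex : ∃ M ∈ ψ.1, near M N := ⟨M, hM, hMN⟩
    refine ⟨pick N, ⟨N, ⟨hN, hex⟩, rfl⟩, fun x g hg G hG => ?_⟩
    have h1 := abs_integral_sub_le_of_hellingerSq (M.1 x) (N.1 x) hg hG (by positivity) (hMN x)
    have h2 := abs_integral_sub_le_of_hellingerSq ((pick N).1 x) (N.1 x) hg hG (by positivity)
      ((hpick' N hex).2 x)
    rw [abs_le] at h1 h2 ⊢
    constructor <;> linarith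

end Info

/-- A finite kernel dominated by another one has a jointly measurable density with values in
`[0, 1]`. -/
theorem exists_kernel_density_of_le {X O : Type*} [MeasurableSpace X] [MeasurableSpace O]
    [MeasurableSpace.CountableOrCountablyGenerated X O] {κ η : Kernel X O} [IsFiniteKernel κ]
    [IsFiniteKernel η] (h : ∀ x, κ x ≤ η x) :
    ∃ f : X × O → ℝ≥0, Measurable f ∧ (∀ y, f y ≤ 1) ∧
      ∀ x, κ x = (η x).withDensity fun o => (f (x, o) : ℝ≥0∞) := by
  -- Joint measurability comes from `Kernel.rnDeriv`; here the countability hypothesis enters.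
  refine ⟨fun y => min (κ.rnDeriv η y.1 y.2).toNNReal 1,
    (Kernel.measurable_rnDeriv κ η).ennreal_toNNReal.min measurable_const,
    fun y => min_le_right _ _, fun x => ?_⟩
  have hac := Measure.absolutelyContinuous_of_le (h x)
  nth_rewrite 1 [← Kernel.withDensity_rnDeriv_eq hac]
  rw [Kernel.withDensity_apply _ (Kernel.measurable_rnDeriv _ _)]
  refine withDensity_congr_ae ?_
  filter_upwards [Measure.rnDeriv_le_one_of_le (h x),
    Kernel.rnDeriv_eq_rnDeriv_measure (κ := κ) (η := η) (a := x)] with o ho ho'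
  rw [← ho'] at ho
  have hx : (κ.rnDeriv η x o).toNNReal ≤ 1 := by
    rw [← ENNReal.coe_le_coe, ENNReal.coe_toNNReal (ne_top_of_le_ne_top ENNReal.one_ne_top ho)]
    exact ho
  rw [min_eq_left hx, ENNReal.coe_toNNReal (ne_top_of_le_ne_top ENNReal.one_ne_top ho)]

/-! ### Posterior information, integrated over observations -/

section Posterior

variable {κ : Type*} [Fintype κ]

/-- Integrated form of `sum_mul_gap_ge`, with the posterior compared to its mean. -/
theorem integral_sum_mul_gap_ge {O : Type*} [MeasurableSpace O] (m : Measure O)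
    [IsProbabilityMeasure m] {wt : κ → ℝ} (hw : ∀ i, 0 < wt i) (hw1 : ∑ i, wt i = 1)
    {r : κ → O → ℝ} (hrm : ∀ i, Measurable (r i)) (hr : ∀ i o, 0 ≤ r i o) (hr1 : ∀ i o, r i o ≤ 1)
    (hsum : ∀ᵐ o ∂m, ∑ i, r i o = 1) {θ : ℝ} (hθ : 0 < θ) {g : κ → O → ℝ}
    (hg : ∀ i, Integrable (fun o => r i o * g i o) m)
    (hgdef : ∀ i o, g i o = ∑ j, wt j * (1 - Real.exp
        (2⁻¹ * Real.log ((r j o + θ) / wt j) - 2⁻¹ * Real.log ((r i o + θ) / wt i)))) :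
    ∑ i, 2⁻¹ * ∫ o, (√(r i o) - √(∫ o, r i o ∂m)) ^ 2 ∂m - 4 * (Fintype.card κ * √θ) ≤
      4 * ∑ i, ∫ o, r i o * g i o ∂m := by
  have hsq : ∀ i, Integrable (fun o => (√(r i o) - √(wt i)) ^ 2) m := by
    intro i
    have hm := hrm i
    refine Integrable.of_bound (C := 1) (by fun_prop) (.of_forall fun o => ?_)
    have h1 : √(r i o) ≤ 1 := Real.sqrt_le_one.2 (hr1 i o)
    have h2 : √(wt i) ≤ 1 := by
      rw [Real.sqrt_le_one, ← hw1]
      exact Finset.single_le_sum (fun j _ => (hw j).le) (Finset.mem_univ i)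
    have h3 := Real.sqrt_nonneg (r i o)
    have h4 := Real.sqrt_nonneg (wt i)
    rw [Real.norm_of_nonneg (sq_nonneg _), sq_le_one_iff_abs_le_one, abs_le]
    constructor <;> linarith
  have hle : ∫ o, (2⁻¹ * ∑ i, (√(r i o) - √(wt i)) ^ 2 - Fintype.card κ * √θ) ∂m ≤
      ∫ o, ∑ i, r i o * g i o ∂m := by
    refine integral_mono_ae (((integrable_finsetSum _ fun i _ => hsq i).const_mul _).sub
      (integrable_const _)) (integrable_finsetSum _ fun i _ => hg i) ?_
    filter_upwards [hsum] with o ho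
    simp only [hgdef]
    exact sum_mul_gap_ge hw hw1 (fun i => hr i o) ho hθ
  rw [integral_finsetSum _ fun i _ => hg i, integral_sub
    ((integrable_finsetSum _ fun i _ => hsq i).const_mul _) (integrable_const _),
    integral_const_mul, integral_finsetSum _ fun i _ => hsq i] at hle
  simp only [integral_const, probReal_univ, smul_eq_mul, one_mul] at hle
  -- The weights `wt` are the learner's, whereas the mean of the posterior is the adversary's prior.
  -- Passing from the former to the latter costs the factor 4.
  have hmean : ∑ i, ∫ o, (√(r i o) - √(∫ o, r i o ∂m)) ^ 2 ∂m ≤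
      4 * ∑ i, ∫ o, (√(r i o) - √(wt i)) ^ 2 ∂m := by
    rw [Finset.mul_sum]
    exact Finset.sum_le_sum fun i _ =>
      integral_sqrt_sub_sqrt_integral_le m (hrm i) (hr i) (hr1 i) (hw i).le
  rw [← Finset.mul_sum]
  linarith

end Posterior

/-! ### Finite mixtures of models -/

section Mixtures

variable {D : Type u} {Φ : Type v} {O : Type w}
  [MeasurableSpace D] [MeasurableSpace Φ] [MeasurableSpace O]

/-- The kernel `∑ i, a i • M i`. -/
def mixKernel {ι : Type*} [Fintype ι] (a : ι → ℝ≥0) (M : ι → Model D Φ O) : Kernel (D × Φ) O where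
  toFun x := ∑ i, a i • (M i).1 x
  measurable' := by
    refine Measure.measurable_of_measurable_coe _ fun s hs => ?_
    simp only [Measure.finsetSum_apply, Measure.smul_apply, ENNReal.smul_def]
    have := fun i => Kernel.measurable_coe (M i).1 hs
    fun_prop

theorem mixKernel_apply {ι : Type*} [Fintype ι] (a : ι → ℝ≥0) (M : ι → Model D Φ O)
    (x : D × Φ) : mixKernel a M x = ∑ i, a i • (M i).1 x := rfl

theorem mixKernel_apply_univ {ι : Type*} [Fintype ι] (a : ι → ℝ≥0) (M : ι → Model D Φ O)
    (x : D × Φ) : mixKernel a M x Set.univ = ((∑ i, a i : ℝ≥0) : ℝ≥0∞) := by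
  rw [mixKernel_apply, Measure.finsetSum_apply, ENNReal.ofNNReal_finsetSum]
  refine Finset.sum_congr rfl fun i _ => ?_
  rw [Measure.smul_apply, measure_univ, ENNReal.smul_def, smul_eq_mul, mul_one]

instance {ι : Type*} [Fintype ι] (a : ι → ℝ≥0) (M : ι → Model D Φ O) :
    IsFiniteKernel (mixKernel a M) :=
  ⟨⟨((∑ i, a i : ℝ≥0) : ℝ≥0∞), ENNReal.coe_lt_top, fun x => (mixKernel_apply_univ a M x).le⟩⟩

/-- The model `∑ i, a i • M i`. -/
def mixModel {ι : Type*} [Fintype ι] (a : ι → ℝ≥0) (ha : ∑ i, a i = 1) (M : ι → Model D Φ O) :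
    Model D Φ O :=
  ⟨mixKernel a M, ⟨fun x => ⟨by rw [mixKernel_apply_univ, ha, ENNReal.coe_one]⟩⟩⟩

theorem mixModel_mem_co {ι : Type*} [Fintype ι] (a : ι → ℝ≥0) (ha : ∑ i, a i = 1)
    (M : ι → Model D Φ O) {S : Set (Model D Φ O)} (hM : ∀ i, M i ∈ S) : mixModel a ha M ∈ co S := by
  set e := (Fintype.equivFin ι).symm
  refine ⟨Fintype.card ι, a ∘ e, M ∘ e, ?_, fun i => hM _, fun x => ?_⟩
  · rw [← ha]
    exact e.sum_comp a
  · exact (e.sum_comp fun i => a i • (M i).1 x).symm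

theorem integral_mixKernel {ι : Type*} [Fintype ι] (a : ι → ℝ≥0) (M : ι → Model D Φ O)
    (x : D × Φ) {g : O → ℝ} (hg : ∀ i, Integrable g ((M i).1 x)) :
    ∫ o, g o ∂(mixKernel a M x) = ∑ i, (a i : ℝ) * ∫ o, g o ∂((M i).1 x) := by
  rw [mixKernel_apply, integral_finsetSum_measure fun i _ => (hg i).smul_measure_nnreal]
  refine Finset.sum_congr rfl fun i _ => ?_
  rw [integral_smul_nnreal_measure]
  rfl

end Mixtures

/-! ### Best response to a finitely supported prior -/

section Bayes

variable {D : Type u} {Φ : Type v} {O : Type w}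
  [MeasurableSpace D] [MeasurableSpace Φ] [MeasurableSpace O]
  [MeasurableSpace.CountableOrCountablyGenerated (D × Φ) O]
  {𝓒 : Finset (Set (Model D Φ O))}

/-- Best response of the weight functions to a finitely supported mixed strategy `μ` on pairs
`(ψ, M)`, `M ∈ ψ`: the information gained is at least the mean squared Hellinger distance between
the conditional mixtures and the overall mixture, up to constants and smoothing. -/
theorem exists_weightFunction_info_ge {ι : Type*} [Fintype ι] {wt : 𝓒 → ℝ} {c : ℝ} (hc : 0 < c)
    (hw : ∀ i, c ≤ wt i) (hw1 : ∑ i, wt i = 1) {θ : ℝ} (hθ : 0 < θ) (psi : ι → 𝓒)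
    (M : ι → Model D Φ O) (hM : ∀ i, M i ∈ (psi i).1) (μ : ι → ℝ≥0) (hμ : ∑ i, μ i = 1) :
    ∃ Mbar ∈ referenceModels 𝓒, ∃ N : 𝓒 → Model D Φ O,
      (∀ ψ, ∑ i : {i // psi i = ψ}, μ i ≠ 0 → N ψ ∈ co ψ.1) ∧
      ∃ ξ : 𝓒 → Obs D Φ O → ℝ, (∀ ψ, Measurable (ξ ψ)) ∧
        (∀ ψ y, |ξ ψ y| ≤ |Real.log θ| + |Real.log ((1 + θ) / c)|) ∧
        ∀ q : ProbabilityMeasure (D × Φ),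
          ∑ ψ : 𝓒, ((∑ i : {i // psi i = ψ}, μ i : ℝ≥0) : ℝ) *
            (∫⁻ x, hellingerSq ((N ψ).1 x) (Mbar.1 x) ∂(q : Measure (D × Φ))).toReal -
            4 * (𝓒.card * √θ) ≤ 4 * ∑ i, (μ i : ℝ) * info wt q ξ (M i) (psi i) := by
  classical
  set ν : 𝓒 → ℝ≥0 := fun ψ => ∑ i : {i // psi i = ψ}, μ i with hν
  have hw0 : ∀ i, 0 < wt i := fun i => hc.trans_le (hw i)
  have hwle : ∀ i, wt i ≤ 1 := fun i => by
    rw [← hw1]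
    exact Finset.single_le_sum (fun j _ => (hw0 j).le) (Finset.mem_univ i)
  set Mbar : Model D Φ O := mixModel μ hμ M with hMbar
  have hMbar_mem : Mbar ∈ referenceModels 𝓒 := mixModel_mem_co _ _ _ fun i => by
    simp only [Set.mem_iUnion]
    exact ⟨(psi i).1, (psi i).2, hM i⟩
  -- `R ψ` is the part of the mixture coming from ψ. Its density `r ψ` with respect to `Mbar` is the
  -- posterior probability of ψ given the pair and the observation.
  set R : 𝓒 → Kernel (D × Φ) O := fun ψ =>
    mixKernel (fun i : {i // psi i = ψ} => μ i) (fun i => M i) with hR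
  have hRsum : ∀ x, ∑ ψ, R ψ x = Mbar.1 x := fun x =>
    Fintype.sum_fiberwise psi (fun i => μ i • (M i).1 x)
  have hRle : ∀ ψ x, R ψ x ≤ Mbar.1 x := fun ψ x => by
    rw [← hRsum x]
    exact Finset.single_le_sum (f := fun ψ => R ψ x) (fun _ _ => Measure.zero_le _) (Finset.mem_univ ψ)
  choose r hrm hr1 hr using fun ψ => exists_kernel_density_of_le (hRle ψ)
  have hr1' : ∀ ψ y, (r ψ y : ℝ) ≤ 1 := fun ψ y => by exact_mod_cast hr1 ψ y
  have hrm' : ∀ ψ x, Measurable fun o => (r ψ (x, o) : ℝ) := fun ψ x =>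
    ((hrm ψ).comp measurable_prodMk_left).coe_nnreal_real
  have hrmE : ∀ ψ x, Measurable fun o => (r ψ (x, o) : ℝ≥0∞) := fun ψ x =>
    ((hrm ψ).comp measurable_prodMk_left).coe_nnreal_ennreal
  have hrsum : ∀ x, ∀ᵐ o ∂(Mbar.1 x), ∑ ψ, (r ψ (x, o) : ℝ) = 1 := by
    intro x
    have h1 : (Mbar.1 x).withDensity (fun o => ((∑ ψ, r ψ (x, o) : ℝ≥0) : ℝ≥0∞)) =
        (Mbar.1 x).withDensity 1 := by
      rw [withDensity_one]
      nth_rewrite 2 [← hRsum x]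
      ext s hs
      rw [withDensity_apply _ hs, Measure.finsetSum_apply]
      simp only [ENNReal.ofNNReal_finsetSum]
      rw [lintegral_finsetSum _ fun ψ _ => hrmE ψ x]
      refine Finset.sum_congr rfl fun ψ _ => ?_
      rw [hr ψ x, withDensity_apply _ hs]
    have h2 := (withDensity_eq_iff_of_sigmaFinite (by
      have := fun ψ => (hrm ψ).comp (measurable_prodMk_left (x := x))
      simp only [Function.comp_def] at this
      fun_prop) (by fun_prop)).1 h1
    filter_upwards [h2] with o ho
    simp only [Pi.one_apply, ENNReal.coe_eq_one] at ho
    exact_mod_cast ho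
  have hrint : ∀ ψ x, ∫ o, (r ψ (x, o) : ℝ) ∂(Mbar.1 x) = ν ψ := by
    intro ψ x
    have h1 := mixKernel_apply_univ (fun i : {i // psi i = ψ} => μ i) (fun i => M i) x
    change R ψ x Set.univ = _ at h1
    rw [hr ψ x, withDensity_apply _ MeasurableSet.univ, Measure.restrict_univ] at h1
    rw [integral_eq_lintegral_of_nonneg_ae (.of_forall fun o => NNReal.coe_nonneg _)
      (hrm' ψ x).aestronglyMeasurable]
    simp only [ENNReal.ofReal_coe_nnreal]
    rw [h1, ENNReal.coe_toReal]
  -- the conditional mixtures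
  have hcond : ∀ ψ, ν ψ ≠ 0 → ∑ i : {i // psi i = ψ}, μ i / ν ψ = 1 := fun ψ h => by
    rw [← Finset.sum_div]
    exact div_self h
  -- The default value is harmless: a ψ without mass enters the bound with coefficient zero.
  set N : 𝓒 → Model D Φ O := fun ψ =>
    if h : ν ψ ≠ 0 then
      mixModel (fun i : {i // psi i = ψ} => μ i / ν ψ) (hcond ψ h) (fun i => M i)
    else Mbar with hN
  have hNmem : ∀ ψ, ν ψ ≠ 0 → N ψ ∈ co ψ.1 := by
    intro ψ h
    simp only [hN, dif_pos h]
    exact mixModel_mem_co _ _ _ fun i => by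
      have := hM i
      rwa [i.2] at this
  set hsq : 𝓒 → D × Φ → ℝ := fun ψ x =>
    2⁻¹ * ∫ o, (√(r ψ (x, o)) - √(ν ψ)) ^ 2 ∂(Mbar.1 x) with hhsq
  have hν1 : ∀ ψ, (ν ψ : ℝ) ≤ 1 := by
    intro ψ
    have : ν ψ ≤ 1 := by
      rw [← hμ, ← Fintype.sum_fiberwise psi μ]
      exact Finset.single_le_sum (f := fun ψ => ν ψ) (fun _ _ => zero_le) (Finset.mem_univ ψ)
    exact_mod_cast this
  have hsq_bd : ∀ ψ y, (√(r ψ y) - √(ν ψ)) ^ 2 ≤ 1 := by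
    intro ψ y
    have h1 : √(r ψ y) ≤ 1 := Real.sqrt_le_one.2 (hr1' ψ y)
    have h2 : √(ν ψ) ≤ 1 := Real.sqrt_le_one.2 (hν1 ψ)
    have h3 := Real.sqrt_nonneg (r ψ y)
    have h4 := Real.sqrt_nonneg (ν ψ)
    rw [sq_le_one_iff_abs_le_one, abs_le]
    constructor <;> linarith
  have hsq_int : ∀ ψ x, Integrable (fun o => (√(r ψ (x, o)) - √(ν ψ)) ^ 2) (Mbar.1 x) := by
    intro ψ x
    refine Integrable.of_bound (C := 1)
      (((hrm' ψ x).sqrt.sub_const _).pow_const 2).aestronglyMeasurable (.of_forall fun o => ?_)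
    rw [Real.norm_of_nonneg (sq_nonneg _)]
    exact hsq_bd _ _
  have hsq0 : ∀ ψ x, 0 ≤ hsq ψ x := fun ψ x =>
    mul_nonneg (by norm_num) (integral_nonneg fun o => sq_nonneg _)
  have hsqm : ∀ ψ, Measurable (hsq ψ) := by
    intro ψ
    have hm : Measurable fun y : (D × Φ) × O => (√(r ψ y) - √(ν ψ)) ^ 2 := by
      have := (hrm ψ).coe_nnreal_real
      fun_prop
    exact ((StronglyMeasurable.integral_kernel_prod_right'
      hm.stronglyMeasurable).measurable).const_mul _
  -- By Bayes' formula `N ψ` has density r/ν with respect to `Mbar`, so ν times the squared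
  -- Hellinger distance is half the mean of (√r - √ν)².
  have hhell : ∀ ψ, ν ψ ≠ 0 → ∀ x, hellingerSq ((N ψ).1 x) (Mbar.1 x) =
      ENNReal.ofReal (hsq ψ x / ν ψ) := by
    intro ψ h x
    have hfm : Measurable fun o => r ψ (x, o) / ν ψ :=
      ((hrm ψ).comp measurable_prodMk_left).div_const _
    have h1 : (N ψ).1 x = (Mbar.1 x).withDensity (fun o => ((r ψ (x, o) / ν ψ : ℝ≥0) : ℝ≥0∞)) := by
      have e1 : (N ψ).1 x = (ν ψ)⁻¹ • R ψ x := by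
        simp only [hN, dif_pos h, hR]
        change mixKernel _ _ x = _
        rw [mixKernel_apply, mixKernel_apply, Finset.smul_sum]
        refine Finset.sum_congr rfl fun i _ => ?_
        rw [smul_smul, div_eq_inv_mul]
      rw [e1, hr ψ x]
      have e2 : (fun o => ((r ψ (x, o) / ν ψ : ℝ≥0) : ℝ≥0∞)) =
          (((ν ψ)⁻¹ : ℝ≥0) : ℝ≥0∞) • fun o => (r ψ (x, o) : ℝ≥0∞) := by
        ext o
        rw [Pi.smul_apply, smul_eq_mul, ← ENNReal.coe_mul, div_eq_inv_mul]
      rw [e2, withDensity_smul _ (hrmE ψ x)]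
      ext s
      rfl
    have hfin : IsFiniteMeasure
        ((Mbar.1 x).withDensity (fun o => ((r ψ (x, o) / ν ψ : ℝ≥0) : ℝ≥0∞))) := by
      rw [← h1]; infer_instance
    have hν0 : (0 : ℝ) < ν ψ := by
      have := pos_iff_ne_zero.2 h
      exact_mod_cast this
    rw [h1, hellingerSq_withDensity _ hfm]
    have e2 : ∀ o, (√((r ψ (x, o) / ν ψ : ℝ≥0) : ℝ) - 1) ^ 2 =
        (ν ψ : ℝ)⁻¹ * (√(r ψ (x, o)) - √(ν ψ)) ^ 2 := by
      intro o
      push_cast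
      rw [Real.sqrt_div (NNReal.coe_nonneg _)]
      have h3 := Real.sq_sqrt hν0.le
      have h4 := (Real.sqrt_pos.2 hν0).ne'
      rw [div_sub_one h4, div_pow, h3]
      field_simp
    simp only [e2]
    rw [← ofReal_integral_eq_lintegral_ofReal ((hsq_int ψ x).const_mul _)
      (.of_forall fun o => by positivity), integral_const_mul, hhsq]
    have : (2⁻¹ : ℝ≥0∞) = ENNReal.ofReal 2⁻¹ := by
      rw [ENNReal.ofReal_inv_of_pos (by norm_num)]; simp
    rw [this, ← ENNReal.ofReal_mul (by norm_num)]
    congr 1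
    ring
  -- the weight functions
  set ξ : 𝓒 → Obs D Φ O → ℝ := fun ψ y => 2⁻¹ * Real.log ((r ψ y + θ) / wt ψ) with hξ
  have hξm : ∀ ψ, Measurable (ξ ψ) := fun ψ => by
    have := (hrm ψ).coe_nnreal_real
    fun_prop
  have hξA : ∀ ψ y, |ξ ψ y| ≤ |Real.log θ| + |Real.log ((1 + θ) / c)| := by
    intro ψ y
    have h1 : θ ≤ (r ψ y + θ) / wt ψ := by
      rw [le_div_iff₀ (hw0 ψ)]
      nlinarith [hwle ψ, NNReal.coe_nonneg (r ψ y)]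
    have h2 : (r ψ y + θ) / wt ψ ≤ (1 + θ) / c := by
      have := hr1' ψ y
      have := hw ψ
      gcongr
    have h3 := Real.log_le_log hθ h1
    have h4 := Real.log_le_log (hθ.trans_le h1) h2
    have h5 := neg_abs_le (Real.log θ)
    have h6 := le_abs_self (Real.log ((1 + θ) / c))
    have h7 := abs_nonneg (Real.log θ)
    have h8 := abs_nonneg (Real.log ((1 + θ) / c))
    simp only [hξ]
    rw [abs_le]
    constructor <;> linarith
  have hξw : ξ ∈ weightFunctions 𝓒 := ⟨hξm, _, hξA⟩
  refine ⟨Mbar, hMbar_mem, N, hNmem, ξ, hξm, hξA, fun q => ?_⟩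
  have hx : ∀ x, ∑ ψ, hsq ψ x - 4 * (𝓒.card * √θ) ≤
      4 * ∑ i, (μ i : ℝ) * infoAt wt ξ (M i) (psi i) x := by
    intro x
    -- Drawing the observation from `Mbar` and then ψ from the posterior is the same as drawing (ψ,
    -- M) from the prior and then the observation from M.
    have hswitch : ∀ ψ, ∫ o, (r ψ (x, o) : ℝ) * gap wt ξ ψ (x, o) ∂(Mbar.1 x) =
        ∑ i : {i // psi i = ψ}, (μ i : ℝ) * infoAt wt ξ (M i) (psi i) x := by
      intro ψ
      have h1 := integral_withDensity_eq_integral_smul (μ := Mbar.1 x)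
        ((hrm ψ).comp (measurable_prodMk_left (x := x))) (fun o => gap wt ξ ψ (x, o))
      simp only [Function.comp_apply, NNReal.smul_def, smul_eq_mul] at h1
      rw [← h1, ← hr ψ x, hR]
      simp only
      rw [integral_mixKernel _ _ _ fun i => integrable_gap hξw _ _ _]
      refine Finset.sum_congr rfl fun i _ => ?_
      rw [i.2]
      rfl
    rw [← Fintype.sum_fiberwise psi (fun i => (μ i : ℝ) * infoAt wt ξ (M i) (psi i) x)]
    simp only [← hswitch]
    have hcard : (𝓒.card : ℝ) = Fintype.card 𝓒 := by simp
    rw [hcard]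
    have := integral_sum_mul_gap_ge (Mbar.1 x) hw0 hw1 (hrm' · x)
      (fun ψ o => NNReal.coe_nonneg (r ψ (x, o))) (fun ψ o => hr1' ψ (x, o)) (hrsum x) hθ
      (g := fun ψ o => gap wt ξ ψ (x, o)) (fun ψ =>
        (integrable_gap hξw Mbar ψ x).bdd_mul (c := 1) (hrm' ψ x).aestronglyMeasurable
          (.of_forall fun o => by
            rw [Real.norm_of_nonneg (NNReal.coe_nonneg _)]
            exact hr1' _ _)) (fun ψ o => rfl)
    simp only [hrint] at this
    exact this
  have hsqi : ∀ ψ, Integrable (hsq ψ) (q : Measure (D × Φ)) := by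
    intro ψ
    refine Integrable.of_bound (C := 1) (hsqm ψ).aestronglyMeasurable (.of_forall fun x => ?_)
    rw [Real.norm_of_nonneg (hsq0 ψ x)]
    have : ∫ o, (√(r ψ (x, o)) - √(ν ψ)) ^ 2 ∂(Mbar.1 x) ≤ ∫ _, (1 : ℝ) ∂(Mbar.1 x) :=
      integral_mono (hsq_int ψ x) (integrable_const _) fun o => hsq_bd _ _
    simp only [integral_const, probReal_univ, smul_eq_mul, one_mul] at this
    simp only [hhsq]
    linarith
  have hhellint : ∀ ψ, (ν ψ : ℝ) *
      (∫⁻ x, hellingerSq ((N ψ).1 x) (Mbar.1 x) ∂(q : Measure (D × Φ))).toReal ≤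
        ∫ x, hsq ψ x ∂(q : Measure (D × Φ)) := by
    intro ψ
    by_cases h : ν ψ = 0
    · simp only [h, NNReal.coe_zero, zero_mul]
      exact integral_nonneg (hsq0 ψ)
    · have hν0 : (0 : ℝ) < ν ψ := by
        have := pos_iff_ne_zero.2 h
        exact_mod_cast this
      simp only [hhell ψ h]
      rw [← ofReal_integral_eq_lintegral_ofReal ((hsqi ψ).div_const _)
        (.of_forall fun x => div_nonneg (hsq0 ψ x) hν0.le), integral_div,
        ENNReal.toReal_ofReal (div_nonneg (integral_nonneg (hsq0 ψ)) hν0.le),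
        mul_div_cancel₀ _ hν0.ne']
  have hfinal : ∫ x, (∑ ψ, hsq ψ x - 4 * (𝓒.card * √θ)) ∂(q : Measure (D × Φ)) ≤
      ∫ x, 4 * ∑ i, (μ i : ℝ) * infoAt wt ξ (M i) (psi i) x ∂(q : Measure (D × Φ)) :=
    integral_mono ((integrable_finsetSum _ fun ψ _ => hsqi ψ).sub (integrable_const _))
      ((integrable_finsetSum _ fun i _ =>
        (integrable_infoAt hξw (M i) (psi i) _).const_mul _).const_mul _) hx
  have hright : ∫ x, 4 * ∑ i, (μ i : ℝ) * infoAt wt ξ (M i) (psi i) x ∂(q : Measure (D × Φ)) =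
      4 * ∑ i, (μ i : ℝ) * info wt q ξ (M i) (psi i) := by
    rw [integral_const_mul, integral_finsetSum _ fun i _ =>
        (integrable_infoAt hξw (M i) (psi i) _).const_mul _]
    simp only [integral_const_mul]
    rfl
  rw [hright, integral_sub (integrable_finsetSum _ fun ψ _ => hsqi ψ) (integrable_const _),
    integral_finsetSum _ fun ψ _ => hsqi ψ] at hfinal
  simp only [integral_const, probReal_univ, smul_eq_mul, one_mul] at hfinal
  refine le_trans ?_ hfinal
  gcongr with ψ _
  exact hhellint ψ

end Bayes

/-! ### From an offset bound to the value of exploration-by-optimization -/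

section OffsetMinimax

variable {D : Type u} {Φ : Type v} {O : Type w}
  [MeasurableSpace D] [MeasurableSpace Φ] [MeasurableSpace O]
  {𝓒 : Finset (Set (Model D Φ O))}

/-- An upper bound `B` on the offset version of the decision-estimation coefficient, with
coefficient `γ`. -/
def OffsetBound (L : 𝓒 → D → ℝ≥0) (γ B : ℝ) : Prop :=
  ∀ Mbar ∈ referenceModels 𝓒, ∀ (F : Finset 𝓒), F.Nonempty → ∀ N : 𝓒 → Model D Φ O,
    (∀ ψ ∈ F, N ψ ∈ co ψ.1) →
    ∃ (p : ProbabilityMeasure D) (q : ProbabilityMeasure (D × Φ)),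
      (∀ ψ, ∫⁻ d, (L ψ d : ℝ≥0∞) ∂(p : Measure D) ≠ ⊤) ∧
      ∀ ψ ∈ F, (∫⁻ d, (L ψ d : ℝ≥0∞) ∂(p : Measure D)).toReal ≤
        B + γ * (∫⁻ x, hellingerSq ((N ψ).1 x) (Mbar.1 x) ∂(q : Measure (D × Φ))).toReal

theorem objectiveAt_eq_coe {L : 𝓒 → D → ℝ≥0} {γ : ℝ} {wt : 𝓒 → ℝ} {p : Measure D}
    {q : Measure (D × Φ)} {ξ : 𝓒 → Obs D Φ O → ℝ} {M : Model D Φ O} {ψ : 𝓒}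
    (hp : ∫⁻ d, (L ψ d : ℝ≥0∞) ∂p ≠ ⊤) :
    objectiveAt L γ wt p q ξ M ψ =
      (((∫⁻ d, (L ψ d : ℝ≥0∞) ∂p).toReal - γ * info wt q ξ M ψ : ℝ) : EReal) := by
  rw [objectiveAt_eq, EReal.coe_sub, EReal.coe_ennreal_toReal hp]

theorem lintegral_mixture {X : Type*} [MeasurableSpace X] (μ ν : ProbabilityMeasure X) {a b : ℝ}
    (ha : 0 ≤ a) (hb : 0 ≤ b) (hab : a + b = 1) (f : X → ℝ≥0∞) :
    ∫⁻ x, f x ∂(mixture μ ν a b ha hb hab : Measure X) =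
      ENNReal.ofReal a * ∫⁻ x, f x ∂(μ : Measure X) +
        ENNReal.ofReal b * ∫⁻ x, f x ∂(ν : Measure X) := by
  change ∫⁻ x, f x ∂(a.toNNReal • (μ : Measure X) + b.toNNReal • (ν : Measure X)) = _
  rw [lintegral_add_measure, ← Measure.coe_nnreal_smul, ← Measure.coe_nnreal_smul,
    lintegral_smul_measure, lintegral_smul_measure]
  rfl

/-- Closeness uniform in the pair passes to the information term under any exploration law q, so the
net of models can be fixed before q. -/
theorem abs_info_sub_le {wt : 𝓒 → ℝ} {ξ : 𝓒 → Obs D Φ O → ℝ} (hξ : ξ ∈ weightFunctions 𝓒)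
    {M M' : Model D Φ O} {ψ : 𝓒} {ε G : ℝ}
    (h : ∀ x, |infoAt wt ξ M ψ x - infoAt wt ξ M' ψ x| ≤ ε * G)
    (q : Measure (D × Φ)) [IsProbabilityMeasure q] :
    |info wt q ξ M ψ - info wt q ξ M' ψ| ≤ ε * G := by
  unfold info
  rw [← integral_sub (integrable_infoAt hξ M ψ q) (integrable_infoAt hξ M' ψ q)]
  have := norm_integral_le_of_norm_le_const (μ := q)
    (f := fun x => infoAt wt ξ M ψ x - infoAt wt ξ M' ψ x) (C := ε * G) (.of_forall h)
  simpa using this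

theorem lintegral_dirac_loss_ne_top {L : 𝓒 → D → ℝ≥0} (hL : ∀ ψ, Measurable (L ψ)) (d : D)
    (ψ : 𝓒) : ∫⁻ d, (L ψ d : ℝ≥0∞) ∂(Measure.dirac d) ≠ ⊤ := by
  rw [lintegral_dirac' _ (hL ψ).coe_nnreal_ennreal]
  exact ENNReal.coe_ne_top

variable [MeasurableSpace.CountableOrCountablyGenerated (D × Φ) O]

/-- Averaged form of the bound on the objective: against every finitely supported mixed strategy
there is a good response with bounded weight functions. -/
theorem exists_average_objective_le {L : 𝓒 → D → ℝ≥0} {γ B : ℝ} (hγ : 0 < γ)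
    (hB : OffsetBound L γ B) {ι : Type*} [Fintype ι] {wt : 𝓒 → ℝ} {c : ℝ} (hc : 0 < c)
    (hw : ∀ i, c ≤ wt i) (hw1 : ∑ i, wt i = 1) {θ : ℝ} (hθ : 0 < θ) (psi : ι → 𝓒)
    (M : ι → Model D Φ O) (hM : ∀ i, M i ∈ (psi i).1) (μ : ι → ℝ) (hμ0 : ∀ i, 0 ≤ μ i)
    (hμ : ∑ i, μ i = 1) :
    ∃ (p : ProbabilityMeasure D) (q : ProbabilityMeasure (D × Φ)) (ξ : 𝓒 → Obs D Φ O → ℝ),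
      (∀ ψ, ∫⁻ d, (L ψ d : ℝ≥0∞) ∂(p : Measure D) ≠ ⊤) ∧ (∀ ψ, Measurable (ξ ψ)) ∧
      (∀ ψ y, |ξ ψ y| ≤ |Real.log θ| + |Real.log ((1 + θ) / c)|) ∧
      ∑ i, μ i * ((∫⁻ d, (L (psi i) d : ℝ≥0∞) ∂(p : Measure D)).toReal -
        4 * γ * info wt q ξ (M i) (psi i)) ≤ B + 4 * γ * (𝓒.card * √θ) := by
  classical
  lift μ to ι → ℝ≥0 using hμ0
  have hμ' : ∑ i, μ i = 1 := by
    simp only at hμ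
    exact_mod_cast hμ
  obtain ⟨Mbar, hMbar, N, hN, ξ, hξm, hξA, hinfo⟩ :=
    exists_weightFunction_info_ge hc hw hw1 hθ psi M hM μ hμ'
  set ν : 𝓒 → ℝ≥0 := fun ψ => ∑ i : {i // psi i = ψ}, μ i with hν
  have hν1 : ∑ ψ, ν ψ = 1 := by
    rw [← hμ']
    exact Fintype.sum_fiberwise psi μ
  have hF : (Finset.univ.filter fun ψ => ν ψ ≠ 0).Nonempty := by
    by_contra hne
    rw [Finset.not_nonempty_iff_eq_empty, Finset.filter_eq_empty_iff] at hne
    simp only [Finset.mem_univ, not_not, true_implies] at hne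
    simp [hne] at hν1
  -- `Mbar`, `N` and ξ do not depend on q, so p and q may be chosen last. Only the ψ of positive
  -- mass have `N ψ ∈ co ψ`.
  obtain ⟨p, q, hfin, hpq⟩ := hB Mbar hMbar _ hF N fun ψ hψ => hN ψ (Finset.mem_filter.1 hψ).2
  refine ⟨p, q, ξ, hfin, hξm, hξA, ?_⟩
  have h1 := hinfo q
  set ℓ : 𝓒 → ℝ := fun ψ => (∫⁻ d, (L ψ d : ℝ≥0∞) ∂(p : Measure D)).toReal with hℓ
  set H : 𝓒 → ℝ := fun ψ =>
    (∫⁻ x, hellingerSq ((N ψ).1 x) (Mbar.1 x) ∂(q : Measure (D × Φ))).toReal with hH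
  have h2 : ∑ i, (μ i : ℝ) * ℓ (psi i) = ∑ ψ, (ν ψ : ℝ) * ℓ ψ := by
    rw [← Fintype.sum_fiberwise psi]
    refine Finset.sum_congr rfl fun ψ _ => ?_
    rw [hν]
    push_cast
    rw [Finset.sum_mul]
    exact Finset.sum_congr rfl fun i _ => by rw [i.2]
  have h3 : ∑ ψ, (ν ψ : ℝ) * ℓ ψ ≤ B + γ * ∑ ψ, (ν ψ : ℝ) * H ψ := by
    have : B = ∑ ψ, (ν ψ : ℝ) * B := by
      rw [← Finset.sum_mul]
      have : ∑ ψ, (ν ψ : ℝ) = 1 := by exact_mod_cast hν1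
      rw [this, one_mul]
    rw [this, Finset.mul_sum, ← Finset.sum_add_distrib]
    refine Finset.sum_le_sum fun ψ _ => ?_
    by_cases h0 : ν ψ = 0
    · simp [h0]
    · have := mul_le_mul_of_nonneg_left (hpq ψ (by simpa using h0)) (NNReal.coe_nonneg (ν ψ))
      calc (ν ψ : ℝ) * ℓ ψ ≤ _ := this
        _ = _ := by ring
  have h4 : ∑ i, (μ i : ℝ) * (ℓ (psi i) - 4 * γ * info wt q ξ (M i) (psi i)) =
      ∑ i, (μ i : ℝ) * ℓ (psi i) - γ * (4 * ∑ i, (μ i : ℝ) * info wt q ξ (M i) (psi i)) := by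
    rw [Finset.mul_sum, Finset.mul_sum, ← Finset.sum_sub_distrib]
    exact Finset.sum_congr rfl fun i _ => by ring
  rw [h4, h2]
  have h5 := mul_le_mul_of_nonneg_left h1 hγ.le
  change γ * (∑ ψ, (ν ψ : ℝ) * H ψ - 4 * (𝓒.card * √θ)) ≤ _ at h5
  nlinarith

/-- The minimax argument: an offset bound controls the value of exploration-by-optimization. -/
theorem exists_objective_le [Nonempty D] [Nonempty Φ]
    (hcov : FiniteCovering (convexifiedClass 𝓒)) {L : 𝓒 → D → ℝ≥0} (hL : ∀ ψ, Measurable (L ψ))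
    {γ B : ℝ} (hγ : 0 < γ)
    (hB : OffsetBound L γ B) {wt : 𝓒 → ℝ} (hw : ∀ i, 0 < wt i) (hw1 : ∑ i, wt i = 1) {s : ℝ}
    (hs : 0 < s) :
    ∃ (p : ProbabilityMeasure D) (q : ProbabilityMeasure (D × Φ)), ∃ ξ ∈ weightFunctions 𝓒,
      objective L (4 * γ) wt (p : Measure D) (q : Measure (D × Φ)) ξ ≤ ((B + s : ℝ) : EReal) := by
  classical
  have hne : Nonempty 𝓒 := by
    by_contra h
    rw [not_nonempty_iff] at h
    simp at hw1
  obtain ⟨i₀, hi₀⟩ := Finite.exists_min wt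
  set c := wt i₀
  have hc : 0 < c := hw i₀
  have hcard : (0 : ℝ) < 𝓒.card := by
    have : 0 < Fintype.card 𝓒 := Fintype.card_pos
    rw [Fintype.card_coe] at this
    exact_mod_cast this
  -- The slack s is split into thirds: smoothing (through θ), the minimax step, and the net (through
  -- ε). The order matters: θ fixes the bound A on the weight functions, A fixes the bound G on the
  -- gap, and G fixes the mesh ε.
  set θ : ℝ := (s / (12 * γ * 𝓒.card)) ^ 2 with hθdef
  have hθ : 0 < θ := by positivity
  have hθs : 4 * γ * (𝓒.card * √θ) = s / 3 := by
    rw [hθdef, Real.sqrt_sq (by positivity)]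
    field_simp
    norm_num
  set A := |Real.log θ| + |Real.log ((1 + θ) / c)| with hA
  have hA0 : 0 ≤ A := by positivity
  set G := Real.exp (2 * A) with hG
  have hG0 : 0 < G := Real.exp_pos _
  set ε := s / (12 * γ * G) with hε
  have hε0 : 0 < ε := by positivity
  choose S hSfin hSsub hS using fun ψ => exists_finite_internal_cover hcov hε0 (𝓒 := 𝓒) ψ
  have : ∀ ψ, Finite (S ψ) := fun ψ => (hSfin ψ).to_subtype
  have : Fintype (Σ ψ : 𝓒, S ψ) := Fintype.ofFinite _
  -- Both restrictions, finite losses and the common bound A, survive mixing, so the family remains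
  -- convex-like.
  set X := {t : ProbabilityMeasure D × ProbabilityMeasure (D × Φ) × (𝓒 → Obs D Φ O → ℝ) //
    (∀ ψ, ∫⁻ d, (L ψ d : ℝ≥0∞) ∂(t.1 : Measure D) ≠ ⊤) ∧ (∀ ψ, Measurable (t.2.2 ψ)) ∧
      ∀ ψ y, |t.2.2 ψ y| ≤ A} with hX
  have hXne : Nonempty X := by
    obtain ⟨d⟩ := ‹Nonempty D›
    obtain ⟨f⟩ := ‹Nonempty Φ›
    exact ⟨⟨(⟨Measure.dirac d, inferInstance⟩, ⟨Measure.dirac (d, f), inferInstance⟩, fun _ _ => 0),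
      lintegral_dirac_loss_ne_top hL d, fun _ => measurable_const, fun _ _ => by simpa using hA0⟩⟩
  set V : X → (Σ ψ : 𝓒, S ψ) → ℝ := fun t i =>
    (∫⁻ d, (L i.1 d : ℝ≥0∞) ∂(t.1.1 : Measure D)).toReal -
      4 * γ * info wt t.1.2.1 t.1.2.2 i.2.1 i.1 with hV
  obtain ⟨⟨⟨p, q, ξ⟩, hfin, hξm, hξA⟩, ht⟩ := exists_forall_lt_of_convexlike V (B := B + s / 3)
    (s := s / 3) (by
      rintro ⟨⟨p₁, q₁, ξ₁⟩, hf₁, hm₁, hA₁⟩ ⟨⟨p₂, q₂, ξ₂⟩, hf₂, hm₂, hA₂⟩ a b ha hb hab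
      obtain ⟨q, ξ, hm, hA', hinfo⟩ := exists_info_mixture_ge (fun i => (hw i).le) q₁ q₂ hm₁ hm₂
        hA₁ hA₂ ha hb hab
      have hmix := fun ψ => lintegral_mixture p₁ p₂ ha hb hab (fun d => (L ψ d : ℝ≥0∞))
      have hx₁ := fun ψ => ENNReal.mul_ne_top (ENNReal.ofReal_ne_top (r := a)) (hf₁ ψ)
      have hx₂ := fun ψ => ENNReal.mul_ne_top (ENNReal.ofReal_ne_top (r := b)) (hf₂ ψ)
      refine ⟨⟨⟨mixture p₁ p₂ a b ha hb hab, q, ξ⟩, fun ψ => ?_, hm, hA'⟩, fun i => ?_⟩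
      · rw [hmix]
        exact ENNReal.add_ne_top.2 ⟨hx₁ ψ, hx₂ ψ⟩
      · simp only [hV]
        rw [hmix, ENNReal.toReal_add (hx₁ _) (hx₂ _), ENNReal.toReal_mul, ENNReal.toReal_mul,
          ENNReal.toReal_ofReal ha, ENNReal.toReal_ofReal hb]
        have := mul_le_mul_of_nonneg_left (hinfo i.2.1 i.1) hγ.le
        nlinarith) (by positivity) (by
      intro μ hμ0 hμ
      obtain ⟨p, q, ξ, hfin, hξm, hξA, h⟩ := exists_average_objective_le hγ hB hc hi₀ hw1 hθ
        (fun i : Σ ψ : 𝓒, S ψ => i.1) (fun i => i.2.1) (fun i => hSsub _ i.2.2) μ hμ0 hμ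
      rw [hθs] at h
      exact ⟨⟨⟨p, q, ξ⟩, hfin, hξm, hξA⟩, h⟩)
  have hξw : ξ ∈ weightFunctions 𝓒 := ⟨hξm, A, hξA⟩
  refine ⟨p, q, ξ, hξw, iSup_le fun ψ => iSup₂_le fun M hM => ?_⟩
  rw [objectiveAt_eq_coe (hfin ψ), EReal.coe_le_coe_iff]
  obtain ⟨M', hM', hclose⟩ := hS ψ M hM
  have h1 : (∫⁻ d, (L ψ d : ℝ≥0∞) ∂(p : Measure D)).toReal - 4 * γ * info wt q ξ M' ψ <
    B + s / 3 + s / 3 := ht ⟨ψ, M', hM'⟩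
  have h2 := abs_info_sub_le hξw (fun x => hclose x (fun o => gap wt ξ ψ (x, o))
    ((measurable_gap hξm ψ).comp measurable_prodMk_left) G fun o =>
      abs_gap_le (fun i => (hw i).le) hw1 hξA ψ _) (q : Measure (D × Φ))
  have h3 : 4 * γ * (ε * G) = s / 3 := by
    rw [hε]
    field_simp
    norm_num
  have h4 := mul_le_mul_of_nonneg_left (abs_le.1 h2).1 (by positivity : 0 ≤ 4 * γ)
  nlinarith

theorem exo_le [Nonempty D] [Nonempty Φ]
    (hcov : FiniteCovering (convexifiedClass 𝓒)) {L : 𝓒 → D → ℝ≥0} (hL : ∀ ψ, Measurable (L ψ))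
    {γ B : ℝ} (hγ : 0 < γ)
    (hB : OffsetBound L γ B) {wt : 𝓒 → ℝ} (hw : ∀ i, 0 < wt i) (hw1 : ∑ i, wt i = 1) :
    exo L (4 * γ) wt ≤ (B : EReal) := by
  refine EReal.le_of_forall_lt_iff_le.1 fun b hb => ?_
  obtain ⟨p, q, ξ, hξ, h⟩ := exists_objective_le hcov hL hγ hB hw hw1
    (sub_pos.2 (EReal.coe_lt_coe_iff.1 hb))
  rw [add_sub_cancel] at h
  exact (iInf_le_of_le p (iInf_le_of_le q (iInf₂_le_of_le ξ hξ h)))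

end OffsetMinimax

/-! ### Regret of exponential weights along the protocol -/

section Analysis

variable {D : Type u} {Φ : Type v} {O : Type w}
  [MeasurableSpace D] [MeasurableSpace Φ] [MeasurableSpace O]
  {𝓒 : Finset (Set (Model D Φ O))}

section Weights

variable {ξ : (t : ℕ) → (Fin t → Obs D Φ O) → 𝓒 → Obs D Φ O → ℝ}

theorem expWeights_pos (t : ℕ) (h : Fin t → Obs D Φ O) (ψ : 𝓒) : 0 < expWeights ξ t h ψ := by
  induction t generalizing ψ with
  | zero =>
    have : 0 < 𝓒.card := Finset.card_pos.2 ⟨ψ.1, ψ.2⟩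
    simp only [expWeights]
    positivity
  | succ t ih =>
    simp only [expWeights]
    exact div_pos (mul_pos (ih _ _) (Real.exp_pos _))
      (Finset.sum_pos (fun i _ => mul_pos (ih _ _) (Real.exp_pos _)) ⟨ψ, Finset.mem_univ _⟩)

theorem sum_expWeights (hne : 𝓒.Nonempty) (t : ℕ) (h : Fin t → Obs D Φ O) :
    ∑ ψ, expWeights ξ t h ψ = 1 := by
  obtain ⟨P, hP⟩ := hne
  cases t with
  | zero =>
    have : 0 < 𝓒.card := Finset.card_pos.2 ⟨P, hP⟩
    simp only [expWeights, Finset.sum_const, Finset.card_univ, Fintype.card_coe, nsmul_eq_mul]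
    field_simp
  | succ t =>
    simp only [expWeights]
    rw [← Finset.sum_div, div_self]
    exact (Finset.sum_pos (fun i _ => mul_pos (expWeights_pos _ _ _) (Real.exp_pos _))
      ⟨⟨P, hP⟩, Finset.mem_univ _⟩).ne'

theorem measurable_init (t : ℕ) :
    Measurable fun h : Fin (t + 1) → Obs D Φ O => (Fin.init h : Fin t → Obs D Φ O) :=
  measurable_pi_iff.2 fun _ => measurable_pi_apply _

theorem measurable_expWeights
    (hξ : ∀ t ψ, Measurable fun y : (Fin t → Obs D Φ O) × Obs D Φ O => ξ t y.1 ψ y.2) (t : ℕ)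
    (ψ : 𝓒) : Measurable fun h => expWeights ξ t h ψ := by
  induction t generalizing ψ with
  | zero => exact measurable_const
  | succ t ih =>
    simp only [expWeights]
    have h1 : ∀ ψ, Measurable fun h : Fin (t + 1) → Obs D Φ O =>
        expWeights ξ t (Fin.init h) ψ * Real.exp (ξ t (Fin.init h) ψ (h (Fin.last t))) := fun ψ =>
      ((ih ψ).comp (measurable_init t)).mul (((hξ t ψ).comp
        ((measurable_init t).prodMk (measurable_pi_apply (Fin.last t)))).exp)
    exact (h1 ψ).div (Finset.measurable_sum _ fun i _ => h1 i)

end Weights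

/-- The right-hand side is exactly the factor by which the update multiplies 1/w(ψ); this links the
objective to exponential weights. -/
theorem one_sub_gap {wt : 𝓒 → ℝ} (hw1 : ∑ i, wt i = 1) (ξ : 𝓒 → Obs D Φ O → ℝ) (ψ : 𝓒)
    (y : Obs D Φ O) :
    1 - gap wt ξ ψ y = (∑ ψ', wt ψ' * Real.exp (ξ ψ' y)) / Real.exp (ξ ψ y) := by
  unfold gap
  simp only [mul_sub, mul_one, Finset.sum_sub_distrib, hw1, Real.exp_sub, sub_sub_cancel]
  rw [Finset.sum_div]
  exact Finset.sum_congr rfl fun i _ => by ring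

theorem one_sub_gap_nonneg {wt : 𝓒 → ℝ} (hw : ∀ i, 0 ≤ wt i) (hw1 : ∑ i, wt i = 1)
    (ξ : 𝓒 → Obs D Φ O → ℝ) (ψ : 𝓒) (y : Obs D Φ O) : 0 ≤ 1 - gap wt ξ ψ y := by
  rw [one_sub_gap hw1]
  exact div_nonneg (Finset.sum_nonneg fun i _ => mul_nonneg (hw i) (Real.exp_pos _).le)
    (Real.exp_pos _).le

theorem le_of_objectiveAt_le {L : 𝓒 → D → ℝ≥0} {γ : ℝ} {wt : 𝓒 → ℝ} {p : Measure D}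
    {q : Measure (D × Φ)} {ξ : 𝓒 → Obs D Φ O → ℝ} {M : Model D Φ O} {ψ : 𝓒} {B : ℝ}
    (h : objectiveAt L γ wt p q ξ M ψ ≤ (B : EReal)) :
    ∫⁻ d, (L ψ d : ℝ≥0∞) ∂p ≠ ⊤ ∧
      (∫⁻ d, (L ψ d : ℝ≥0∞) ∂p).toReal - γ * info wt q ξ M ψ ≤ B := by
  have hfin : ∫⁻ d, (L ψ d : ℝ≥0∞) ∂p ≠ ⊤ := by
    intro htop
    rw [objectiveAt_eq, htop, EReal.coe_ennreal_top, EReal.top_sub_coe] at h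
    exact absurd (h.trans_lt (EReal.coe_lt_top B)) (lt_irrefl _)
  refine ⟨hfin, ?_⟩
  rwa [objectiveAt_eq_coe hfin, EReal.coe_le_coe_iff] at h

/-- Expectation of the likelihood-ratio-type increment of the weights. -/
theorem lintegral_one_sub_gap {wt : 𝓒 → ℝ} (hw : ∀ i, 0 ≤ wt i) (hw1 : ∑ i, wt i = 1)
    {ξ : 𝓒 → Obs D Φ O → ℝ} (hξ : ξ ∈ weightFunctions 𝓒) (q : Measure (D × Φ))
    [IsProbabilityMeasure q] (M : Model D Φ O) (ψ : 𝓒) :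
    ∫⁻ x, ∫⁻ o, ENNReal.ofReal (1 - gap wt ξ ψ (x, o)) ∂(M.1 x) ∂q =
      ENNReal.ofReal (1 - info wt q ξ M ψ) := by
  have h1 : ∀ x, ∫⁻ o, ENNReal.ofReal (1 - gap wt ξ ψ (x, o)) ∂(M.1 x) =
      ENNReal.ofReal (1 - infoAt wt ξ M ψ x) := by
    intro x
    rw [← ofReal_integral_eq_lintegral_ofReal (f := fun o => 1 - gap wt ξ ψ (x, o))
      ((integrable_const _).sub (integrable_gap hξ M ψ x))
      (.of_forall fun o => one_sub_gap_nonneg hw hw1 ξ ψ _),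
      integral_sub (integrable_const _) (integrable_gap hξ M ψ x)]
    simp [infoAt]
  have h2 : ∀ x, 0 ≤ 1 - infoAt wt ξ M ψ x := by
    intro x
    have : ∫ o, (1 - gap wt ξ ψ (x, o)) ∂(M.1 x) = 1 - infoAt wt ξ M ψ x := by
      rw [integral_sub (integrable_const _) (integrable_gap hξ M ψ x)]
      simp [infoAt]
    rw [← this]
    exact integral_nonneg fun o => one_sub_gap_nonneg hw hw1 ξ ψ _
  simp only [h1]
  rw [← ofReal_integral_eq_lintegral_ofReal (f := fun x => 1 - infoAt wt ξ M ψ x)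
      ((integrable_const _).sub (integrable_infoAt hξ M ψ q)) (.of_forall h2),
      integral_sub (integrable_const _) (integrable_infoAt hξ M ψ q)]
  simp [info]

section Protocol

variable {Z : Type z} [MeasurableSpace Z]

theorem measurable_snoc_round (t : ℕ) :
    Measurable fun x : (Fin t → Round D Φ O Z) × Round D Φ O Z =>
      (Fin.snoc (α := fun _ => Round D Φ O Z) x.1 x.2 : Fin (t + 1) → Round D Φ O Z) := by
  refine measurable_pi_iff.2 fun i => ?_
  refine Fin.lastCases ?_ (fun j => ?_) i
  · simp only [Fin.snoc_last]
    exact measurable_snd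
  · simp only [Fin.snoc_castSucc]
    exact (measurable_pi_apply j).comp measurable_fst

instance isMarkovKernel_roundKernel {T : ℕ} (alg : Algorithm D Φ O T) (env : Environment D Φ O Z)
    (t : ℕ) : IsMarkovKernel (roundKernel alg env t) := by
  have := env.model_markov
  have := env.choose_markov t
  have := alg.explore_markov t
  unfold roundKernel
  infer_instance

instance isProbabilityMeasure_historyLaw {T : ℕ} (alg : Algorithm D Φ O T)
    (env : Environment D Φ O Z) (t : ℕ) : IsProbabilityMeasure (historyLaw alg env t) := by
  induction t with
  | zero => unfold historyLaw; infer_instance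
  | succ t ih =>
    unfold historyLaw
    exact Measure.isProbabilityMeasure_map (measurable_snoc_round t).aemeasurable

theorem lintegral_roundKernel {T : ℕ} (alg : Algorithm D Φ O T) (env : Environment D Φ O Z)
    (t : ℕ) (h : Fin t → Round D Φ O Z) {f : Obs D Φ O → ℝ≥0∞} (hf : Measurable f) :
    ∫⁻ r, f (r.1.2, r.2) ∂(roundKernel alg env t h) =
      ∫⁻ l, ∫⁻ x, ∫⁻ o, f (x, o) ∂((env.modelAt l).1 x) ∂(alg.explore t (visible h))
        ∂(env.choose t h) := by
  have := env.model_markov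
  have := env.choose_markov t
  have := alg.explore_markov t
  have hm : Measurable fun r : Round D Φ O Z => f (r.1.2, r.2) := by fun_prop
  unfold roundKernel
  rw [Kernel.lintegral_compProd _ _ _ hm, Kernel.prod_apply]
  have hm2 : Measurable fun y : Z × (D × Φ) => ∫⁻ o, f (y.2, o) ∂(env.model y) :=
    Measurable.lintegral_kernel_prod_right'
      (f := fun r : Round D Φ O Z => f (r.1.2, r.2)) hm
  simp only [Kernel.prodMkLeft_apply]
  rw [lintegral_prod _ hm2.aemeasurable]
  rfl

theorem visible_snoc {D : Type u} {Φ : Type v} {O : Type w} {Z : Type z} {t : ℕ} (h : Fin t → Round D Φ O Z) (r : Round D Φ O Z) :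
    visible (Fin.snoc (α := fun _ => Round D Φ O Z) h r) =
      Fin.snoc (α := fun _ => Obs D Φ O) (visible h) (r.1.2, r.2) := by
  ext1 i
  refine Fin.lastCases ?_ (fun j => ?_) i
  · simp [visible]
  · simp [visible]

end Protocol

/-- Cumulative sums of a predictable sequence along a history. -/
def cumSum (ℓ : (t : ℕ) → (Fin t → Obs D Φ O) → ℝ) : (t : ℕ) → (Fin t → Obs D Φ O) → ℝ
  | 0, _ => 0
  | t + 1, h => cumSum ℓ t (Fin.init h) + ℓ t (Fin.init h)

theorem cumSum_eq_sum {D : Type u} {Φ : Type v} {O : Type w}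
    (ℓ : (t : ℕ) → (Fin t → Obs D Φ O) → ℝ) (t : ℕ) (h : Fin t → Obs D Φ O) :
    cumSum ℓ t h = ∑ s : Fin t, ℓ s (fun i => h (Fin.castLE s.isLt.le i)) := by
  induction t with
  | zero => simp [cumSum]
  | succ t ih =>
    rw [Fin.sum_univ_castSucc, cumSum, ih]
    rfl

theorem measurable_cumSum {ℓ : (t : ℕ) → (Fin t → Obs D Φ O) → ℝ} (hℓ : ∀ t, Measurable (ℓ t))
    (t : ℕ) : Measurable (cumSum ℓ t) := by
  induction t with
  | zero => exact measurable_const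
  | succ t ih => exact (ih.comp (measurable_init t)).add ((hℓ t).comp (measurable_init t))

section Regret

/-- The exponential potential: inverse normalized weight of `P` times the exponential of the
cumulative excess loss. -/
def potential (ξ : (t : ℕ) → (Fin t → Obs D Φ O) → 𝓒 → Obs D Φ O → ℝ)
    (ℓ : (t : ℕ) → (Fin t → Obs D Φ O) → ℝ) (P : 𝓒) (B γ : ℝ) (t : ℕ) (h : Fin t → Obs D Φ O) : ℝ :=
  (𝓒.card * expWeights ξ t h P)⁻¹ * Real.exp ((cumSum ℓ t h - t * B) / γ)

variable {ξ : (t : ℕ) → (Fin t → Obs D Φ O) → 𝓒 → Obs D Φ O → ℝ}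
  {ℓ : (t : ℕ) → (Fin t → Obs D Φ O) → ℝ} {B γ : ℝ}

theorem potential_nonneg (P : 𝓒) (t : ℕ) (h : Fin t → Obs D Φ O) :
    0 ≤ potential ξ ℓ P B γ t h := by
  have := expWeights_pos (ξ := ξ) t h P
  unfold potential
  positivity

/-- Only the last factor depends on the new observation; the others are known before the round. -/
theorem potential_snoc (P : 𝓒) (t : ℕ) (h : Fin t → Obs D Φ O) (y : Obs D Φ O) :
    potential ξ ℓ P B γ (t + 1) (Fin.snoc (α := fun _ => Obs D Φ O) h y) =
      potential ξ ℓ P B γ t h * Real.exp ((ℓ t h - B) / γ) *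
        (1 - gap (expWeights ξ t h) (ξ t h) P y) := by
  rw [one_sub_gap (sum_expWeights ⟨P.1, P.2⟩ t h)]
  unfold potential
  simp only [expWeights, cumSum, Fin.init_snoc, Fin.snoc_last]
  have e : (cumSum ℓ t h + ℓ t h - ((t + 1 : ℕ) : ℝ) * B) / γ =
      (cumSum ℓ t h - t * B) / γ + (ℓ t h - B) / γ := by
    push_cast
    ring
  rw [e, Real.exp_add]
  have h1 := expWeights_pos (ξ := ξ) t h P
  have h2 := Real.exp_pos (ξ t h P y)
  have h3 : 0 < ∑ ψ', expWeights ξ t h ψ' * Real.exp (ξ t h ψ' y) :=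
    Finset.sum_pos (fun i _ => mul_pos (expWeights_pos _ _ _) (Real.exp_pos _))
      ⟨P, Finset.mem_univ _⟩
  field_simp

theorem measurable_potential
    (hξ : ∀ t ψ, Measurable fun y : (Fin t → Obs D Φ O) × Obs D Φ O => ξ t y.1 ψ y.2)
    (hℓ : ∀ t, Measurable (ℓ t)) (P : 𝓒) (t : ℕ) : Measurable (potential ξ ℓ P B γ t) := by
  unfold potential
  have h1 := measurable_expWeights hξ t P
  have h2 := measurable_cumSum hℓ t
  fun_prop

/-- The potential is a supermartingale in every environment constrained to `P`. -/
theorem lintegral_potential_le_one {Z : Type z} [MeasurableSpace Z] {T : ℕ}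
    (alg : Algorithm D Φ O T) (env : Environment D Φ O Z)
    (hξ : ∀ t ψ, Measurable fun y : (Fin t → Obs D Φ O) × Obs D Φ O => ξ t y.1 ψ y.2)
    (hξw : ∀ t h, ξ t h ∈ weightFunctions 𝓒) (hℓ : ∀ t, Measurable (ℓ t)) (P : 𝓒)
    (hγ : 0 < γ) (hcon : env.ConstrainedTo T P.1)
    (hobj : ∀ t < T, ∀ h, ∀ M ∈ P.1,
      ℓ t h - γ * info (expWeights ξ t h) (alg.explore t h) (ξ t h) M P ≤ B)
    (t : ℕ) (ht : t ≤ T) :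
    ∫⁻ h, ENNReal.ofReal (potential ξ ℓ P B γ t (visible h)) ∂(historyLaw alg env t) ≤ 1 := by
  induction t with
  | zero =>
    have hc : 0 < 𝓒.card := Finset.card_pos.2 ⟨P.1, P.2⟩
    have hc' : (𝓒.card : ℝ) ≠ 0 := by positivity
    have : ∀ h : Fin 0 → Round D Φ O Z, potential ξ ℓ P B γ 0 (visible h) = 1 := by
      intro h
      simp [potential, expWeights, cumSum, hc']
    simp [this]
  | succ t ih =>
    refine le_trans ?_ (ih (by omega))
    have := env.choose_markov t
    have hexpl := alg.explore_markov t
    rw [show historyLaw alg env (t + 1) = (historyLaw alg env t ⊗ₘ roundKernel alg env t).map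
      fun x => Fin.snoc (α := fun _ => Round D Φ O Z) x.1 x.2 from rfl]
    refine (lintegral_map_le _ _).trans ?_
    simp only [visible_snoc]
    have hm : Measurable fun x : (Fin t → Round D Φ O Z) × Round D Φ O Z =>
        ENNReal.ofReal (potential ξ ℓ P B γ (t + 1)
          (Fin.snoc (α := fun _ => Obs D Φ O) (visible x.1) (x.2.1.2, x.2.2))) := by
      simp only [← visible_snoc]
      exact ((measurable_potential hξ hℓ P (t + 1)).comp ((measurable_visible (t + 1)).comp
        (measurable_snoc_round t))).ennreal_ofReal
    rw [Measure.lintegral_compProd hm]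
    refine lintegral_mono fun h => ?_
    simp only [potential_snoc]
    set c := potential ξ ℓ P B γ t (visible h) * Real.exp ((ℓ t (visible h) - B) / γ) with hcdef
    have hc0 : 0 ≤ c := mul_nonneg (potential_nonneg P t _) (Real.exp_pos _).le
    set wt := expWeights ξ t (visible h) with hwt
    have hw : ∀ i, 0 ≤ wt i := fun i => (expWeights_pos _ _ _).le
    have hw1 : ∑ i, wt i = 1 := sum_expWeights ⟨P.1, P.2⟩ _ _
    have hgm : Measurable (gap wt (ξ t (visible h)) P) := measurable_gap (hξw _ _).1 P
    simp only [ENNReal.ofReal_mul hc0]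
    rw [lintegral_const_mul _ (by fun_prop), lintegral_roundKernel alg env t h
      (f := fun y => ENNReal.ofReal (1 - gap wt (ξ t (visible h)) P y)) (by fun_prop)]
    simp only [lintegral_one_sub_gap hw hw1 (hξw t (visible h))]
    -- The objective bound gives u = (ℓ - B)/γ ≤ `info` for every model in P, hence 1 - `info` ≤ 1 -
    -- u ≤ exp(-u), which cancels the factor exp(u) of the potential.
    have hle : ∀ᵐ l ∂(env.choose t h), ENNReal.ofReal
        (1 - info wt (alg.explore t (visible h)) (ξ t (visible h)) (env.modelAt l) P) ≤
        ENNReal.ofReal (Real.exp (-((ℓ t (visible h) - B) / γ))) := by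
      filter_upwards [hcon t (by omega) h] with l hl
      refine ENNReal.ofReal_le_ofReal ?_
      have h1 := hobj t (by omega) (visible h) _ hl
      have h2 : (ℓ t (visible h) - B) / γ ≤
          info wt (alg.explore t (visible h)) (ξ t (visible h)) (env.modelAt l) P := by
        rw [div_le_iff₀ hγ]
        linarith
      have h3 := Real.add_one_le_exp (-((ℓ t (visible h) - B) / γ))
      linarith
    calc ENNReal.ofReal c * ∫⁻ l, ENNReal.ofReal
          (1 - info wt (alg.explore t (visible h)) (ξ t (visible h)) (env.modelAt l) P)
            ∂(env.choose t h)
        ≤ ENNReal.ofReal c * ∫⁻ _, ENNReal.ofReal (Real.exp (-((ℓ t (visible h) - B) / γ)))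
            ∂(env.choose t h) := by
          exact mul_le_mul_right (lintegral_mono_ae hle) _
      _ = ENNReal.ofReal (potential ξ ℓ P B γ t (visible h)) := by
          rw [lintegral_const, measure_univ, mul_one, ← ENNReal.ofReal_mul hc0, hcdef, mul_assoc,
            ← Real.exp_add, add_neg_cancel, Real.exp_zero, mul_one]

/-- The risk guarantee of exponential weights when the worst-case objective stays below `B`. -/
theorem risk_bound_of_objective_le {Z : Type z} [MeasurableSpace Z] {T : ℕ} (hT : 1 ≤ T)
    (alg : Algorithm D Φ O T) (env : Environment D Φ O Z) {L : 𝓒 → D → ℝ≥0}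
    (hL : ∀ ψ, Measurable (L ψ)) {p : (t : ℕ) → Kernel (Fin t → Obs D Φ O) D}
    (hξ : ∀ t ψ, Measurable fun y : (Fin t → Obs D Φ O) × Obs D Φ O => ξ t y.1 ψ y.2)
    (hξw : ∀ t h, ξ t h ∈ weightFunctions 𝓒) (hγ : 0 < γ)
    (hobj : ∀ t < T, ∀ h,
      objective L γ (expWeights ξ t h) (p t h) (alg.explore t h) (ξ t h) ≤ (B : EReal))
    (hout : ∀ h, alg.output h =
      (T : ℝ≥0∞)⁻¹ • ∑ t : Fin T, p t (fun i => h (Fin.castLE t.isLt.le i)))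
    (P : 𝓒) (hcon : env.ConstrainedTo T P.1) {δ : ℝ} (hδ : 0 < δ) :
    ENNReal.ofReal (1 - δ) ≤ historyLaw alg env T {h | risk alg L P (visible h) ≤
      ENNReal.ofReal (B + γ * Real.log (𝓒.card / δ) / T)} := by
  set ℓ : (t : ℕ) → (Fin t → Obs D Φ O) → ℝ := fun t h =>
    (∫⁻ d, (L P d : ℝ≥0∞) ∂(p t h)).toReal with hℓdef
  have hℓ : ∀ t, Measurable (ℓ t) := fun t =>
    ((hL P).coe_nnreal_ennreal.lintegral_kernel (κ := p t)).ennreal_toReal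
  have hobjAt : ∀ t < T, ∀ h, ∀ M ∈ P.1,
      objectiveAt L γ (expWeights ξ t h) (p t h) (alg.explore t h) (ξ t h) M P ≤ (B : EReal) :=
    fun t ht h M hM => le_trans (le_iSup_of_le P (le_iSup₂_of_le
      (f := fun M (_ : M ∈ P.1) => objectiveAt L γ (expWeights ξ t h) (p t h) (alg.explore t h)
        (ξ t h) M P) M hM le_rfl)) (hobj t ht h)
  have hU := lintegral_potential_le_one alg env hξ hξw hℓ P hγ hcon
    (fun t ht h M hM => (le_of_objectiveAt_le (hobjAt t ht h M hM)).2) T le_rfl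
  -- A model in P is needed for the objective to control the loss of P at all; T ≥ 1 provides one.
  have hmodel : ∃ M, M ∈ P.1 := by
    have := env.choose_markov 0
    obtain ⟨l, hl⟩ := (hcon 0 (by omega) Fin.elim0).exists
    exact ⟨_, hl⟩
  obtain ⟨M, hM⟩ := hmodel
  have hfin : ∀ t < T, ∀ h, ∫⁻ d, (L P d : ℝ≥0∞) ∂(p t h) ≠ ⊤ := fun t ht h =>
    (le_of_objectiveAt_le (hobjAt t ht h M hM)).1
  have hTpos : (0 : ℝ) < T := by exact_mod_cast hT
  have hrisk : ∀ h, risk alg L P h = ENNReal.ofReal (cumSum ℓ T h / T) := by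
    intro h
    unfold risk
    rw [hout, lintegral_smul_measure, lintegral_finsetSum_measure, cumSum_eq_sum,
      div_eq_inv_mul, ENNReal.ofReal_mul (by positivity), ENNReal.ofReal_inv_of_pos hTpos,
      ENNReal.ofReal_natCast, ENNReal.ofReal_sum_of_nonneg fun _ _ => ENNReal.toReal_nonneg,
      smul_eq_mul]
    congr 1
    exact Finset.sum_congr rfl fun t _ => (ENNReal.ofReal_toReal (hfin t t.2 _)).symm
  set A := {h : Fin T → Round D Φ O Z | risk alg L P (visible h) ≤
      ENNReal.ofReal (B + γ * Real.log (𝓒.card / δ) / T)} with hA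
  have hcard : (0 : ℝ) < 𝓒.card := by
    have : 0 < 𝓒.card := Finset.card_pos.2 ⟨P.1, P.2⟩
    exact_mod_cast this
  -- If the risk exceeds the bound, the exponential factor is at least |𝓒|/δ, and w(P) ≤ 1 then
  -- makes the potential at least 1/δ.
  have hsub : Aᶜ ⊆ {h | ENNReal.ofReal δ⁻¹ ≤
      ENNReal.ofReal (potential ξ ℓ P B γ T (visible h))} := by
    intro h hh
    simp only [hA, Set.mem_compl_iff, Set.mem_ofPred_eq, not_le, hrisk] at hh ⊢
    refine ENNReal.ofReal_le_ofReal ?_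
    have h1 := (ENNReal.ofReal_lt_ofReal_iff'.1 hh).1
    have h2 : Real.log (𝓒.card / δ) ≤ (cumSum ℓ T (visible h) - T * B) / γ := by
      rw [le_div_iff₀ hγ]
      rw [lt_div_iff₀ hTpos, add_mul, div_mul_cancel₀ _ hTpos.ne'] at h1
      linarith
    have h3 : 𝓒.card / δ ≤ Real.exp ((cumSum ℓ T (visible h) - T * B) / γ) := by
      rw [← Real.log_le_iff_le_exp (by positivity)]
      exact h2
    have h4 : expWeights ξ T (visible h) P ≤ 1 := by
      rw [← sum_expWeights (ξ := ξ) ⟨P.1, P.2⟩ T (visible h)]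
      exact Finset.single_le_sum (fun i _ => (expWeights_pos T (visible h) i).le)
        (Finset.mem_univ P)
    have h5 := expWeights_pos (ξ := ξ) T (visible h) P
    unfold potential
    calc δ⁻¹ = (𝓒.card * 1 : ℝ)⁻¹ * (𝓒.card / δ) := by field_simp
      _ ≤ _ := by gcongr
  have hbad : historyLaw alg env T Aᶜ ≤ ENNReal.ofReal δ := by
    calc historyLaw alg env T Aᶜ ≤ _ := measure_mono hsub
      _ ≤ (∫⁻ h, ENNReal.ofReal (potential ξ ℓ P B γ T (visible h)) ∂(historyLaw alg env T)) /
          ENNReal.ofReal δ⁻¹ := meas_ge_le_lintegral_div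
            (((measurable_potential hξ hℓ P T).comp
              (measurable_visible T)).ennreal_ofReal).aemeasurable
            (by simpa using hδ) ENNReal.ofReal_ne_top
      _ ≤ 1 / ENNReal.ofReal δ⁻¹ := by gcongr
      _ = ENNReal.ofReal δ := by
        rw [ENNReal.ofReal_inv_of_pos hδ, one_div, inv_inv]
  -- Subadditivity suffices, so measurability of A is not needed.
  have htot : 1 ≤ historyLaw alg env T A + historyLaw alg env T Aᶜ := by
    rw [← measure_univ (μ := historyLaw alg env T), ← Set.union_compl_self A]
    exact measure_union_le _ _
  rw [ENNReal.ofReal_sub _ hδ.le, ENNReal.ofReal_one]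
  exact tsub_le_iff_right.2 (htot.trans (by gcongr))

end Regret

end Analysis

/-! ### Measurable near-optimal executions -/

section Existence

variable {D : Type u} {Φ : Type v} {O : Type w}
  [MeasurableSpace D] [MeasurableSpace Φ] [MeasurableSpace O]
  {𝓒 : Finset (Set (Model D Φ O))}

section Semicontinuity

variable {L : 𝓒 → D → ℝ≥0} {γ : ℝ}

theorem info_sub_le {ξ : 𝓒 → Obs D Φ O → ℝ} (hξ : ∀ ψ, Measurable (ξ ψ)) {A : ℝ}
    (hA : ∀ ψ y, |ξ ψ y| ≤ A) (wt wt' : 𝓒 → ℝ) (q : Measure (D × Φ)) [IsProbabilityMeasure q]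
    (M : Model D Φ O) (ψ : 𝓒) :
    info wt q ξ M ψ - info wt' q ξ M ψ ≤ (∑ i, |wt i - wt' i|) * Real.exp (2 * A) := by
  have hw : ξ ∈ weightFunctions 𝓒 := ⟨hξ, A, hA⟩
  have h1 : ∀ y, gap wt ξ ψ y - gap wt' ξ ψ y = gap (fun i => wt i - wt' i) ξ ψ y := by
    intro y
    unfold gap
    rw [← Finset.sum_sub_distrib]
    exact Finset.sum_congr rfl fun i _ => by ring
  have h2 : info wt q ξ M ψ - info wt' q ξ M ψ = info (fun i => wt i - wt' i) q ξ M ψ := by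
    unfold info
    rw [← integral_sub (integrable_infoAt hw M ψ q) (integrable_infoAt hw M ψ q)]
    refine integral_congr_ae (.of_forall fun x => ?_)
    simp only [infoAt]
    rw [← integral_sub (integrable_gap hw M ψ x) (integrable_gap hw M ψ x)]
    simp only [h1]
  rw [h2]
  exact (le_abs_self _).trans (abs_info_le (abs_gap_le_of_sum_abs hA) q M ψ)

theorem objective_le_add (hγ : 0 ≤ γ) {ξ : 𝓒 → Obs D Φ O → ℝ} (hξ : ∀ ψ, Measurable (ξ ψ)) {A : ℝ}
    (hA : ∀ ψ y, |ξ ψ y| ≤ A) (wt wt' : 𝓒 → ℝ) (p : Measure D) (q : Measure (D × Φ))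
    [IsProbabilityMeasure q] :
    objective L γ wt' p q ξ ≤ objective L γ wt p q ξ +
      ((γ * ((∑ i, |wt i - wt' i|) * Real.exp (2 * A)) : ℝ) : EReal) := by
  refine iSup_le fun ψ => iSup₂_le fun M hM => ?_
  have h1 : objectiveAt L γ wt p q ξ M ψ ≤ objective L γ wt p q ξ :=
    le_iSup_of_le ψ (le_iSup₂_of_le
      (f := fun M (_ : M ∈ ψ.1) => objectiveAt L γ wt p q ξ M ψ) M hM le_rfl)
  refine le_trans ?_ (add_le_add_left h1 _)
  by_cases hp : ∫⁻ d, (L ψ d : ℝ≥0∞) ∂p = ⊤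
  · rw [objectiveAt_eq L γ wt, hp, EReal.coe_ennreal_top, EReal.top_sub_coe, EReal.top_add_coe]
    exact le_top
  · rw [objectiveAt_eq_coe hp, objectiveAt_eq_coe hp, ← EReal.coe_add, EReal.coe_le_coe_iff]
    have := mul_le_mul_of_nonneg_left (info_sub_le hξ hA wt wt' q M ψ) hγ
    linarith

/-- For a fixed triple the objective moves by at most a constant times the ℓ¹ change of the weights,
uniformly over ψ and M. The resulting semicontinuity gives both measurability and the countable
reduction. -/
theorem isOpen_objective_lt (hγ : 0 ≤ γ) {ξ : 𝓒 → Obs D Φ O → ℝ} (hξ : ξ ∈ weightFunctions 𝓒)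
    (p : Measure D) (q : Measure (D × Φ)) [IsProbabilityMeasure q] (r : EReal) :
    IsOpen {wt : 𝓒 → ℝ | objective L γ wt p q ξ < r} := by
  obtain ⟨hξm, A, hA⟩ := hξ
  rw [isOpen_iff_mem_nhds]
  intro wt hwt
  obtain ⟨b, hb, hbr⟩ := EReal.lt_iff_exists_real_btwn.1 hwt
  obtain ⟨c, hbc, hcr⟩ := EReal.lt_iff_exists_real_btwn.1 hbr
  rw [EReal.coe_lt_coe_iff] at hbc
  have hopen : IsOpen {wt' : 𝓒 → ℝ |
      γ * ((∑ i, |wt i - wt' i|) * Real.exp (2 * A)) < c - b} :=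
    isOpen_lt (by fun_prop) continuous_const
  filter_upwards [hopen.mem_nhds (show wt ∈ _ by simpa using hbc)] with wt' hwt'
  calc objective L γ wt' p q ξ ≤ objective L γ wt p q ξ +
      ((γ * ((∑ i, |wt i - wt' i|) * Real.exp (2 * A)) : ℝ) : EReal) :=
        objective_le_add hγ hξm hA wt wt' p q
    _ ≤ (b : EReal) + ((c - b : ℝ) : EReal) :=
        add_le_add hb.le (EReal.coe_le_coe_iff.2 (le_of_lt hwt'))
    _ = c := by rw [← EReal.coe_add, add_sub_cancel]
    _ < r := hcr

theorem exo_lt_iff {wt : 𝓒 → ℝ} {r : EReal} :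
    exo L γ wt < r ↔ ∃ i : ProbabilityMeasure D × ProbabilityMeasure (D × Φ) × weightFunctions 𝓒,
      objective L γ wt (i.1 : Measure D) (i.2.1 : Measure (D × Φ)) i.2.2.1 < r := by
  unfold exo
  simp only [iInf_lt_iff, Prod.exists, Subtype.exists]

/-- The value of exploration-by-optimization is the infimum over a countable family of triples. -/
theorem exists_seq_objective [Nonempty D] [Nonempty Φ] (hγ : 0 ≤ γ) :
    ∃ e : ℕ → ProbabilityMeasure D × ProbabilityMeasure (D × Φ) × weightFunctions 𝓒,
      ∀ (wt : 𝓒 → ℝ) (r : ℚ), exo L γ wt < ((r : ℝ) : EReal) →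
        ∃ n, objective L γ wt ((e n).1 : Measure D) ((e n).2.1 : Measure (D × Φ)) (e n).2.2.1 <
          ((r : ℝ) : EReal) := by
  set I := ProbabilityMeasure D × ProbabilityMeasure (D × Φ) × weightFunctions 𝓒
  obtain ⟨d⟩ := ‹Nonempty D›
  obtain ⟨f⟩ := ‹Nonempty Φ›
  let i₀ : I := (⟨Measure.dirac d, inferInstance⟩, ⟨Measure.dirac (d, f), inferInstance⟩,
    ⟨fun _ _ => 0, fun _ => measurable_const, 0, by simp⟩)
  -- Lindelöf property of the finite-dimensional space of weights, at each rational level. The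
  -- triple i₀ only ensures that the countable family is non-empty.
  choose S hS hSU using fun r : ℚ => TopologicalSpace.isOpen_iUnion_countable
    (fun i : I => {wt : 𝓒 → ℝ | objective L γ wt (i.1 : Measure D) (i.2.1 : Measure (D × Φ))
      i.2.2.1 < ((r : ℝ) : EReal)}) (fun i => isOpen_objective_lt hγ i.2.2.2 _ _ _)
  have hcount : (insert i₀ (⋃ r, S r)).Countable := (Set.countable_iUnion hS).insert i₀
  obtain ⟨e, he⟩ := hcount.exists_eq_range ⟨i₀, Set.mem_insert _ _⟩
  refine ⟨e, fun wt r hr => ?_⟩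
  have h1 : wt ∈ ⋃ i : I, {wt : 𝓒 → ℝ | objective L γ wt (i.1 : Measure D)
      (i.2.1 : Measure (D × Φ)) i.2.2.1 < ((r : ℝ) : EReal)} := by
    exact Set.mem_iUnion.2 (exo_lt_iff.1 hr)
  rw [← hSU r] at h1
  simp only [Set.mem_iUnion] at h1
  obtain ⟨i, hi, hlt⟩ := h1
  have : i ∈ Set.range e := he ▸ Set.mem_insert_of_mem _ (Set.mem_iUnion.2 ⟨r, hi⟩)
  obtain ⟨n, rfl⟩ := this
  exact ⟨n, hlt⟩

theorem measurable_objective (hγ : 0 ≤ γ) {ξ : 𝓒 → Obs D Φ O → ℝ} (hξ : ξ ∈ weightFunctions 𝓒)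
    (p : Measure D) (q : Measure (D × Φ)) [IsProbabilityMeasure q] :
    Measurable fun wt : 𝓒 → ℝ => objective L γ wt p q ξ :=
  measurable_of_Iio fun r => (isOpen_objective_lt hγ hξ p q r).measurableSet

theorem measurable_exo (hγ : 0 ≤ γ) : Measurable fun wt : 𝓒 → ℝ => exo L γ wt := by
  refine measurable_of_Iio fun r => IsOpen.measurableSet ?_
  have : (fun wt : 𝓒 → ℝ => exo L γ wt) ⁻¹' Set.Iio r =
      ⋃ i : ProbabilityMeasure D × ProbabilityMeasure (D × Φ) × weightFunctions 𝓒,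
        {wt | objective L γ wt (i.1 : Measure D) (i.2.1 : Measure (D × Φ)) i.2.2.1 < r} := by
    ext wt
    simp only [Set.mem_preimage, Set.mem_Iio, Set.mem_iUnion, Set.mem_ofPred_eq]
    exact exo_lt_iff
  rw [this]
  exact isOpen_iUnion fun i => isOpen_objective_lt hγ i.2.2.2 _ _ _

theorem neg_le_objective (hγ : 0 ≤ γ) {wt : 𝓒 → ℝ} (hw : ∀ i, 0 ≤ wt i) (hw1 : ∑ i, wt i = 1)
    {ξ : 𝓒 → Obs D Φ O → ℝ} (hξ : ξ ∈ weightFunctions 𝓒) (p : Measure D) (q : Measure (D × Φ))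
    [IsProbabilityMeasure q] {ψ : 𝓒} {M : Model D Φ O} (hM : M ∈ ψ.1) :
    ((-γ : ℝ) : EReal) ≤ objective L γ wt p q ξ := by
  have h1 : objectiveAt L γ wt p q ξ M ψ ≤ objective L γ wt p q ξ :=
    le_iSup_of_le ψ (le_iSup₂_of_le
      (f := fun M (_ : M ∈ ψ.1) => objectiveAt L γ wt p q ξ M ψ) M hM le_rfl)
  refine le_trans ?_ h1
  by_cases hp : ∫⁻ d, (L ψ d : ℝ≥0∞) ∂p = ⊤
  · rw [objectiveAt_eq L γ wt, hp, EReal.coe_ennreal_top, EReal.top_sub_coe]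
    exact le_top
  · rw [objectiveAt_eq_coe hp, EReal.coe_le_coe_iff]
    have h2 := info_le_one hw hw1 hξ q M ψ
    have h3 : 0 ≤ (∫⁻ d, (L ψ d : ℝ≥0∞) ∂p).toReal := ENNReal.toReal_nonneg
    nlinarith

/-- A finite value leaves room for a rational level below value + η. The value ⊥ is excluded as soon
as some information set contains a model; otherwise the objective is an empty supremum. -/
theorem exists_near_optimal (hγ : 0 ≤ γ)
    {e : ℕ → ProbabilityMeasure D × ProbabilityMeasure (D × Φ) × weightFunctions 𝓒}
    (he : ∀ (wt : 𝓒 → ℝ) (r : ℚ), exo L γ wt < ((r : ℝ) : EReal) →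
        ∃ n, objective L γ wt ((e n).1 : Measure D) ((e n).2.1 : Measure (D × Φ)) (e n).2.2.1 <
          ((r : ℝ) : EReal)) {η : ℝ} (hη : 0 < η) {wt : 𝓒 → ℝ} (hw : ∀ i, 0 ≤ wt i)
    (hw1 : ∑ i, wt i = 1) :
    ∃ n, objective L γ wt ((e n).1 : Measure D) ((e n).2.1 : Measure (D × Φ)) (e n).2.2.1 ≤
      exo L γ wt + (η : EReal) := by
  by_cases hM : ∃ ψ : 𝓒, ∃ M, M ∈ ψ.1
  · obtain ⟨ψ, M, hM⟩ := hM
    have hlow : ((-γ : ℝ) : EReal) ≤ exo L γ wt :=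
      le_iInf fun p => le_iInf fun q => le_iInf₂ fun ξ hξ =>
        neg_le_objective hγ hw hw1 hξ _ _ hM
    induction hx : exo L γ wt with
    | bot =>
      rw [hx] at hlow
      exact absurd hlow (not_le.2 (EReal.bot_lt_coe _))
    | top => exact ⟨0, by rw [EReal.top_add_coe]; exact le_top⟩
    | coe b =>
      obtain ⟨r, hr1, hr2⟩ := exists_rat_btwn (show b < b + η by linarith)
      obtain ⟨n, hn⟩ := he wt r (by rw [hx]; exact_mod_cast hr1)
      refine ⟨n, hn.le.trans ?_⟩
      rw [← EReal.coe_add]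
      exact_mod_cast hr2.le
  · push Not at hM
    refine ⟨0, le_trans (iSup_le fun ψ => iSup₂_le fun M hM' => absurd hM' (hM ψ M)) bot_le⟩

end Semicontinuity

section Execution

/-- The weights generated by a selection rule `z` that maps weights to weight functions. -/
def selectedWeights (z : (𝓒 → ℝ) → 𝓒 → Obs D Φ O → ℝ) :
    (t : ℕ) → (Fin t → Obs D Φ O) → 𝓒 → ℝ
  | 0, _ => fun _ => (𝓒.card : ℝ)⁻¹
  | t + 1, h => fun ψ =>
      selectedWeights z t (Fin.init h) ψ *
          Real.exp (z (selectedWeights z t (Fin.init h)) ψ (h (Fin.last t))) /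
        ∑ ψ', selectedWeights z t (Fin.init h) ψ' *
          Real.exp (z (selectedWeights z t (Fin.init h)) ψ' (h (Fin.last t)))

/-- The weight functions are selected from the weights that they themselves drive; a joint recursion
resolves the circularity. -/
theorem expWeights_selected (z : (𝓒 → ℝ) → 𝓒 → Obs D Φ O → ℝ) (t : ℕ) (h : Fin t → Obs D Φ O) :
    expWeights (fun t h => z (selectedWeights z t h)) t h = selectedWeights z t h := by
  induction t with
  | zero => rfl
  | succ t ih =>
    ext ψ
    simp only [expWeights, selectedWeights, ih]

theorem measurable_selectedWeights {z : (𝓒 → ℝ) → 𝓒 → Obs D Φ O → ℝ}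
    (hz : ∀ ψ, Measurable fun y : (𝓒 → ℝ) × Obs D Φ O => z y.1 ψ y.2) (t : ℕ) :
    Measurable fun h : Fin t → Obs D Φ O => selectedWeights z t h := by
  induction t with
  | zero => exact measurable_const
  | succ t ih =>
    refine measurable_pi_iff.2 fun ψ => ?_
    simp only [selectedWeights]
    have h0 : Measurable fun h : Fin (t + 1) → Obs D Φ O => selectedWeights z t (Fin.init h) :=
      ih.comp (measurable_init t)
    have h1 : ∀ ψ, Measurable fun h : Fin (t + 1) → Obs D Φ O =>
        selectedWeights z t (Fin.init h) ψ *
          Real.exp (z (selectedWeights z t (Fin.init h)) ψ (h (Fin.last t))) := fun ψ =>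
      ((measurable_pi_apply ψ).comp h0).mul (((hz ψ).comp
        (h0.prodMk (measurable_pi_apply (Fin.last t)))).exp)
    exact (h1 ψ).div (Finset.measurable_sum _ fun i _ => h1 i)

/-- Measurable choice of an index. -/
theorem exists_measurable_index {α : Type*} [MeasurableSpace α] {good : α → ℕ → Prop}
    (hm : ∀ n, MeasurableSet {x | good x n}) :
    ∃ idx : α → ℕ, Measurable idx ∧ ∀ x, (∃ n, good x n) → good x (idx x) := by
  classical
  have hex : ∀ x, ∃ n, (∃ m, good x m) → good x n := fun x => by
    by_cases h : ∃ m, good x m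
    · exact ⟨h.choose, fun _ => h.choose_spec⟩
    · exact ⟨0, fun h' => absurd h' h⟩
  refine ⟨fun x => Nat.find (hex x), measurable_find hex fun n => ?_, fun x =>
    Nat.find_spec (hex x)⟩
  have : {x | (∃ m, good x m) → good x n} = (⋃ m, {x | good x m})ᶜ ∪ {x | good x n} := by
    ext x
    simp only [Set.mem_ofPred_eq, Set.mem_union, Set.mem_compl_iff, Set.mem_iUnion]
    tauto
  rw [this]
  exact (MeasurableSet.iUnion hm).compl.union (hm n)

/-- Existence of executions of any positive accuracy. The exploitation laws may moreover be passed
through a map `f` that does not increase the objective. -/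
theorem exists_isExOPlus [Nonempty D] [Nonempty Φ] (hne : 𝓒.Nonempty) {T : ℕ} (hT : 1 ≤ T)
    (L : 𝓒 → D → ℝ≥0) {γ : ℝ} (hγ : 0 ≤ γ) {η : ℝ≥0} (hη : 0 < η)
    (f : ProbabilityMeasure D → ProbabilityMeasure D)
    (hf : ∀ (wt : 𝓒 → ℝ) (p : ProbabilityMeasure D) (q : ProbabilityMeasure (D × Φ))
      (ξ : 𝓒 → Obs D Φ O → ℝ),
        objective L γ wt (f p : Measure D) (q : Measure (D × Φ)) ξ ≤
          objective L γ wt (p : Measure D) (q : Measure (D × Φ)) ξ) :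
    ∃ alg : Algorithm D Φ O T, IsExOPlus alg L γ η ∧
      ∀ h, ∃ p : Fin T → ProbabilityMeasure D,
        alg.output h = (T : ℝ≥0∞)⁻¹ • ∑ t : Fin T, (f (p t) : Measure D) := by
  classical
  obtain ⟨e, he⟩ := exists_seq_objective (L := L) hγ
  set good : (𝓒 → ℝ) → ℕ → Prop := fun wt n =>
    objective L γ wt ((e n).1 : Measure D) ((e n).2.1 : Measure (D × Φ)) (e n).2.2.1 ≤
      exo L γ wt + ((η : ℝ) : EReal) with hgood
  have hgoodm : ∀ n, MeasurableSet {wt | good wt n} := fun n =>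
    measurableSet_le (measurable_objective hγ (e n).2.2.2 _ _)
      ((show Monotone fun x : EReal => x + ((η : ℝ) : EReal) from
        fun _ _ h => add_le_add_left h _).measurable.comp (measurable_exo hγ))
  obtain ⟨idx, hidxm, hidx⟩ := exists_measurable_index hgoodm
  set z : (𝓒 → ℝ) → 𝓒 → Obs D Φ O → ℝ := fun wt => (e (idx wt)).2.2.1 with hz
  have hzm : ∀ ψ, Measurable fun y : (𝓒 → ℝ) × Obs D Φ O => z y.1 ψ y.2 := fun ψ => by
    have h1 : Measurable fun y : ℕ × Obs D Φ O => (e y.1).2.2.1 ψ y.2 :=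
      measurable_from_prod_countable_right fun n => (e n).2.2.2.1 ψ
    exact h1.comp ((hidxm.comp measurable_fst).prodMk measurable_snd)
  have hW := measurable_selectedWeights (z := z) hzm
  set I : (t : ℕ) → (Fin t → Obs D Φ O) → ℕ := fun t h => idx (selectedWeights z t h) with hI
  have hIm : ∀ t, Measurable (I t) := fun t => hidxm.comp (hW t)
  -- The kernel factors through a countable index, so no measurability of f is required.
  set p : (t : ℕ) → Kernel (Fin t → Obs D Φ O) D := fun t =>
    (Kernel.ofFunOfCountable fun n => (f (e n).1 : Measure D)).comap (I t) (hIm t) with hp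
  set q : (t : ℕ) → Kernel (Fin t → Obs D Φ O) (D × Φ) := fun t =>
    (Kernel.ofFunOfCountable fun n => ((e n).2.1 : Measure (D × Φ))).comap (I t) (hIm t) with hq
  have hpapp : ∀ t h, p t h = (f (e (I t h)).1 : Measure D) := fun t h => rfl
  have hqapp : ∀ t h, q t h = ((e (I t h)).2.1 : Measure (D × Φ)) := fun t h => rfl
  have hpM : ∀ t, IsMarkovKernel (p t) := fun t => ⟨fun h => by rw [hpapp]; infer_instance⟩
  have hqM : ∀ t, IsMarkovKernel (q t) := fun t => ⟨fun h => by rw [hqapp]; infer_instance⟩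
  let out : Kernel (Fin T → Obs D Φ O) D :=
    { toFun := fun h => (T : ℝ≥0∞)⁻¹ • ∑ t : Fin T, p t (fun i => h (Fin.castLE t.isLt.le i))
      measurable' := by
        refine Measure.measurable_of_measurable_coe _ fun s hs => ?_
        simp only [Measure.smul_apply, Measure.finsetSum_apply, smul_eq_mul]
        refine Measurable.const_mul (Finset.measurable_sum _ fun t _ => ?_) _
        exact (Kernel.measurable_coe (p t) hs).comp
          (measurable_pi_iff.2 fun i => measurable_pi_apply _) }
  have hout : IsMarkovKernel out := ⟨fun h => ⟨by
    change ((T : ℝ≥0∞)⁻¹ • ∑ t : Fin T, p t (fun i => h (Fin.castLE t.isLt.le i))) Set.univ = 1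
    simp only [Measure.smul_apply, Measure.finsetSum_apply, measure_univ, Finset.sum_const,
      Finset.card_univ, Fintype.card_fin, nsmul_eq_mul, mul_one, smul_eq_mul]
    exact ENNReal.inv_mul_cancel (by positivity) (by simp)⟩⟩
  refine ⟨⟨q, hqM, out, hout⟩, ⟨p, fun t h => z (selectedWeights z t h), hpM, fun t ψ => ?_,
    fun t h => (e (I t h)).2.2.2, fun t _ h => ?_, fun h => rfl⟩, fun h => ⟨_, rfl⟩⟩
  · exact (hzm ψ).comp (((hW t).comp measurable_fst).prodMk measurable_snd)
  · have hsel := expWeights_selected z t h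
    rw [hsel]
    have hw0 : ∀ i, 0 ≤ selectedWeights z t h i := fun i => by
      rw [← hsel]
      exact (expWeights_pos _ _ _).le
    have hw1 : ∑ i, selectedWeights z t h i = 1 := by
      rw [← hsel]
      exact sum_expWeights hne _ _
    have h1 : good (selectedWeights z t h) (I t h) :=
      hidx (selectedWeights z t h)
        (exists_near_optimal hγ he (by exact_mod_cast hη) hw0 hw1)
    exact (hf _ _ _ _).trans h1

end Execution

end Existence

/-! ### From the constrained coefficient to an offset bound -/

section Rates

variable {D : Type u} {Φ : Type v} {O : Type w}
  [MeasurableSpace D] [MeasurableSpace Φ] [MeasurableSpace O]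
  {𝓒 : Finset (Set (Model D Φ O))} {L : 𝓒 → D → ℝ≥0}

section DEC

theorem pDec_mono {ε ε' : ℝ} (hε : 0 ≤ ε) (h : ε ≤ ε') : pDec 𝓒 L ε ≤ pDec 𝓒 L ε' :=
  iSup₂_mono fun _ _ => iInf_mono fun _ => iInf_mono fun _ => iSup_mono fun _ =>
    iSup_mono' fun h' => ⟨h'.trans (ENNReal.ofReal_le_ofReal (by gcongr)), le_rfl⟩

theorem pDec_le_of_loss_le [Nonempty Φ] (hL : ∀ ψ, Measurable (L ψ)) (d : D) {K : ℝ≥0}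
    (hK : ∀ ψ, L ψ d ≤ K) (ε : ℝ) : pDec 𝓒 L ε ≤ K := by
  obtain ⟨f⟩ := ‹Nonempty Φ›
  refine iSup₂_le fun Mbar _ => iInf_le_of_le ⟨Measure.dirac d, inferInstance⟩
    (iInf_le_of_le ⟨Measure.dirac (d, f), inferInstance⟩ (iSup₂_le fun ψ _ => ?_))
  change ∫⁻ d, (L ψ d : ℝ≥0∞) ∂(Measure.dirac d) ≤ K
  rw [lintegral_dirac' _ (hL ψ).coe_nnreal_ennreal]
  exact_mod_cast hK ψ

/-- The infimum over (p, q) need not be attained, hence the level b strictly above it. -/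
theorem exists_loss_lt_of_pDec_lt {ε : ℝ} {b : ℝ≥0∞} (h : pDec 𝓒 L ε < b) {Mbar : Model D Φ O}
    (hM : Mbar ∈ referenceModels 𝓒) :
    ∃ (p : ProbabilityMeasure D) (q : ProbabilityMeasure (D × Φ)), ∀ ψ : 𝓒, ∀ N ∈ co ψ.1,
      ∫⁻ x, hellingerSq (N.1 x) (Mbar.1 x) ∂(q : Measure (D × Φ)) ≤ ENNReal.ofReal (ε ^ 2) →
        ∫⁻ d, (L ψ d : ℝ≥0∞) ∂(p : Measure D) < b := by
  have h1 : pDecAt 𝓒 L ε Mbar < b :=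
    (le_iSup₂ (f := fun M (_ : M ∈ referenceModels 𝓒) => pDecAt 𝓒 L ε M) Mbar hM).trans_lt h
  unfold pDecAt at h1
  simp only [iInf_lt_iff] at h1
  obtain ⟨p, q, hpq⟩ := h1
  refine ⟨p, q, fun ψ N hN hle => lt_of_le_of_lt ?_ hpq⟩
  have hgap : infoGap ψ.1 q Mbar ≤ ENNReal.ofReal (ε ^ 2) := (iInf₂_le N hN).trans hle
  exact le_iSup₂ (f := fun (P : 𝓒) (_ : infoGap P.1 q Mbar ≤ ENNReal.ofReal (ε ^ 2)) =>
    ∫⁻ d, (L P d : ℝ≥0∞) ∂(p : Measure D)) ψ hgap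

theorem lintegral_hellingerSq_le_one (M N : Model D Φ O) (q : Measure (D × Φ))
    [IsProbabilityMeasure q] : ∫⁻ x, hellingerSq (M.1 x) (N.1 x) ∂q ≤ 1 := by
  calc ∫⁻ x, hellingerSq (M.1 x) (N.1 x) ∂q ≤ ∫⁻ _, 1 ∂q :=
        lintegral_mono fun x => hellingerSq_le_one _ _
    _ = 1 := by simp

/-- Bounded losses: the offset bound follows from the constrained coefficient at one scale. -/
theorem offsetBound_of_loss_le_one [Nonempty D] [Nonempty Φ] (hL : ∀ ψ, Measurable (L ψ))
    (hL1 : ∀ ψ d, L ψ d ≤ 1) {ε s : ℝ} (hε : 0 < ε) (hs : 0 < s) :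
    OffsetBound L (1 / ε ^ 2) ((pDec 𝓒 L ε).toReal + s) := by
  intro Mbar hMbar F _ N hN
  obtain ⟨d⟩ := ‹Nonempty D›
  have hfin : pDec 𝓒 L ε ≠ ⊤ := ne_top_of_le_ne_top ENNReal.coe_ne_top
    (pDec_le_of_loss_le hL d (fun ψ => hL1 ψ d) ε)
  obtain ⟨p, q, hpq⟩ := exists_loss_lt_of_pDec_lt
    (ENNReal.lt_add_right hfin (ENNReal.ofReal_pos.2 hs).ne') hMbar
  have hle1 : ∀ ψ, ∫⁻ d, (L ψ d : ℝ≥0∞) ∂(p : Measure D) ≤ 1 := fun ψ => by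
    calc ∫⁻ d, (L ψ d : ℝ≥0∞) ∂(p : Measure D) ≤ ∫⁻ _, 1 ∂(p : Measure D) :=
          lintegral_mono fun d => by
            change (L ψ d : ℝ≥0∞) ≤ ((1 : ℝ≥0) : ℝ≥0∞)
            exact ENNReal.coe_le_coe.2 (hL1 ψ d)
      _ = 1 := by simp
  refine ⟨p, q, fun ψ => ne_top_of_le_ne_top ENNReal.one_ne_top (hle1 ψ), fun ψ hψ => ?_⟩
  have hH := lintegral_hellingerSq_le_one (N ψ) Mbar (q : Measure (D × Φ))
  set H := ∫⁻ x, hellingerSq ((N ψ).1 x) (Mbar.1 x) ∂(q : Measure (D × Φ))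
  have hHtop : H ≠ ⊤ := ne_top_of_le_ne_top ENNReal.one_ne_top hH
  -- Within radius ε the DEC applies; beyond it the penalty H/ε² already exceeds the loss, which is
  -- at most 1.
  by_cases hgood : H ≤ ENNReal.ofReal (ε ^ 2)
  · have h1 := (hpq ψ (N ψ) (hN ψ hψ) hgood).le
    have h2 := ENNReal.toReal_mono (ENNReal.add_ne_top.2 ⟨hfin, ENNReal.ofReal_ne_top⟩) h1
    rw [ENNReal.toReal_add hfin ENNReal.ofReal_ne_top, ENNReal.toReal_ofReal hs.le] at h2
    have : 0 ≤ 1 / ε ^ 2 * H.toReal := mul_nonneg (by positivity) ENNReal.toReal_nonneg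
    linarith
  · have h1 : ε ^ 2 ≤ H.toReal := by
      rw [← ENNReal.ofReal_le_iff_le_toReal hHtop]
      exact (not_le.1 hgood).le
    have h2 : 1 ≤ 1 / ε ^ 2 * H.toReal := by
      rw [one_div, ← div_eq_inv_mul, le_div_iff₀ (by positivity), one_mul]
      exact h1
    have h3 := ENNReal.toReal_mono ENNReal.one_ne_top (hle1 ψ)
    rw [ENNReal.toReal_one] at h3
    have h4 : 0 ≤ (pDec 𝓒 L ε).toReal := ENNReal.toReal_nonneg
    linarith

/-- Moderate decay is available only up to radius 1, hence the truncation, which loses nothing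
because squared Hellinger distances are at most 1. For ε > 1 monotonicity suffices. -/
theorem pDec_min_le {c : ℝ≥0} (hc : 1 ≤ c) (hdec : ModerateDecay c (pDec 𝓒 L)) {ε : ℝ}
    (hε : 0 < ε) (k : ℕ) :
    pDec 𝓒 L (min (2 ^ k * ε) 1) ≤ ENNReal.ofReal (c * 2 ^ k) * pDec 𝓒 L ε := by
  have hk : (1 : ℝ) ≤ 2 ^ k := one_le_pow₀ (by norm_num)
  have hc' : (1 : ℝ) ≤ c := by exact_mod_cast hc
  rcases le_total ε 1 with h1 | h1
  · have h2 : ε ≤ min (2 ^ k * ε) 1 := le_min (le_mul_of_one_le_left hε.le hk) h1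
    have h3 := hdec ε _ hε h2 (min_le_right _ _)
    have hpos : 0 < min (2 ^ k * ε) 1 := hε.trans_le h2
    rw [ENNReal.div_le_iff (ENNReal.ofReal_pos.2 hpos).ne' ENNReal.ofReal_ne_top] at h3
    refine h3.trans ?_
    calc (c : ℝ≥0∞) * (pDec 𝓒 L ε / ENNReal.ofReal ε) * ENNReal.ofReal (min (2 ^ k * ε) 1)
        ≤ c * (pDec 𝓒 L ε / ENNReal.ofReal ε) * ENNReal.ofReal (2 ^ k * ε) := by
          gcongr
          exact min_le_left _ _
      _ = ENNReal.ofReal (c * 2 ^ k) * pDec 𝓒 L ε := by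
          rw [ENNReal.ofReal_mul (by positivity), ENNReal.ofReal_mul (NNReal.coe_nonneg c), ENNReal.ofReal_coe_nnreal,
            div_eq_mul_inv]
          have : (ENNReal.ofReal ε)⁻¹ * ENNReal.ofReal ε = 1 :=
            ENNReal.inv_mul_cancel (ENNReal.ofReal_pos.2 hε).ne' ENNReal.ofReal_ne_top
          calc _ = (c : ℝ≥0∞) * ENNReal.ofReal (2 ^ k) * pDec 𝓒 L ε *
                ((ENNReal.ofReal ε)⁻¹ * ENNReal.ofReal ε) := by ring
            _ = _ := by rw [this, mul_one]
  · have h2 : min (2 ^ k * ε) 1 ≤ ε := (min_le_right _ _).trans h1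
    have h3 : 0 ≤ min (2 ^ k * ε) 1 := le_min (by positivity) zero_le_one
    refine (pDec_mono h3 h2).trans ?_
    have : (1 : ℝ≥0∞) ≤ ENNReal.ofReal (c * 2 ^ k) := by
      rw [ENNReal.one_le_ofReal]
      nlinarith
    exact le_mul_of_one_le_left (by simp) this

/-- Triangle inequality through a random decision. -/
theorem loss_best_le (hL : ∀ ψ, Measurable (L ψ)) {ρ : PseudoMetricSpace D} {best : 𝓒 → D}
    (hρ : ∀ P d, (L P d : ℝ) = ρ.dist (best P) d) (p : ProbabilityMeasure D) (ψ ψ₀ : 𝓒) :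
    (L ψ (best ψ₀) : ℝ≥0∞) ≤ ∫⁻ d, (L ψ d : ℝ≥0∞) ∂(p : Measure D) +
      ∫⁻ d, (L ψ₀ d : ℝ≥0∞) ∂(p : Measure D) := by
  rw [← lintegral_add_left (hL ψ).coe_nnreal_ennreal]
  calc (L ψ (best ψ₀) : ℝ≥0∞) = ∫⁻ _, (L ψ (best ψ₀) : ℝ≥0∞) ∂(p : Measure D) := by simp
    _ ≤ _ := lintegral_mono fun d => by
      have : (L ψ (best ψ₀) : ℝ) ≤ L ψ d + L ψ₀ d := by
        rw [hρ, hρ, hρ, ρ.dist_comm (best ψ₀) d]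
        exact ρ.dist_triangle _ _ _
      change (L ψ (best ψ₀) : ℝ≥0∞) ≤ (L ψ d : ℝ≥0∞) + (L ψ₀ d : ℝ≥0∞)
      rw [← ENNReal.coe_add, ENNReal.coe_le_coe]
      exact_mod_cast this

/-- The geometric mixture `∑ k, 2⁻¹ ^ (k + 1) • q k`. -/
def geometricMixture {X : Type*} [MeasurableSpace X] (q : ℕ → ProbabilityMeasure X) :
    ProbabilityMeasure X :=
  ⟨Measure.sum fun k => ((2 : ℝ≥0∞)⁻¹ ^ (k + 1)) • (q k : Measure X), ⟨by
    rw [Measure.sum_apply _ MeasurableSet.univ]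
    simp only [Measure.smul_apply, measure_univ, smul_eq_mul, mul_one]
    rw [ENNReal.tsum_geometric_add_one, ENNReal.one_sub_inv_two, inv_inv,
      ENNReal.inv_mul_cancel (by simp) (by simp)]⟩⟩

theorem mul_lintegral_le_geometricMixture {X : Type*} [MeasurableSpace X]
    (q : ℕ → ProbabilityMeasure X) (f : X → ℝ≥0∞) (k : ℕ) :
    (2 : ℝ≥0∞)⁻¹ ^ (k + 1) * ∫⁻ x, f x ∂(q k : Measure X) ≤
      ∫⁻ x, f x ∂(geometricMixture q : Measure X) := by
  change _ ≤ ∫⁻ x, f x ∂(Measure.sum fun k => ((2 : ℝ≥0∞)⁻¹ ^ (k + 1)) • (q k : Measure X))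
  rw [lintegral_sum_measure, ← smul_eq_mul, ← lintegral_smul_measure]
  exact ENNReal.le_tsum (f := fun k => ∫⁻ x, f x ∂((2 : ℝ≥0∞)⁻¹ ^ (k + 1)) • (q k : Measure X)) k

/-- Metric losses with moderate decay: the offset bound follows by exploring at all dyadic scales
and playing the best decision of the information set closest to the reference model. -/
theorem offsetBound_of_metricBased (hL : ∀ ψ, Measurable (L ψ)) {c : ℝ≥0} (hc : 1 ≤ c)
    (hmet : MetricBased L) (hdec : ModerateDecay c (pDec 𝓒 L)) {ε : ℝ} (hε : 0 < ε)
    (h0 : pDec 𝓒 L ε ≠ 0) (htop : pDec 𝓒 L ε ≠ ⊤) :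
    OffsetBound L (16 * c * (pDec 𝓒 L ε).toReal / ε ^ 2) (4 * c * (pDec 𝓒 L ε).toReal) := by
  obtain ⟨ρ, best, hρ⟩ := hmet
  intro Mbar hMbar F hF N hN
  set v := (pDec 𝓒 L ε).toReal with hv
  have hv0 : 0 < v := ENNReal.toReal_pos h0 htop
  have hveq : pDec 𝓒 L ε = ENNReal.ofReal v := (ENNReal.ofReal_toReal htop).symm
  have hc' : (1 : ℝ) ≤ c := by exact_mod_cast hc
  -- The factor 2 buys strictness, which requires v > 0.
  have hlt : ∀ k : ℕ, pDec 𝓒 L (min (2 ^ k * ε) 1) < ENNReal.ofReal (2 * (c * 2 ^ k * v)) := by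
    intro k
    refine (pDec_min_le hc hdec hε k).trans_lt ?_
    have hpos : 0 < c * 2 ^ k * v := by positivity
    rw [hveq, ← ENNReal.ofReal_mul (by positivity), ENNReal.ofReal_lt_ofReal_iff (by positivity)]
    linarith
  choose p q hpq using fun k => exists_loss_lt_of_pDec_lt (hlt k) hMbar
  set H : 𝓒 → ℝ≥0∞ := fun ψ => ∫⁻ x, hellingerSq ((N ψ).1 x) (Mbar.1 x)
    ∂(geometricMixture q : Measure (D × Φ)) with hH
  have hHtop : ∀ ψ, H ψ ≠ ⊤ := fun ψ =>
    ne_top_of_le_ne_top ENNReal.one_ne_top (lintegral_hellingerSq_le_one _ _ _)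
  obtain ⟨ψ₀, hψ₀, hmin⟩ := F.exists_min_image H hF
  refine ⟨⟨Measure.dirac (best ψ₀), inferInstance⟩, geometricMixture q,
    lintegral_dirac_loss_ne_top hL _, fun ψ hψ => ?_⟩
  change (∫⁻ d, (L ψ d : ℝ≥0∞) ∂(Measure.dirac (best ψ₀))).toReal ≤
    _ + _ * (H ψ).toReal
  rw [lintegral_dirac' _ (hL ψ).coe_nnreal_ennreal, ENNReal.coe_toReal]
  -- Component k has weight 2^-(k+1), so the squared distance under `q k` is at most 2^(k+1) · 2^k
  -- ε²/2 = (2^k ε)². At the truncated radius 1 feasibility is automatic.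
  have hscale : ∀ (k : ℕ), ∀ ψ' ∈ F, (H ψ').toReal ≤ 2 ^ k * ε ^ 2 / 2 →
      ∫⁻ d, (L ψ' d : ℝ≥0∞) ∂(p k : Measure D) < ENNReal.ofReal (2 * (c * 2 ^ k * v)) := by
    intro k ψ' hψ' hle
    refine hpq k ψ' (N ψ') (hN ψ' hψ') ?_
    have h1 := lintegral_hellingerSq_le_one (N ψ') Mbar (q k : Measure (D × Φ))
    have h2 := mul_lintegral_le_geometricMixture q
      (fun x => hellingerSq ((N ψ').1 x) (Mbar.1 x)) k
    set I := ∫⁻ x, hellingerSq ((N ψ').1 x) (Mbar.1 x) ∂(q k : Measure (D × Φ))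
    have hItop : I ≠ ⊤ := ne_top_of_le_ne_top ENNReal.one_ne_top h1
    have h3 := ENNReal.toReal_mono (hHtop ψ') h2
    rw [ENNReal.toReal_mul, ENNReal.toReal_pow, ENNReal.toReal_inv, ENNReal.toReal_ofNat] at h3
    have h4 := ENNReal.toReal_mono ENNReal.one_ne_top h1
    rw [ENNReal.toReal_one] at h4
    rw [← ENNReal.ofReal_toReal hItop]
    refine ENNReal.ofReal_le_ofReal ?_
    rcases min_choice (2 ^ k * ε) 1 with hm | hm
    · rw [hm]
      have h5 : ((2 : ℝ)⁻¹) ^ (k + 1) * 2 ^ (k + 1) = 1 := by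
        rw [← mul_pow]; norm_num
      have h6 : I.toReal = ((2 : ℝ)⁻¹ ^ (k + 1) * I.toReal) * 2 ^ (k + 1) := by
        rw [mul_right_comm, h5, one_mul]
      rw [h6]
      calc _ ≤ (2 ^ k * ε ^ 2 / 2) * 2 ^ (k + 1) :=
            mul_le_mul_of_nonneg_right (h3.trans hle) (by positivity)
        _ = (2 ^ k * ε) ^ 2 := by ring
    · rw [hm]
      simpa using h4
  -- By minimality ψ₀ is feasible whenever ψ is, so both have small loss under `p k`; the triangle
  -- inequality through a decision drawn from `p k` adds the two bounds.
  have hbound : ∀ k : ℕ, (H ψ).toReal ≤ 2 ^ k * ε ^ 2 / 2 →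
      (L ψ (best ψ₀) : ℝ) ≤ 4 * c * v * 2 ^ k := by
    intro k hk
    have h1 := hscale k ψ hψ hk
    have h2 := hscale k ψ₀ hψ₀ ((ENNReal.toReal_mono (hHtop ψ) (hmin ψ hψ)).trans hk)
    have h3 := (loss_best_le hL hρ (p k) ψ ψ₀).trans (add_le_add h1.le h2.le)
    rw [← ENNReal.ofReal_add (by positivity) (by positivity), ← ENNReal.ofReal_coe_nnreal,
      ENNReal.ofReal_le_ofReal_iff (by positivity)] at h3
    linarith
  have hexk : ∃ k : ℕ, (H ψ).toReal ≤ 2 ^ k * ε ^ 2 / 2 := by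
    obtain ⟨k, hk⟩ := pow_unbounded_of_one_lt ((H ψ).toReal * 2 / ε ^ 2) (one_lt_two (α := ℝ))
    refine ⟨k, ?_⟩
    rw [div_lt_iff₀ (by positivity)] at hk
    linarith
  classical
  have hspec := Nat.find_spec hexk
  have hHnn : 0 ≤ (H ψ).toReal := ENNReal.toReal_nonneg
  -- At the least feasible scale: scale 0 gives the constant 4 c v. Otherwise failure at the
  -- previous scale gives 2^(k+1) ≤ 4H/ε², whence the coefficient 16 c v/ε².
  rcases hk : Nat.find hexk with _ | k
  · rw [hk] at hspec
    have h1 := hbound 0 hspec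
    have h2 : 0 ≤ 16 * c * v / ε ^ 2 * (H ψ).toReal := by positivity
    simp only [pow_zero, mul_one] at h1
    linarith
  · rw [hk] at hspec
    have h1 := hbound _ hspec
    have h2 : ¬ (H ψ).toReal ≤ 2 ^ k * ε ^ 2 / 2 := Nat.find_min hexk (by omega)
    rw [not_le] at h2
    have h3 : 4 * c * v * 2 ^ (k + 1) ≤ 16 * c * v / ε ^ 2 * (H ψ).toReal := by
      have h4 : (2 : ℝ) ^ (k + 1) ≤ 4 / ε ^ 2 * (H ψ).toReal := by
        rw [div_mul_eq_mul_div, le_div_iff₀ (by positivity), pow_succ]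
        linarith
      calc 4 * c * v * 2 ^ (k + 1) ≤ 4 * c * v * (4 / ε ^ 2 * (H ψ).toReal) := by gcongr
        _ = _ := by ring
    have h4 : 0 ≤ 4 * c * v := by positivity
    linarith

/-- When the coefficient vanishes, the optimal decisions of non-empty information sets are at
distance zero from each other. -/
theorem loss_best_eq_zero (hL : ∀ ψ, Measurable (L ψ)) {c : ℝ≥0} (hc : 1 ≤ c)
    {ρ : PseudoMetricSpace D} {best : 𝓒 → D} (hρ : ∀ P d, (L P d : ℝ) = ρ.dist (best P) d)
    (hdec : ModerateDecay c (pDec 𝓒 L)) {ε : ℝ} (hε : 0 < ε) (h0 : pDec 𝓒 L ε = 0) {ψ ψ₀ : 𝓒}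
    {M M₀ : Model D Φ O} (hM : M ∈ ψ.1) (hM₀ : M₀ ∈ ψ₀.1) : L ψ (best ψ₀) = 0 := by
  have h1 : pDec 𝓒 L 1 = 0 := by
    obtain ⟨k, hk⟩ := pow_unbounded_of_one_lt (1 / ε) (one_lt_two (α := ℝ))
    rw [div_lt_iff₀ hε] at hk
    have := pDec_min_le hc hdec hε k
    rwa [min_eq_right hk.le, h0, mul_zero, nonpos_iff_eq_zero] at this
  have href : M ∈ referenceModels 𝓒 := subset_co _ (by
    simp only [Set.mem_iUnion]
    exact ⟨ψ.1, ψ.2, hM⟩)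
  by_contra hne
  have hpos : (0 : ℝ≥0∞) < L ψ (best ψ₀) := by
    simpa [pos_iff_ne_zero] using hne
  have hhalf : (0 : ℝ≥0∞) < L ψ (best ψ₀) / 2 := ENNReal.half_pos hpos.ne'
  -- At radius 1 every non-empty information set is feasible, so one law p has loss below half the
  -- putative distance for both ψ and ψ₀.
  obtain ⟨p, q, hpq⟩ := exists_loss_lt_of_pDec_lt (h1.trans_lt hhalf) href
  have hone : ENNReal.ofReal ((1 : ℝ) ^ 2) = 1 := by simp
  have h2 := hpq ψ M (subset_co _ hM) ((lintegral_hellingerSq_le_one _ _ _).trans hone.ge)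
  have h3 := hpq ψ₀ M₀ (subset_co _ hM₀) ((lintegral_hellingerSq_le_one _ _ _).trans hone.ge)
  have h4 := (loss_best_le hL hρ p ψ ψ₀).trans_lt (ENNReal.add_lt_add h2 h3)
  rw [ENNReal.add_halves] at h4
  exact absurd h4 (lt_irrefl _)

end DEC

end Rates

/-! ### Risk guarantees of ExO⁺ -/

section Guarantees

variable {D : Type u} {Φ : Type v} {O : Type w}
  [MeasurableSpace D] [MeasurableSpace Φ] [MeasurableSpace O]
  {𝓒 : Finset (Set (Model D Φ O))} {L : 𝓒 → D → ℝ≥0}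

theorem IsExOPlus.mono {T : ℕ} {alg : Algorithm D Φ O T} {γ : ℝ} {η η' : ℝ≥0}
    (h : IsExOPlus alg L γ η) (hη : η ≤ η') : IsExOPlus alg L γ η' := by
  obtain ⟨p, ξ, hp, hξ, hξw, hobj, hout⟩ := h
  refine ⟨p, ξ, hp, hξ, hξw, fun t ht h => (hobj t ht h).trans ?_, hout⟩
  gcongr

theorem RiskBound.mono {T : ℕ} {alg : Algorithm D Φ O T} {δ : ℝ} {B B' : ℝ≥0∞}
    (h : RiskBound.{u, v, w, z} alg L δ B) (hB : B ≤ B') : RiskBound.{u, v, w, z} alg L δ B' :=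
  fun Z _ env P hcon => (h Z env P hcon).trans (measure_mono fun _ hx => le_trans hx hB)

theorem Environment.ConstrainedTo.nonempty {Z : Type z} [MeasurableSpace Z]
    {env : Environment D Φ O Z} {T : ℕ} (hT : 1 ≤ T) {P : Set (Model D Φ O)}
    (h : env.ConstrainedTo T P) : P.Nonempty := by
  have := env.choose_markov 0
  obtain ⟨l, hl⟩ := (h 0 (by omega) Fin.elim0).exists
  exact ⟨_, hl⟩

/-- A surely bounded risk. -/
theorem riskBound_of_forall {T : ℕ} (hT : 1 ≤ T) {alg : Algorithm D Φ O T} {δ : ℝ} (hδ : 0 < δ)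
    {B : ℝ≥0∞} (h : ∀ P : 𝓒, P.1.Nonempty → ∀ h, risk alg L P h ≤ B) :
    RiskBound.{u, v, w, z} alg L δ B := by
  intro Z _ env P hcon
  have hset : {h : Fin T → Round D Φ O Z | risk alg L P (visible h) ≤ B} = Set.univ :=
    Set.eq_univ_of_forall fun x => h P (hcon.nonempty hT) _
  rw [hset, measure_univ]
  exact ENNReal.ofReal_le_one.2 (by linarith)

/-- The guarantee of ExO⁺ from an offset bound. -/
theorem riskBound_of_offsetBound [Nonempty D] [Nonempty Φ]
    [MeasurableSpace.CountableOrCountablyGenerated (D × Φ) O]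
    (hne : 𝓒.Nonempty) (hcov : FiniteCovering (convexifiedClass 𝓒)) {T : ℕ} (hT : 1 ≤ T) {δ : ℝ}
    (hδ : 0 < δ) (hL : ∀ P, Measurable (L P)) {γ B : ℝ} (hγ : 0 < γ) (hB : OffsetBound L γ B)
    {η : ℝ≥0} {alg : Algorithm D Φ O T} (halg : IsExOPlus alg L (4 * γ) η) :
    RiskBound.{u, v, w, z} alg L δ
      (ENNReal.ofReal (B + η + 4 * γ * Real.log (𝓒.card / δ) / T)) := by
  obtain ⟨p, ξ, hp, hξ, hξw, hobj, hout⟩ := halg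
  intro Z _ env P hcon
  refine risk_bound_of_objective_le hT alg env hL (p := p) hξ hξw (by positivity)
    (fun t ht h => (hobj t ht h).trans ?_) hout P hcon hδ
  rw [EReal.coe_add]
  exact add_le_add_left (exo_le hcov hL hγ hB (fun i => expWeights_pos _ _ _)
    (sum_expWeights hne _ _)) _

/-- Empty information sets do not enter the supremum. Exploitation laws can thus be replaced by a
point mass without losing near-optimality. -/
theorem objective_dirac_le (hL : ∀ P, Measurable (L P)) {d : D}
    (hd : ∀ ψ : 𝓒, ψ.1.Nonempty → L ψ d = 0) (γ : ℝ) (wt : 𝓒 → ℝ) (p : Measure D)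
    (q : Measure (D × Φ)) (ξ : 𝓒 → Obs D Φ O → ℝ) :
    objective L γ wt (Measure.dirac d) q ξ ≤ objective L γ wt p q ξ := by
  refine iSup_mono fun ψ => iSup₂_mono fun M hM => ?_
  rw [objectiveAt_eq, objectiveAt_eq, lintegral_dirac' _ (hL ψ).coe_nnreal_ennreal, hd ψ ⟨M, hM⟩]
  refine EReal.sub_le_sub ?_ le_rfl
  rw [ENNReal.coe_zero]
  exact EReal.coe_ennreal_le_coe_ennreal_iff.2 bot_le

/-- If all non-empty information sets share a loss with minimum zero, near-optimal exploitation laws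
have small loss. -/
theorem lintegral_loss_le_of_objective_le (hL : ∀ P, Measurable (L P)) {d : D}
    (hd : ∀ ψ : 𝓒, ψ.1.Nonempty → L ψ d = 0) {P : 𝓒} (hP : P.1.Nonempty)
    (hsame : ∀ ψ : 𝓒, ψ.1.Nonempty → L ψ = L P) {γ : ℝ} (hγ : 0 ≤ γ) {wt : 𝓒 → ℝ}
    (hw : ∀ i, 0 ≤ wt i) (hw1 : ∑ i, wt i = 1) {ξ : 𝓒 → Obs D Φ O → ℝ}
    (hξ : ξ ∈ weightFunctions 𝓒) (p : Measure D) (q : ProbabilityMeasure (D × Φ)) {η : ℝ≥0}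
    (h : objective L γ wt p (q : Measure (D × Φ)) ξ ≤ exo L γ wt + ((η : ℝ) : EReal)) :
    ∫⁻ d, (L P d : ℝ≥0∞) ∂p ≤ η := by
  obtain ⟨M, hM⟩ := hP
  set X := objective L γ wt (Measure.dirac d) (q : Measure (D × Φ)) ξ with hX
  have hexo : exo L γ wt ≤ X :=
    iInf_le_of_le ⟨Measure.dirac d, inferInstance⟩ (iInf_le_of_le q (iInf₂_le_of_le ξ hξ le_rfl))
  obtain ⟨G, hG⟩ := exists_abs_gap_le (wt := wt) hξ
  have hXtop : X ≤ ((γ * G : ℝ) : EReal) := by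
    refine iSup_le fun ψ => iSup₂_le fun N hN => ?_
    have hzero : ∫⁻ d, (L ψ d : ℝ≥0∞) ∂(Measure.dirac d) = 0 := by
      rw [lintegral_dirac' _ (hL ψ).coe_nnreal_ennreal, hd ψ ⟨N, hN⟩, ENNReal.coe_zero]
    rw [objectiveAt_eq_coe (by rw [hzero]; exact ENNReal.zero_ne_top), hzero, EReal.coe_le_coe_iff,
      ENNReal.toReal_zero, zero_sub]
    have := (abs_le.1 (abs_info_le hG (q : Measure (D × Φ)) N ψ)).1
    nlinarith
  have hXbot := neg_le_objective (L := L) hγ hw hw1 hξ (Measure.dirac d) (q : Measure (D × Φ)) hM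
  rw [← hX] at hXbot
  lift X to ℝ using ⟨(hXtop.trans_lt (EReal.coe_lt_top _)).ne,
    ((EReal.bot_lt_coe _).trans_le hXbot).ne'⟩ with x hx
  have hle : objective L γ wt p (q : Measure (D × Φ)) ξ ≤ ((x + η : ℝ) : EReal) := by
    rw [EReal.coe_add]
    exact h.trans (add_le_add_left hexo _)
  have hat : ∀ ψ : 𝓒, ∀ N ∈ ψ.1,
      objectiveAt L γ wt p (q : Measure (D × Φ)) ξ N ψ ≤ ((x + η : ℝ) : EReal) :=
    fun ψ N hN => le_trans (le_iSup_of_le ψ (le_iSup₂_of_le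
      (f := fun N (_ : N ∈ ψ.1) => objectiveAt L γ wt p (q : Measure (D × Φ)) ξ N ψ) N hN le_rfl))
      hle
  have hfin := (le_of_objectiveAt_le (hat P M hM)).1
  set ℓ := (∫⁻ d, (L P d : ℝ≥0∞) ∂p).toReal with hℓ
  -- With a shared loss, replacing p by the point mass at d lowers every term by the same ℓ, keeping
  -- q and ξ. Accuracy η then forces ℓ ≤ η.
  have hx2 : ((x : ℝ) : EReal) ≤ ((x + η - ℓ : ℝ) : EReal) := by
    rw [hx]
    refine iSup_le fun ψ => iSup₂_le fun N hN => ?_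
    have hzero : ∫⁻ d, (L ψ d : ℝ≥0∞) ∂(Measure.dirac d) = 0 := by
      rw [lintegral_dirac' _ (hL ψ).coe_nnreal_ennreal, hd ψ ⟨N, hN⟩, ENNReal.coe_zero]
    rw [objectiveAt_eq_coe (by rw [hzero]; exact ENNReal.zero_ne_top), hzero, EReal.coe_le_coe_iff,
      ENNReal.toReal_zero, zero_sub]
    have h1 := (le_of_objectiveAt_le (hat ψ N hN)).2
    rw [hsame ψ ⟨N, hN⟩] at h1
    linarith
  rw [EReal.coe_le_coe_iff] at hx2
  rw [← ENNReal.ofReal_toReal hfin, ← ENNReal.ofReal_coe_nnreal]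
  exact ENNReal.ofReal_le_ofReal (by linarith)

theorem risk_le_of_forall_lintegral_le {T : ℕ} (hT : 1 ≤ T) {alg : Algorithm D Φ O T} {P : 𝓒}
    {h : Fin T → Obs D Φ O} {ν : Fin T → Measure D}
    (hout : alg.output h = (T : ℝ≥0∞)⁻¹ • ∑ t : Fin T, ν t) {B : ℝ≥0∞}
    (hν : ∀ t, ∫⁻ d, (L P d : ℝ≥0∞) ∂(ν t) ≤ B) : risk alg L P h ≤ B := by
  unfold risk
  rw [hout, lintegral_smul_measure, lintegral_finsetSum_measure, smul_eq_mul]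
  calc (T : ℝ≥0∞)⁻¹ * ∑ t : Fin T, ∫⁻ d, (L P d : ℝ≥0∞) ∂(ν t)
      ≤ (T : ℝ≥0∞)⁻¹ * ∑ _t : Fin T, B := by
        gcongr with t _
        exact hν t
    _ = B := by
        rw [Finset.sum_const, Finset.card_univ, Fintype.card_fin, nsmul_eq_mul, ← mul_assoc,
          ENNReal.inv_mul_cancel (by positivity) (by simp), one_mul]

/-- Metric losses with vanishing coefficient. -/
theorem exists_exoPlus_of_pDec_eq_zero [Nonempty D] [Nonempty Φ] (hne : 𝓒.Nonempty) {T : ℕ}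
    (hT : 1 ≤ T) {δ : ℝ} (hδ : 0 < δ) (hL : ∀ P, Measurable (L P)) {c : ℝ≥0} (hc : 1 ≤ c)
    (hmet : MetricBased L) (hdec : ModerateDecay c (pDec 𝓒 L)) {ε : ℝ} (hε : 0 < ε)
    (h0 : pDec 𝓒 L ε = 0) :
    (∀ η : ℝ≥0, 0 < η → ∃ alg : Algorithm D Φ O T,
      IsExOPlus alg L 1 η ∧ RiskBound.{u, v, w, z} alg L δ 0) ∧
    (∀ (η : ℝ≥0) (alg : Algorithm D Φ O T), IsExOPlus alg L 1 η →
      RiskBound.{u, v, w, z} alg L δ η) := by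
  obtain ⟨ρ, best, hρ⟩ := hmet
  have hzero : ∀ ψ ψ₀ : 𝓒, ψ.1.Nonempty → ψ₀.1.Nonempty → L ψ (best ψ₀) = 0 :=
    fun ψ ψ₀ ⟨M, hM⟩ ⟨M₀, hM₀⟩ => loss_best_eq_zero hL hc hρ hdec hε h0 hM hM₀
  have hsame : ∀ ψ ψ₀ : 𝓒, ψ.1.Nonempty → ψ₀.1.Nonempty → L ψ = L ψ₀ := by
    have hle : ∀ ψ ψ₀ : 𝓒, ψ.1.Nonempty → ψ₀.1.Nonempty → ∀ d, L ψ d ≤ L ψ₀ d := by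
      intro ψ ψ₀ h h' d
      have h1 : (L ψ (best ψ₀) : ℝ) = 0 := by rw [hzero ψ ψ₀ h h', NNReal.coe_zero]
      have h2 : (L ψ d : ℝ) ≤ L ψ (best ψ₀) + L ψ₀ d := by
        rw [hρ, hρ, hρ]
        exact ρ.dist_triangle _ _ _
      rw [h1, zero_add] at h2
      exact_mod_cast h2
    exact fun ψ ψ₀ h h' => funext fun d => le_antisymm (hle ψ ψ₀ h h' d) (hle ψ₀ ψ h' h d)
  constructor
  · intro η hη
    by_cases hex : ∃ ψ₀ : 𝓒, ψ₀.1.Nonempty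
    · obtain ⟨ψ₀, hψ₀⟩ := hex
      -- The bound 0 cannot absorb the accuracy η, so every exploitation law is replaced by the
      -- point mass at a common optimal decision.
      obtain ⟨alg, halg, hout⟩ := exists_isExOPlus hne hT L (γ := 1) zero_le_one hη
        (fun _ => ⟨Measure.dirac (best ψ₀), inferInstance⟩)
        (fun wt p q ξ => objective_dirac_le hL (fun ψ hψ => hzero ψ ψ₀ hψ hψ₀) 1 wt _ _ ξ)
      refine ⟨alg, halg, riskBound_of_forall hT hδ fun P hP h => ?_⟩
      obtain ⟨p, hp⟩ := hout h
      refine risk_le_of_forall_lintegral_le hT hp fun t => ?_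
      change ∫⁻ d, (L P d : ℝ≥0∞) ∂(Measure.dirac (best ψ₀)) ≤ 0
      rw [lintegral_dirac' _ (hL P).coe_nnreal_ennreal, hzero P ψ₀ hP hψ₀, ENNReal.coe_zero]
    · obtain ⟨alg, halg, -⟩ := exists_isExOPlus hne hT L (γ := 1) zero_le_one hη id
        (fun wt p q ξ => le_rfl)
      exact ⟨alg, halg, riskBound_of_forall hT hδ fun P hP => absurd ⟨P, hP⟩ hex⟩
  · rintro η alg ⟨p, ξ, hp, hξ, hξw, hobj, hout⟩
    refine riskBound_of_forall hT hδ fun P hP h => risk_le_of_forall_lintegral_le hT (hout h)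
      fun t => ?_
    have := alg.explore_markov t
    exact lintegral_loss_le_of_objective_le hL (d := best P) (fun ψ hψ => hzero ψ P hψ hP) hP
      (fun ψ hψ => hsame ψ P hψ hP) zero_le_one (fun i => (expWeights_pos _ _ _).le)
      (sum_expWeights hne _ _) (hξw _ _) _ ⟨alg.explore t _, inferInstance⟩ (hobj t t.2 _)

theorem log_card_div_pos (hne : 𝓒.Nonempty) {δ : ℝ} (hδ : 0 < δ) (hδ1 : δ < 1) :
    0 < Real.log (𝓒.card / δ) := by
  have h1 : (1 : ℝ) ≤ 𝓒.card := by exact_mod_cast Finset.card_pos.2 hne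
  exact Real.log_pos (by rw [lt_div_iff₀ hδ]; linarith)

theorem epsBar_pos (hne : 𝓒.Nonempty) {δ τ : ℝ} (hδ : 0 < δ) (hδ1 : δ < 1) (hτ : 0 < τ) :
    0 < epsBar 𝓒.card δ τ :=
  Real.sqrt_pos.2 (div_pos (log_card_div_pos hne hδ hδ1) hτ)

theorem epsBar_sq (hne : 𝓒.Nonempty) {δ τ : ℝ} (hδ : 0 < δ) (hδ1 : δ < 1) (hτ : 0 < τ) :
    epsBar 𝓒.card δ τ ^ 2 = Real.log (𝓒.card / δ) / τ :=
  Real.sq_sqrt (div_pos (log_card_div_pos hne hδ hδ1) hτ).le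

end Guarantees

end

end HybridDMSO

/-! ### Assembling the constants -/

open HybridDMSO in
theorem mainTheorem2 :
    ∃ C : ℝ≥0, ∀ (D : Type u) (Φ : Type v) (O : Type w)
      [MeasurableSpace D] [MeasurableSpace Φ] [MeasurableSpace O] [Nonempty D] [Nonempty Φ]
      [MeasurableSpace.CountableOrCountablyGenerated (D × Φ) O]
      (𝓒 : Finset (Set (HybridDMSO.Model D Φ O))) (_ : 𝓒.Nonempty)
      (_ : HybridDMSO.FiniteCovering (HybridDMSO.convexifiedClass 𝓒))
      (T : ℕ) (_ : 1 ≤ T) (δ : ℝ) (_ : 0 < δ) (_ : δ < 1)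
      (L : 𝓒 → D → ℝ≥0) (_ : ∀ P, Measurable (L P)),
      (∀ c : ℝ≥0, 1 ≤ c → HybridDMSO.MetricBased L →
        HybridDMSO.ModerateDecay c (HybridDMSO.pDec 𝓒 L) →
        ∃ γ : ℝ, 0 < γ ∧
          (∀ η : ℝ≥0, 0 < η → ∃ alg : HybridDMSO.Algorithm D Φ O T,
            HybridDMSO.IsExOPlus alg L γ η ∧
            HybridDMSO.RiskBound.{u, v, w, z} alg L δ
              (C * c * HybridDMSO.pDec 𝓒 L (HybridDMSO.epsBar 𝓒.card δ T))) ∧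
          (∀ (η : ℝ≥0) (alg : HybridDMSO.Algorithm D Φ O T),
            HybridDMSO.IsExOPlus alg L γ η →
            HybridDMSO.RiskBound.{u, v, w, z} alg L δ
              (C * c * HybridDMSO.pDec 𝓒 L (HybridDMSO.epsBar 𝓒.card δ T) + η))) ∧
      (∀ Δ : ℝ≥0, 0 < Δ → (∀ P d, L P d ≤ 1) →
        ∃ γ : ℝ, 0 < γ ∧
          (∀ η : ℝ≥0, 0 < η → ∃ alg : HybridDMSO.Algorithm D Φ O T,
            HybridDMSO.IsExOPlus alg L γ η ∧
            HybridDMSO.RiskBound.{u, v, w, z} alg L δ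
              (C * (HybridDMSO.pDec 𝓒 L (HybridDMSO.epsBar 𝓒.card δ (Δ * T)) + Δ))) ∧
          (∀ (η : ℝ≥0) (alg : HybridDMSO.Algorithm D Φ O T),
            HybridDMSO.IsExOPlus alg L γ η →
            HybridDMSO.RiskBound.{u, v, w, z} alg L δ
              (C * (HybridDMSO.pDec 𝓒 L (HybridDMSO.epsBar 𝓒.card δ (Δ * T)) + Δ) + η))) := by
  -- 69 = 4 + 64 + 1 in the metric case: offset bound, γ log(|𝓒|/δ)/T, and accuracy at most v. The
  -- bounded case needs only v + 6Δ.
  refine ⟨69, fun D Φ O _ _ _ _ _ _ 𝓒 hne hcov T hT δ hδ hδ1 L hL => ⟨?_, ?_⟩⟩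
  · intro c hc hmet hdec
    have hTpos : (0 : ℝ) < T := by exact_mod_cast hT
    have hε := epsBar_pos hne hδ hδ1 hTpos
    have hεsq := epsBar_sq hne hδ hδ1 hTpos
    set ε := epsBar 𝓒.card δ T
    -- The general choice of γ is proportional to the DEC and would be 0 here.
    by_cases h0 : pDec 𝓒 L ε = 0
    · obtain ⟨h1, h2⟩ := exists_exoPlus_of_pDec_eq_zero.{u, v, w, z} hne hT hδ hL hc hmet hdec hε h0
      refine ⟨1, one_pos, ?_, ?_⟩
      · rw [h0, mul_zero]
        exact h1
      · rw [h0, mul_zero]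
        simpa only [zero_add] using h2
    have htop : pDec 𝓒 L ε ≠ ⊤ := by
      obtain ⟨d⟩ := ‹Nonempty D›
      exact ne_top_of_le_ne_top ENNReal.coe_ne_top (pDec_le_of_loss_le hL d
        (K := ∑ ψ, L ψ d) (fun ψ => Finset.single_le_sum (f := fun ψ => L ψ d)
          (fun _ _ => zero_le) (Finset.mem_univ ψ)) ε)
    have hoff := offsetBound_of_metricBased hL hc hmet hdec hε h0 htop
    set v := (pDec 𝓒 L ε).toNNReal with hv
    have hv0 : 0 < v := ENNReal.toNNReal_pos h0 htop
    have hveq : pDec 𝓒 L ε = v := (ENNReal.coe_toNNReal htop).symm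
    have hvr : (pDec 𝓒 L ε).toReal = v := rfl
    rw [hvr] at hoff
    have hc' : (1 : ℝ) ≤ c := by exact_mod_cast hc
    have hv0' : (0 : ℝ) < v := by exact_mod_cast hv0
    have hγ : 0 < 16 * c * v / ε ^ 2 := by positivity
    have hlog : 4 * (16 * c * v / ε ^ 2) * Real.log (𝓒.card / δ) / T = 64 * c * v := by
      rw [mul_div_assoc, ← hεsq]
      field_simp
      norm_num
    have main : ∀ (η : ℝ≥0) (alg : Algorithm D Φ O T),
        IsExOPlus alg L (4 * (16 * c * v / ε ^ 2)) η →
        RiskBound.{u, v, w, z} alg L δ ((68 * c * v + η : ℝ≥0) : ℝ≥0∞) := by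
      intro η alg halg
      refine (riskBound_of_offsetBound hne hcov hT hδ hL hγ hoff halg).mono ?_
      rw [hlog, ← ENNReal.ofReal_coe_nnreal]
      refine ENNReal.ofReal_le_ofReal (le_of_eq ?_)
      push_cast
      ring
    refine ⟨4 * (16 * c * v / ε ^ 2), by positivity, fun η hη => ?_, fun η alg halg => ?_⟩
    -- Solving to accuracy min(η, v) yields an execution of accuracy η whose optimization error is
    -- absorbed in the bound.
    · obtain ⟨alg, halg, -⟩ := exists_isExOPlus hne hT L (γ := 4 * (16 * c * v / ε ^ 2))
        (by positivity) (lt_min hη hv0) id (fun _ _ _ _ => le_rfl)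
      refine ⟨alg, halg.mono (min_le_left _ _), (main _ alg (halg.mono (min_le_right _ _))).mono ?_⟩
      rw [hveq]
      have : 68 * c * v + v ≤ 69 * c * v := by
        have : v ≤ c * v := le_mul_of_one_le_left (by positivity) hc
        calc 68 * c * v + v ≤ 68 * c * v + c * v := by gcongr
          _ = 69 * c * v := by ring
      exact_mod_cast this
    · refine (main η alg halg).mono ?_
      rw [hveq]
      have : 68 * c * v + η ≤ 69 * c * v + η := by
        gcongr
        norm_num
      exact_mod_cast this
  · intro Δ hΔ hL1
    have hTpos : (0 : ℝ) < T := by exact_mod_cast hT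
    have hΔ' : (0 : ℝ) < Δ := by exact_mod_cast hΔ
    have hε := epsBar_pos hne hδ hδ1 (mul_pos hΔ' hTpos)
    have hεsq := epsBar_sq hne hδ hδ1 (mul_pos hΔ' hTpos)
    set ε := epsBar 𝓒.card δ (Δ * T)
    have htop : pDec 𝓒 L ε ≠ ⊤ := by
      obtain ⟨d⟩ := ‹Nonempty D›
      exact ne_top_of_le_ne_top ENNReal.coe_ne_top
        (pDec_le_of_loss_le hL d (fun ψ => hL1 ψ d) ε)
    -- The slack is taken equal to Δ; together with 4Δ from the logarithmic term this gives 5Δ, and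
    -- accuracy at most Δ adds one more.
    have hoff := offsetBound_of_loss_le_one hL hL1 hε hΔ'
    set v := (pDec 𝓒 L ε).toNNReal with hv
    have hveq : pDec 𝓒 L ε = v := (ENNReal.coe_toNNReal htop).symm
    have hvr : (pDec 𝓒 L ε).toReal = v := rfl
    rw [hvr] at hoff
    have hγ : 0 < 1 / ε ^ 2 := by positivity
    have hlog : 4 * (1 / ε ^ 2) * Real.log (𝓒.card / δ) / T = 4 * Δ := by
      have hl := log_card_div_pos hne hδ hδ1
      rw [hεsq]
      field_simp
    have main : ∀ (η : ℝ≥0) (alg : Algorithm D Φ O T), IsExOPlus alg L (4 * (1 / ε ^ 2)) η →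
        RiskBound.{u, v, w, z} alg L δ ((v + 5 * Δ + η : ℝ≥0) : ℝ≥0∞) := by
      intro η alg halg
      refine (riskBound_of_offsetBound hne hcov hT hδ hL hγ hoff halg).mono ?_
      rw [hlog, ← ENNReal.ofReal_coe_nnreal]
      refine ENNReal.ofReal_le_ofReal (le_of_eq ?_)
      push_cast
      ring
    have hbound : v + 5 * Δ + Δ ≤ 69 * (v + Δ) := by
      calc v + 5 * Δ + Δ = 1 * v + 6 * Δ := by ring
        _ ≤ 69 * v + 69 * Δ := by gcongr <;> norm_num
        _ = 69 * (v + Δ) := by ring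
    refine ⟨4 * (1 / ε ^ 2), by positivity, fun η hη => ?_, fun η alg halg => ?_⟩
    · obtain ⟨alg, halg, -⟩ := exists_isExOPlus hne hT L (γ := 4 * (1 / ε ^ 2))
        (by positivity) (lt_min hη hΔ) id (fun _ _ _ _ => le_rfl)
      refine ⟨alg, halg.mono (min_le_left _ _), (main _ alg (halg.mono (min_le_right _ _))).mono ?_⟩
      rw [hveq]
      exact_mod_cast hbound
    · refine (main η alg halg).mono ?_
      rw [hveq]
      have : v + 5 * Δ + η ≤ 69 * (v + Δ) + η := by
        gcongr
        exact (le_add_of_nonneg_right (by positivity)).trans hbound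
      exact_mod_cast this
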